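/- Consider the class of equations $u_t+a(u^2)_x=g(t)u_{xx}$, where $a$ is a nonzero constant and $g$ is a smooth nonvanishing function on an open interval. A generalized equivalence transformation of the class is a (local) point transformation $(t,x,u,a,g)\mapsto(\tilde t,\tilde x,\tilde u,\tilde a,\tilde g)$ (smooth, with nonzero Jacobian) of the space of variables and arbitrary elements that maps every equation of the class to an equation of the class; its domain is an open set where $ag\neq0$ and whose slices over fixed $a$ are connected. The generalized equivalence group $\hat G^{\sim}_2$ of the class comprises the transformations \[ \tilde t=\frac{\alpha t+\beta}{\gamma t+\delta},\qquad \tilde x=\frac{\kappa x+\mu_1t+\mu_0}{\gamma t+\delta},\qquad \tilde u=\frac{\sigma}{2a(\alpha\delta-\beta\gamma)}\bigl(2a\kappa(\gamma t+\delta)u-\kappa\gamma x+\mu_1\delta-\mu_0\gamma\bigr), \] \[ \tilde a=\frac a\sigma,\qquad \tilde g=\frac{\kappa^2}{\alpha\delta-\beta\gamma}\,g, \] where $\alpha,\beta,\gamma,\delta,\kappa,\mu_1,\mu_0,\sigma$ are constants with $\alpha\delta-\beta\gamma\neq0$ and $\kappa\sigma\neq0$, the tuple $(\alpha,\beta,\gamma,\delta,\kappa,\mu_1,\mu_0)$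 being defined up to a nonzero multiplier. Precisely: for all values of the constants this is a generalized equivalence transformation (on every domain as above where $\gamma t+\delta\ne0$), and these transformations form a group under composition (where defined); a point transformation of $(t,x,u,a,g)$ is a generalized equivalence transformation if and only if for each fixed value of the constant $a$ it coincides with one of them (so the parameters do not depend on $t,x,u,g$; their values may be chosen differently for different values of the constant $a$); and two sets of constants give the same transformation for a given value of $a$ if and only if they have the same $\sigma$ and their tuples $(\alpha,\beta,\gamma,\delta,\kappa,\mu_1,\mu_0)$ differ by a nonzero multiplier. -/

import Mathlib

open scoped ContDiff Topology

/-- The space of the variables and the arbitrary elements, with coordinates `(t, x, u, a, g)`. -/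
abbrev ExtSpace : Type := ℝ × ℝ × ℝ × ℝ × ℝ

namespace ExtSpace

/-- The coordinate `t`. -/
abbrev t (z : ExtSpace) : ℝ := z.1
/-- The coordinate `x`. -/
abbrev x (z : ExtSpace) : ℝ := z.2.1
/-- The coordinate `u`. -/
abbrev u (z : ExtSpace) : ℝ := z.2.2.1
/-- The coordinate `a`. -/
abbrev a (z : ExtSpace) : ℝ := z.2.2.2.1
/-- The coordinate `g`. -/
abbrev g (z : ExtSpace) : ℝ := z.2.2.2.2

end ExtSpace

/-- An equation `u_t + a (u ^ 2)_x = g(t) u_xx` of the class: `a` is a nonzero constant and `g` is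
a smooth nonvanishing function on an open interval `I` (bounded or not). -/
structure BurgersEq where
  a : ℝ
  I : Set ℝ
  g : ℝ → ℝ
  a_ne_zero : a ≠ 0
  isOpen_I : IsOpen I
  ordConnected_I : I.OrdConnected
  smooth_g : ContDiffOn ℝ ∞ g I
  g_ne_zero : ∀ t ∈ I, g t ≠ 0

namespace BurgersEq

/-- The function `u` of `(t, x)` satisfies the equation at the one point `(t, x)`; that is, the
second-order jet of `u` at `(t, x)` lies on the manifold in the jet space `J²` which the equation
determines. -/
def HoldsAt (E : BurgersEq) (u : ℝ × ℝ → ℝ) (t x : ℝ) : Prop :=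
  deriv (fun s => u (s, x)) t + E.a * deriv (fun y => u (t, y) ^ 2) x =
    E.g t * iteratedDeriv 2 (fun y => u (t, y)) x

/-- The point of the extended space over `(t, x, u)` given by the arbitrary elements of `E`. -/
def lift (E : BurgersEq) (t x u : ℝ) : ExtSpace := (t, x, u, E.a, E.g t)

end BurgersEq

/-- Domains of local transformations of the extended space: open sets on which `a` and `g` do not
vanish and whose slices over fixed values of `a` are connected (for instance, products of open
intervals, or convex open sets). -/
structure IsExtDomain (Ω : Set ExtSpace) : Prop where
  isOpen : IsOpen Ω
  a_ne_zero : ∀ z ∈ Ω, z.a ≠ 0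
  g_ne_zero : ∀ z ∈ Ω, z.g ≠ 0
  slice_connected : ∀ a : ℝ, IsPreconnected {z ∈ Ω | z.a = a}

/-- A (local) point transformation of the extended space: smooth, with nonzero Jacobian. -/
structure IsPointTransformation (Ω : Set ExtSpace) (Φ : ExtSpace → ExtSpace) : Prop where
  smooth : ContDiffOn ℝ ∞ Φ Ω
  jacobian_ne_zero : ∀ z ∈ Ω, (fderiv ℝ Φ z).det ≠ 0

/-- The transformation `Φ` with domain `Ω` maps the equation `E` to the equation `E'`:
* the values of the arbitrary elements of `E` are mapped to the values of those of `E'`;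
* the transformation of `(t, x, u)` that `Φ` induces for the arbitrary elements of `E` maps the
  equation `E` to the equation `E'` (its second prolongation maps the manifold of `E` in `J²` into
  the manifold of `E'`): if the graph of `v` is the image of the graph of `u` near a point and `u`
  satisfies `E` at that point, then `v` satisfies `E'` at the image point. -/
structure MapsEq (Ω : Set ExtSpace) (Φ : ExtSpace → ExtSpace) (E E' : BurgersEq) : Prop where
  map_elements : ∀ t x u : ℝ, t ∈ E.I → E.lift t x u ∈ Ω →
    (Φ (E.lift t x u)).a = E'.a ∧
    (Φ (E.lift t x u)).t ∈ E'.I ∧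
    (Φ (E.lift t x u)).g = E'.g (Φ (E.lift t x u)).t
  map_jets : ∀ (u v : ℝ × ℝ → ℝ) (t x : ℝ), t ∈ E.I → E.lift t x (u (t, x)) ∈ Ω →
    ContDiffAt ℝ ∞ u (t, x) →
    ContDiffAt ℝ ∞ v ((Φ (E.lift t x (u (t, x)))).t, (Φ (E.lift t x (u (t, x)))).x) →
    (∀ᶠ q : ℝ × ℝ in 𝓝 (t, x),
      v ((Φ (E.lift q.1 q.2 (u q))).t, (Φ (E.lift q.1 q.2 (u q))).x) =
        (Φ (E.lift q.1 q.2 (u q))).u) →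
    E.HoldsAt u t x →
    E'.HoldsAt v (Φ (E.lift t x (u (t, x)))).t (Φ (E.lift t x (u (t, x)))).x

/-- `Φ` is a generalized equivalence transformation of the class, with domain `Ω`: a point
transformation of the extended space (all components may depend on all of `t, x, u, a, g`) that
maps every equation of the class to an equation of the class. -/
structure IsGenEquiv (Ω : Set ExtSpace) (Φ : ExtSpace → ExtSpace) : Prop where
  isPointTransformation : IsPointTransformation Ω Φ
  maps_class : ∀ E : BurgersEq, ∃ E' : BurgersEq, MapsEq Ω Φ E E'

/-- The constants that parameterize the transformations. -/
structure ProjParams where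
  α : ℝ
  β : ℝ
  γ : ℝ
  δ : ℝ
  κ : ℝ
  μ₁ : ℝ
  μ₀ : ℝ
  σ : ℝ
  disc_ne_zero : α * δ - β * γ ≠ 0
  κσ_ne_zero : κ * σ ≠ 0

namespace ProjParams

/-- The transformation of `(t, x, u, a, g)` with the constants `p`, considered where
`γ t + δ ≠ 0` and `a ≠ 0`. -/
noncomputable def toMap (p : ProjParams) (z : ExtSpace) : ExtSpace :=
  ((p.α * z.t + p.β) / (p.γ * z.t + p.δ),
   (p.κ * z.x + p.μ₁ * z.t + p.μ₀) / (p.γ * z.t + p.δ),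
   p.σ / (2 * z.a * (p.α * p.δ - p.β * p.γ)) *
     (2 * z.a * p.κ * (p.γ * z.t + p.δ) * z.u - p.κ * p.γ * z.x + p.μ₁ * p.δ - p.μ₀ * p.γ),
   z.a / p.σ,
   p.κ ^ 2 / (p.α * p.δ - p.β * p.γ) * z.g)

/-- The tuples `(α, β, γ, δ, κ, μ₁, μ₀)` differ by a nonzero multiplier, and `σ` is the same. -/
def Equivalent (p q : ProjParams) : Prop :=
  (∃ c : ℝ, c ≠ 0 ∧ q.α = c * p.α ∧ q.β = c * p.β ∧ q.γ = c * p.γ ∧ q.δ = c * p.δ ∧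
    q.κ = c * p.κ ∧ q.μ₁ = c * p.μ₁ ∧ q.μ₀ = c * p.μ₀) ∧ q.σ = p.σ

end ProjParams

/-! Necessity. Write `T, X, U` for the `t, x, u` components of the transformation and `a', g'` for
the image values of the arbitrary elements. Through each point `z` of the domain and for each real
slope `s` there passes an equation of the class whose coefficient is affine in `t` with derivative
`s` (`affineEq`). Its image has a constant `a'` and a coefficient that depends on the new time
alone, so on the tangent directions of such an equation `da' = 0` and `dg'` is a multiple of `dT`.
Nondegeneracy of the Jacobian therefore passes to `(T, X, U)` as functions of `(t, x, u)`, for every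
`s` (`fderiv_elements`, `injective_of_slope`).

Quadratic test functions turn the transformation rule into algebra on second-order jets
(`jet_transfer`), and the free quantities are varied one at a time. Varying `u_tt` forces `T_x = T_u
= 0`, and varying `s` then forces `T_g = 0`. Varying `u_t` gives `X_u = 0` and `g X_x ^ 2 = g' T_t`.
Varying `s` again gives `X_g = U_g = 0`. Shifting `g` and varying `u_x` splits what is left into `2
a' T_t U = 2 a u X_x + X_t` and `U_t + 2 a u U_x = 0` (`determining_equations`).

Since `g'` and `T_t` do not depend on `x`, neither does `X_x`, so `X = X₁(t) x + X₀(t)`. With `P =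
X₁ / T'`, `Q = X₁' / T'`, `R = X₀' / T'` the first equation reads `2 a' U = 2 a u P + Q x + R`, and
the second becomes `P' = -Q`, `Q' = R' = 0`. Hence `X₁ ^ 2 / T'` is constant, `1 / X₁` is affine in
`t`, `T` is fractional linear and `X₀` is affine in `T` (`projective_of_ode`). The local parameters
so found glue along a connected slice, because the germ of a listed map within a slice determines
its constants up to the multiplier.

Sufficiency is the chain rule (`jet_rule`), together with the construction of the image equation on
an interval (`imageEq`). The group law is multiplication of matrices. -/

/-- The second derivative of `f` at `q` along the straight line with direction `c`. -/
noncomputable def secondLineDeriv {V : Type*} [NormedAddCommGroup V] [NormedSpace ℝ V]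
    (f : V → ℝ) (q c : V) : ℝ :=
  deriv (deriv fun τ : ℝ => f (q + τ • c)) 0

/-! ### Second derivatives along curves. -/

section SecondOrder

variable {V : Type*} [NormedAddCommGroup V] [NormedSpace ℝ V]

theorem deriv_deriv_comp {f : V → ℝ} {c : ℝ → V} {τ : ℝ}
    (hf : ContDiffAt ℝ ∞ f (c τ)) (hc : ContDiffAt ℝ ∞ c τ) :
    deriv (deriv fun s => f (c s)) τ =
      fderiv ℝ (fderiv ℝ f) (c τ) (deriv c τ) (deriv c τ) +
        fderiv ℝ f (c τ) (deriv (deriv c) τ) := by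
  have hf1 : ∀ᶠ y in 𝓝 (c τ), DifferentiableAt ℝ f y :=
    ((hf.of_le (by norm_cast : (1 : WithTop ℕ∞) ≤ ∞)).eventually (by simp)).mono
      fun y hy => hy.differentiableAt (by simp)
  have hc1 : ∀ᶠ s in 𝓝 τ, DifferentiableAt ℝ c s :=
    ((hc.of_le (by norm_cast : (1 : WithTop ℕ∞) ≤ ∞)).eventually (by simp)).mono
      fun y hy => hy.differentiableAt (by simp)
  have h1 : (deriv fun s => f (c s)) =ᶠ[𝓝 τ] fun s => fderiv ℝ f (c s) (deriv c s) := by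
    filter_upwards [hc.continuousAt.eventually hf1, hc1] with s hs hs'
    exact (hs.hasFDerivAt.comp_hasDerivAt s hs'.hasDerivAt).deriv
  rw [h1.deriv_eq]
  have hf2 : DifferentiableAt ℝ (fderiv ℝ f) (c τ) :=
    (hf.fderiv_right (m := 1) (by norm_cast)).differentiableAt (by simp)
  have hc2 : DifferentiableAt ℝ (deriv c) τ := by
    have : DifferentiableAt ℝ (fderiv ℝ c) τ :=
      (hc.fderiv_right (m := 1) (by norm_cast)).differentiableAt (by simp)
    exact this.clm_apply (differentiableAt_const _)
  exact ((hf2.hasFDerivAt.comp_hasDerivAt τ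
    (hc.differentiableAt (by simp)).hasDerivAt).clm_apply hc2.hasDerivAt).deriv

theorem secondLineDeriv_eq {f : V → ℝ} {q : V} (hf : ContDiffAt ℝ ∞ f q) (c : V) :
    secondLineDeriv f q c = fderiv ℝ (fderiv ℝ f) q c c := by
  have h1 : ∀ s : ℝ, HasDerivAt (fun τ : ℝ => q + τ • c) c s := fun s => by
    simpa using ((hasDerivAt_id s).smul_const c).const_add q
  have h2 : deriv (fun τ : ℝ => q + τ • c) = fun _ => c := funext fun s => (h1 s).deriv
  have := deriv_deriv_comp (f := f) (c := fun τ : ℝ => q + τ • c) (τ := 0) (by simpa using hf)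
    (by fun_prop)
  rw [secondLineDeriv, this, h2]
  simp

/-- The second derivative of `f` along a curve whose acceleration is constant. -/
theorem deriv_deriv_comp_eq_secondLineDeriv {f : V → ℝ} {c : ℝ → V} {τ : ℝ}
    (hf : ContDiffAt ℝ ∞ f (c τ)) (hc : ContDiffAt ℝ ∞ c τ) :
    deriv (deriv fun s => f (c s)) τ =
      secondLineDeriv f (c τ) (deriv c τ) + fderiv ℝ f (c τ) (deriv (deriv c) τ) := by
  rw [deriv_deriv_comp hf hc, secondLineDeriv_eq hf]

end SecondOrder

/-! ### Functions of `(t, x)` and the equation at a point. -/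

section Plane

theorem hasDerivAt_prodMk_left (t x : ℝ) : HasDerivAt (fun s : ℝ => (s, x)) (1, 0) t :=
  (hasDerivAt_id t).prodMk (hasDerivAt_const t x)

theorem hasDerivAt_prodMk_right (t x : ℝ) : HasDerivAt (fun y : ℝ => (t, y)) (0, 1) x :=
  (hasDerivAt_const x t).prodMk (hasDerivAt_id x)

theorem deriv_deriv_snd {v : ℝ × ℝ → ℝ} {t x : ℝ} (hv : ContDiffAt ℝ ∞ v (t, x)) :
    deriv (deriv fun y => v (t, y)) x = secondLineDeriv v (t, x) (0, 1) := by
  have hc : deriv (fun y : ℝ => (t, y)) = fun _ => ((0 : ℝ), (1 : ℝ)) :=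
    funext fun y => (hasDerivAt_prodMk_right t y).deriv
  have := deriv_deriv_comp_eq_secondLineDeriv (f := v) (c := fun y : ℝ => (t, y)) (τ := x) hv
    (by fun_prop)
  rw [this, hc]
  simp

/-- The equation at a point in terms of Fréchet derivatives. -/
theorem burgers_jet_iff {v : ℝ × ℝ → ℝ} {t x : ℝ} (hv : ContDiffAt ℝ ∞ v (t, x)) (a g : ℝ) :
    (deriv (fun s => v (s, x)) t + a * deriv (fun y => v (t, y) ^ 2) x =
        g * iteratedDeriv 2 (fun y => v (t, y)) x) ↔
      fderiv ℝ v (t, x) (1, 0) + 2 * a * v (t, x) * fderiv ℝ v (t, x) (0, 1) =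
        g * secondLineDeriv v (t, x) (0, 1) := by
  have hd : DifferentiableAt ℝ v (t, x) := hv.differentiableAt (by simp)
  have h1 : HasDerivAt (fun s => v (s, x)) (fderiv ℝ v (t, x) (1, 0)) t :=
    hd.hasFDerivAt.comp_hasDerivAt t (hasDerivAt_prodMk_left t x)
  have h2 : HasDerivAt (fun y => v (t, y)) (fderiv ℝ v (t, x) (0, 1)) x :=
    hd.hasFDerivAt.comp_hasDerivAt x (hasDerivAt_prodMk_right t x)
  have h3 : iteratedDeriv 2 (fun y => v (t, y)) x = secondLineDeriv v (t, x) (0, 1) := by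
    rw [iteratedDeriv_succ, iteratedDeriv_one, deriv_deriv_snd hv]
  have h4 : HasDerivAt (fun y => v (t, y) ^ 2) _ x := h2.pow 2
  rw [h1.deriv, h4.deriv, h3]
  simp only [Nat.cast_ofNat, Nat.add_one_sub_one, pow_one]
  constructor <;> intro h <;> linarith

/-- A function of the plane factors through a local diffeomorphism. -/
theorem exists_contDiffAt_comp_eq {ψ : ℝ × ℝ → ℝ × ℝ} {F : ℝ × ℝ → ℝ} {q : ℝ × ℝ}
    (hψ : ContDiffAt ℝ ∞ ψ q) (hF : ContDiffAt ℝ ∞ F q)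
    (hinj : ∀ w, fderiv ℝ ψ q w = 0 → w = 0) :
    ∃ v : ℝ × ℝ → ℝ, ContDiffAt ℝ ∞ v (ψ q) ∧ ∀ᶠ y in 𝓝 q, v (ψ y) = F y := by
  have hker : Function.Injective (fderiv ℝ ψ q : ℝ × ℝ →ₗ[ℝ] ℝ × ℝ) :=
    (injective_iff_map_eq_zero _).2 hinj
  let e : (ℝ × ℝ) ≃L[ℝ] (ℝ × ℝ) :=
    (LinearEquiv.ofInjectiveEndo (fderiv ℝ ψ q : ℝ × ℝ →ₗ[ℝ] ℝ × ℝ) hker).toContinuousLinearEquiv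
  have he : HasFDerivAt ψ (e : ℝ × ℝ →L[ℝ] ℝ × ℝ) q := by
    have : (e : ℝ × ℝ →L[ℝ] ℝ × ℝ) = fderiv ℝ ψ q := by ext <;> rfl
    rw [this]
    exact (hψ.differentiableAt (by simp)).hasFDerivAt
  have hn : (∞ : WithTop ℕ∞) ≠ 0 := by simp
  refine ⟨F ∘ hψ.localInverse he hn, ?_, ?_⟩
  · have h1 := hψ.to_localInverse he hn
    refine ContDiffAt.comp _ ?_ h1
    rw [hψ.localInverse_apply_image he hn]
    exact hF
  · have h := (hψ.hasStrictFDerivAt' he hn).eventually_left_inverse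
    filter_upwards [h] with y hy
    exact congrArg F hy

end Plane

/-! ### The transformation rule as algebra on second-order jets. -/

section JetTransfer

/-- What the transformation rule for smooth solutions at a point says about the derivatives of the
components `T`, `X`, `U` of the transformation: `p`, `q`, `A`, `C` are the derivatives
`u_t`, `u_x`, `u_tt`, `u_xx` of the test function (with `u_tx = 0`), `(e₁, e₂)` is the direction
mapped to `∂_x`, and `v₁`, `v₂`, `v₃` are `v_t`, `v_x`, `v_xx`. -/
theorem jet_transfer {T X U : ℝ × ℝ × ℝ → ℝ} {t₀ x₀ u₀ a g a' g' : ℝ}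
    (hT : ContDiffAt ℝ ∞ T (t₀, x₀, u₀)) (hX : ContDiffAt ℝ ∞ X (t₀, x₀, u₀))
    (hU : ContDiffAt ℝ ∞ U (t₀, x₀, u₀))
    (H : ∀ u v : ℝ × ℝ → ℝ, u (t₀, x₀) = u₀ → ContDiffAt ℝ ∞ u (t₀, x₀) →
      ContDiffAt ℝ ∞ v (T (t₀, x₀, u₀), X (t₀, x₀, u₀)) →
      (∀ᶠ q : ℝ × ℝ in 𝓝 (t₀, x₀),
        v (T (q.1, q.2, u q), X (q.1, q.2, u q)) = U (q.1, q.2, u q)) →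
      (deriv (fun s => u (s, x₀)) t₀ + a * deriv (fun y => u (t₀, y) ^ 2) x₀ =
        g * iteratedDeriv 2 (fun y => u (t₀, y)) x₀) →
      deriv (fun s => v (s, X (t₀, x₀, u₀))) (T (t₀, x₀, u₀)) +
          a' * deriv (fun y => v (T (t₀, x₀, u₀), y) ^ 2) (X (t₀, x₀, u₀)) =
        g' * iteratedDeriv 2 (fun y => v (T (t₀, x₀, u₀), y)) (X (t₀, x₀, u₀)))
    (p q A C : ℝ) (hjet : p + 2 * a * u₀ * q = g * C)
    (hJ : fderiv ℝ T (t₀, x₀, u₀) (1, 0, p) * fderiv ℝ X (t₀, x₀, u₀) (0, 1, q) -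
      fderiv ℝ T (t₀, x₀, u₀) (0, 1, q) * fderiv ℝ X (t₀, x₀, u₀) (1, 0, p) ≠ 0)
    (e₁ e₂ : ℝ)
    (heT : e₁ * fderiv ℝ T (t₀, x₀, u₀) (1, 0, p) + e₂ * fderiv ℝ T (t₀, x₀, u₀) (0, 1, q) = 0)
    (heX : e₁ * fderiv ℝ X (t₀, x₀, u₀) (1, 0, p) + e₂ * fderiv ℝ X (t₀, x₀, u₀) (0, 1, q) = 1) :
    ∃ v₁ v₂ v₃ : ℝ,
      v₁ * fderiv ℝ T (t₀, x₀, u₀) (1, 0, p) + v₂ * fderiv ℝ X (t₀, x₀, u₀) (1, 0, p) =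
        fderiv ℝ U (t₀, x₀, u₀) (1, 0, p) ∧
      v₁ * fderiv ℝ T (t₀, x₀, u₀) (0, 1, q) + v₂ * fderiv ℝ X (t₀, x₀, u₀) (0, 1, q) =
        fderiv ℝ U (t₀, x₀, u₀) (0, 1, q) ∧
      v₁ + 2 * a' * U (t₀, x₀, u₀) * v₂ = g' * v₃ ∧
      v₃ + v₁ * (secondLineDeriv T (t₀, x₀, u₀) (e₁, e₂, p * e₁ + q * e₂) +
          (A * e₁ ^ 2 + C * e₂ ^ 2) * fderiv ℝ T (t₀, x₀, u₀) (0, 0, 1)) +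
        v₂ * (secondLineDeriv X (t₀, x₀, u₀) (e₁, e₂, p * e₁ + q * e₂) +
          (A * e₁ ^ 2 + C * e₂ ^ 2) * fderiv ℝ X (t₀, x₀, u₀) (0, 0, 1)) =
        secondLineDeriv U (t₀, x₀, u₀) (e₁, e₂, p * e₁ + q * e₂) +
          (A * e₁ ^ 2 + C * e₂ ^ 2) * fderiv ℝ U (t₀, x₀, u₀) (0, 0, 1) := by
  set z₀ : ℝ × ℝ × ℝ := (t₀, x₀, u₀) with hz₀
  -- A polynomial realizing the prescribed second-order jet; the mixed derivative is set to zero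
  -- because varying it is never needed.
  let u : ℝ × ℝ → ℝ := fun y =>
    u₀ + p * (y.1 - t₀) + q * (y.2 - x₀) + A / 2 * (y.1 - t₀) ^ 2 + C / 2 * (y.2 - x₀) ^ 2
  have hu0 : u (t₀, x₀) = u₀ := by simp [u]
  have hu : ContDiff ℝ ∞ u := by fun_prop
  have hlift : ContDiff ℝ ∞ fun y : ℝ × ℝ => ((y.1, y.2, u y) : ℝ × ℝ × ℝ) := by fun_prop
  have hz : ((t₀, x₀).1, (t₀, x₀).2, u (t₀, x₀)) = z₀ := by simp [hz₀, hu0]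
  -- the derivatives of `u` along the axes and of the lift
  have hcurve : ∀ (w₁ w₂ τ : ℝ), HasDerivAt
      (fun τ : ℝ => ((t₀ + τ * w₁, x₀ + τ * w₂, u (t₀ + τ * w₁, x₀ + τ * w₂)) : ℝ × ℝ × ℝ))
      (w₁, w₂, p * w₁ + q * w₂ + τ * (A * w₁ ^ 2 + C * w₂ ^ 2)) τ := by
    intro w₁ w₂ τ
    have h1 : HasDerivAt (fun τ : ℝ => t₀ + τ * w₁) w₁ τ := by
      simpa using ((hasDerivAt_id τ).mul_const w₁).const_add t₀
    have h2 : HasDerivAt (fun τ : ℝ => x₀ + τ * w₂) w₂ τ := by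
      simpa using ((hasDerivAt_id τ).mul_const w₂).const_add x₀
    refine h1.prodMk (h2.prodMk ?_)
    have h3 : (fun τ : ℝ => u (t₀ + τ * w₁, x₀ + τ * w₂)) = fun τ : ℝ =>
        u₀ + τ * (p * w₁ + q * w₂) + τ ^ 2 * ((A * w₁ ^ 2 + C * w₂ ^ 2) / 2) := by
      funext τ; simp only [u]; ring
    rw [h3]
    have h4 := (((hasDerivAt_id τ).mul_const (p * w₁ + q * w₂)).const_add u₀).add
      (((hasDerivAt_id τ).pow 2).mul_const ((A * w₁ ^ 2 + C * w₂ ^ 2) / 2))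
    refine h4.congr_deriv ?_
    simp; ring
  have hcurve0 : ∀ (w₁ w₂ : ℝ),
      ((t₀ + 0 * w₁, x₀ + 0 * w₂, u (t₀ + 0 * w₁, x₀ + 0 * w₂)) : ℝ × ℝ × ℝ) = z₀ := by
    intro w₁ w₂; simp [hz₀, hu0]
  have hcurveC : ∀ (w₁ w₂ : ℝ), ContDiff ℝ ∞ (fun τ : ℝ =>
      ((t₀ + τ * w₁, x₀ + τ * w₂, u (t₀ + τ * w₁, x₀ + τ * w₂)) : ℝ × ℝ × ℝ)) := by
    intro w₁ w₂; fun_prop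
  have hd1 : ∀ (w₁ w₂ : ℝ), deriv (fun τ : ℝ =>
      ((t₀ + τ * w₁, x₀ + τ * w₂, u (t₀ + τ * w₁, x₀ + τ * w₂)) : ℝ × ℝ × ℝ)) =
      fun τ => (w₁, w₂, p * w₁ + q * w₂ + τ * (A * w₁ ^ 2 + C * w₂ ^ 2)) :=
    fun w₁ w₂ => funext fun τ => (hcurve w₁ w₂ τ).deriv
  have hd2 : ∀ (w₁ w₂ : ℝ), deriv (deriv (fun τ : ℝ =>
      ((t₀ + τ * w₁, x₀ + τ * w₂, u (t₀ + τ * w₁, x₀ + τ * w₂)) : ℝ × ℝ × ℝ))) 0 =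
      (A * w₁ ^ 2 + C * w₂ ^ 2) • ((0, 0, 1) : ℝ × ℝ × ℝ) := by
    intro w₁ w₂
    rw [hd1]
    have : HasDerivAt (fun τ : ℝ => ((w₁, w₂, p * w₁ + q * w₂ + τ * (A * w₁ ^ 2 + C * w₂ ^ 2)) :
        ℝ × ℝ × ℝ)) (0, 0, A * w₁ ^ 2 + C * w₂ ^ 2) 0 := by
      refine (hasDerivAt_const _ _).prodMk ((hasDerivAt_const _ _).prodMk ?_)
      simpa using ((hasDerivAt_id (0 : ℝ)).mul_const (A * w₁ ^ 2 + C * w₂ ^ 2)).const_add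
        (p * w₁ + q * w₂)
    rw [this.deriv]; simp
  -- first and second derivatives along the lifted lines
  have first : ∀ {f : ℝ × ℝ × ℝ → ℝ}, ContDiffAt ℝ ∞ f z₀ → ∀ w₁ w₂ : ℝ,
      HasDerivAt (fun τ : ℝ => f (t₀ + τ * w₁, x₀ + τ * w₂, u (t₀ + τ * w₁, x₀ + τ * w₂)))
        (w₁ * fderiv ℝ f z₀ (1, 0, p) + w₂ * fderiv ℝ f z₀ (0, 1, q)) 0 := by
    intro f hf w₁ w₂
    have hd := (hf.differentiableAt (by simp)).hasFDerivAt
    rw [← hcurve0 w₁ w₂] at hd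
    have := hd.comp_hasDerivAt (0 : ℝ) (hcurve w₁ w₂ 0)
    rw [hcurve0 w₁ w₂] at this
    refine this.congr_deriv ?_
    have hw : ((w₁, w₂, p * w₁ + q * w₂ + 0 * (A * w₁ ^ 2 + C * w₂ ^ 2)) : ℝ × ℝ × ℝ) =
        w₁ • (1, 0, p) + w₂ • (0, 1, q) := by simp [mul_comm]
    rw [hw, map_add, map_smul, map_smul, smul_eq_mul, smul_eq_mul]
  have second : ∀ {f : ℝ × ℝ × ℝ → ℝ}, ContDiffAt ℝ ∞ f z₀ → ∀ w₁ w₂ : ℝ,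
      deriv (deriv fun τ : ℝ => f (t₀ + τ * w₁, x₀ + τ * w₂, u (t₀ + τ * w₁, x₀ + τ * w₂))) 0 =
        secondLineDeriv f z₀ (w₁, w₂, p * w₁ + q * w₂) +
          (A * w₁ ^ 2 + C * w₂ ^ 2) * fderiv ℝ f z₀ (0, 0, 1) := by
    intro f hf w₁ w₂
    have h := deriv_deriv_comp_eq_secondLineDeriv (f := f) (τ := 0)
      (by rw [hcurve0 w₁ w₂]; exact hf) (hcurveC w₁ w₂).contDiffAt
    rw [h, hcurve0 w₁ w₂, hd2, hd1, map_smul, smul_eq_mul]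
    simp
  -- the induced local diffeomorphism of the plane
  let ψ : ℝ × ℝ → ℝ × ℝ := fun y => (T (y.1, y.2, u y), X (y.1, y.2, u y))
  have comp : ∀ {f : ℝ × ℝ × ℝ → ℝ}, ContDiffAt ℝ ∞ f z₀ →
      ContDiffAt ℝ ∞ (fun y : ℝ × ℝ => f (y.1, y.2, u y)) (t₀, x₀) := by
    intro f hf
    refine ContDiffAt.comp (t₀, x₀) ?_ hlift.contDiffAt
    rw [hz]; exact hf
  have hψ : ContDiffAt ℝ ∞ ψ (t₀, x₀) := (comp hT).prodMk (comp hX)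
  have line : ∀ w₁ w₂ : ℝ, HasDerivAt (fun τ : ℝ => (t₀ + τ * w₁, x₀ + τ * w₂)) (w₁, w₂) 0 := by
    intro w₁ w₂
    refine HasDerivAt.prodMk ?_ ?_
    · simpa using ((hasDerivAt_id (0 : ℝ)).mul_const w₁).const_add t₀
    · simpa using ((hasDerivAt_id (0 : ℝ)).mul_const w₂).const_add x₀
  have hψd : ∀ w₁ w₂ : ℝ, fderiv ℝ ψ (t₀, x₀) (w₁, w₂) =
      (w₁ * fderiv ℝ T z₀ (1, 0, p) + w₂ * fderiv ℝ T z₀ (0, 1, q),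
        w₁ * fderiv ℝ X z₀ (1, 0, p) + w₂ * fderiv ℝ X z₀ (0, 1, q)) := by
    intro w₁ w₂
    have h1 : HasFDerivAt ψ (fderiv ℝ ψ (t₀, x₀)) (t₀ + 0 * w₁, x₀ + 0 * w₂) := by
      simpa using (hψ.differentiableAt (by simp)).hasFDerivAt
    have h2 := h1.comp_hasDerivAt (0 : ℝ) (line w₁ w₂)
    exact h2.unique ((first hT w₁ w₂).prodMk (first hX w₁ w₂))
  have hinj : ∀ w, fderiv ℝ ψ (t₀, x₀) w = 0 → w = 0 := by
    rintro ⟨w₁, w₂⟩ hw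
    rw [hψd] at hw
    obtain ⟨h1, h2⟩ := Prod.ext_iff.1 hw
    simp only [Prod.fst_zero, Prod.snd_zero] at h1 h2
    have k1 : w₁ * (fderiv ℝ T z₀ (1, 0, p) * fderiv ℝ X z₀ (0, 1, q) -
        fderiv ℝ T z₀ (0, 1, q) * fderiv ℝ X z₀ (1, 0, p)) = 0 := by
      linear_combination fderiv ℝ X z₀ (0, 1, q) * h1 - fderiv ℝ T z₀ (0, 1, q) * h2
    have k2 : w₂ * (fderiv ℝ T z₀ (1, 0, p) * fderiv ℝ X z₀ (0, 1, q) -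
        fderiv ℝ T z₀ (0, 1, q) * fderiv ℝ X z₀ (1, 0, p)) = 0 := by
      linear_combination fderiv ℝ T z₀ (1, 0, p) * h2 - fderiv ℝ X z₀ (1, 0, p) * h1
    rw [(mul_eq_zero.1 k1).resolve_right hJ, (mul_eq_zero.1 k2).resolve_right hJ]
    rfl
  -- The image of the graph of `u` is again a graph near the point, since `ψ` is a local
  -- diffeomorphism by `hJ`; `v` is the function with this graph.
  obtain ⟨v, hv, hvψ⟩ := exists_contDiffAt_comp_eq hψ (comp hU) hinj
  have hψ0 : ψ (t₀, x₀) = (T z₀, X z₀) := by simp [ψ, hu0, hz₀]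
  rw [hψ0] at hv
  have hv0 : v (T z₀, X z₀) = U z₀ := by
    have := hvψ.self_of_nhds
    rw [hψ0] at this
    rw [this]; simp [hu0, hz₀]
  -- the test function solves the first equation
  have hueq : deriv (fun s => u (s, x₀)) t₀ + a * deriv (fun y => u (t₀, y) ^ 2) x₀ =
      g * iteratedDeriv 2 (fun y => u (t₀, y)) x₀ := by
    have hus : ∀ w₁ w₂, secondLineDeriv u (t₀, x₀) (w₁, w₂) = A * w₁ ^ 2 + C * w₂ ^ 2 := by
      intro w₁ w₂
      have : deriv (fun τ : ℝ => u ((t₀, x₀) + τ • (w₁, w₂))) =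
          fun τ => p * w₁ + q * w₂ + τ * (A * w₁ ^ 2 + C * w₂ ^ 2) := by
        funext τ
        exact ((hasFDerivAt_snd.comp_hasDerivAt τ
          (hasFDerivAt_snd.comp_hasDerivAt τ (hcurve w₁ w₂ τ)))).deriv
      rw [secondLineDeriv, this]
      simp
    have huf : ∀ w₁ w₂, fderiv ℝ u (t₀, x₀) (w₁, w₂) = p * w₁ + q * w₂ := by
      intro w₁ w₂
      have h1 : HasFDerivAt u (fderiv ℝ u (t₀, x₀)) (t₀ + 0 * w₁, x₀ + 0 * w₂) := by
        simpa using (hu.contDiffAt.differentiableAt (by simp)).hasFDerivAt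
      have h2 := h1.comp_hasDerivAt (0 : ℝ) (line w₁ w₂)
      refine h2.unique ?_
      have h3 := hasFDerivAt_snd.comp_hasDerivAt (0 : ℝ)
          (hasFDerivAt_snd.comp_hasDerivAt (0 : ℝ) (hcurve w₁ w₂ 0))
      refine HasDerivAt.congr_deriv h3 ?_
      simp
    rw [burgers_jet_iff hu.contDiffAt, huf, huf, hus, hu0]
    linarith
  have hveq := H u v hu0 hu.contDiffAt hv hvψ hueq
  rw [burgers_jet_iff hv, hv0] at hveq
  have hvd : ∀ w₁ w₂ : ℝ, fderiv ℝ v (T z₀, X z₀) (w₁, w₂) =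
      fderiv ℝ v (T z₀, X z₀) (1, 0) * w₁ + fderiv ℝ v (T z₀, X z₀) (0, 1) * w₂ := by
    intro w₁ w₂
    have : ((w₁, w₂) : ℝ × ℝ) = w₁ • (1, 0) + w₂ • (0, 1) := by simp
    rw [this, map_add, map_smul, map_smul, smul_eq_mul, smul_eq_mul, mul_comm, mul_comm w₂]
  have hline : ∀ w₁ w₂ : ℝ, Filter.Tendsto (fun τ : ℝ => (t₀ + τ * w₁, x₀ + τ * w₂)) (𝓝 0)
      (𝓝 (t₀, x₀)) := by
    intro w₁ w₂
    have := (line w₁ w₂).continuousAt.tendsto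
    simpa using this
  have hvU : ∀ w₁ w₂ : ℝ, (fun τ : ℝ => v (ψ (t₀ + τ * w₁, x₀ + τ * w₂))) =ᶠ[𝓝 0]
      fun τ : ℝ => U (t₀ + τ * w₁, x₀ + τ * w₂, u (t₀ + τ * w₁, x₀ + τ * w₂)) :=
    fun w₁ w₂ => (hline w₁ w₂).eventually hvψ
  have hψline : ∀ w₁ w₂ : ℝ, ContDiffAt ℝ ∞ (fun τ : ℝ => ψ (t₀ + τ * w₁, x₀ + τ * w₂)) 0 := by
    intro w₁ w₂
    refine ContDiffAt.comp (g := ψ) (0 : ℝ) ?_ (by fun_prop)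
    simpa using hψ
  have hψline0 : ∀ w₁ w₂ : ℝ, ψ (t₀ + 0 * w₁, x₀ + 0 * w₂) = (T z₀, X z₀) := by
    intro w₁ w₂; simp [hψ0]
  have vfirst : ∀ w₁ w₂ : ℝ,
      fderiv ℝ v (T z₀, X z₀) (1, 0) *
          (w₁ * fderiv ℝ T z₀ (1, 0, p) + w₂ * fderiv ℝ T z₀ (0, 1, q)) +
        fderiv ℝ v (T z₀, X z₀) (0, 1) *
          (w₁ * fderiv ℝ X z₀ (1, 0, p) + w₂ * fderiv ℝ X z₀ (0, 1, q)) =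
      w₁ * fderiv ℝ U z₀ (1, 0, p) + w₂ * fderiv ℝ U z₀ (0, 1, q) := by
    intro w₁ w₂
    have h1 : HasFDerivAt v (fderiv ℝ v (T z₀, X z₀)) (ψ (t₀ + 0 * w₁, x₀ + 0 * w₂)) := by
      rw [hψline0]; exact (hv.differentiableAt (by simp)).hasFDerivAt
    have h2 := h1.comp_hasDerivAt (0 : ℝ) ((first hT w₁ w₂).prodMk (first hX w₁ w₂))
    rw [hvd] at h2
    exact h2.unique ((first hU w₁ w₂).congr_of_eventuallyEq (hvU w₁ w₂))
  refine ⟨fderiv ℝ v (T z₀, X z₀) (1, 0), fderiv ℝ v (T z₀, X z₀) (0, 1),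
    secondLineDeriv v (T z₀, X z₀) (0, 1), by simpa using vfirst 1 0, by simpa using vfirst 0 1,
    hveq, ?_⟩
  -- The identity `v ∘ ψ = U` on the graph is differentiated twice along the line with direction
  -- `(e₁, e₂)`. The image curve has velocity `∂_x`, so `v_xx` is the only second derivative of `v`
  -- that appears; the acceleration of the image curve contributes the terms with `v₁` and `v₂`.
  have h2 := deriv_deriv_comp_eq_secondLineDeriv (f := v)
    (c := fun τ : ℝ => ψ (t₀ + τ * e₁, x₀ + τ * e₂)) (τ := 0)
    (by rw [hψline0]; exact hv) (hψline e₁ e₂)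
  have hψ1 : deriv (fun τ : ℝ => ψ (t₀ + τ * e₁, x₀ + τ * e₂)) 0 = (0, 1) := by
    have h3 := ((first hT e₁ e₂).prodMk (first hX e₁ e₂)).deriv
    rw [heT, heX] at h3
    exact h3
  have hψ2 : deriv (deriv fun τ : ℝ => ψ (t₀ + τ * e₁, x₀ + τ * e₂)) 0 =
      (secondLineDeriv T z₀ (e₁, e₂, p * e₁ + q * e₂) +
          (A * e₁ ^ 2 + C * e₂ ^ 2) * fderiv ℝ T z₀ (0, 0, 1),
        secondLineDeriv X z₀ (e₁, e₂, p * e₁ + q * e₂) +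
          (A * e₁ ^ 2 + C * e₂ ^ 2) * fderiv ℝ X z₀ (0, 0, 1)) := by
    have hs : DifferentiableAt ℝ (deriv fun τ : ℝ => ψ (t₀ + τ * e₁, x₀ + τ * e₂)) 0 :=
      (((hψline e₁ e₂).fderiv_right (m := 1) (by norm_cast)).differentiableAt
        (by simp)).clm_apply (differentiableAt_const _)
    have hev : ∀ᶠ τ in 𝓝 (0 : ℝ),
        DifferentiableAt ℝ (fun τ : ℝ => ψ (t₀ + τ * e₁, x₀ + τ * e₂)) τ :=
      (((hψline e₁ e₂).of_le (by norm_cast : (1 : WithTop ℕ∞) ≤ ∞)).eventually (by simp)).mono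
        fun y hy => hy.differentiableAt (by simp)
    ext
    · rw [← second hT e₁ e₂]
      have h3 := (hasFDerivAt_fst.comp_hasDerivAt (0 : ℝ) hs.hasDerivAt).deriv
      refine Eq.trans h3.symm (Filter.EventuallyEq.deriv_eq ?_)
      filter_upwards [hev] with τ hτ
      exact (hasFDerivAt_fst.comp_hasDerivAt τ hτ.hasDerivAt).deriv.symm
    · rw [← second hX e₁ e₂]
      have h3 := (hasFDerivAt_snd.comp_hasDerivAt (0 : ℝ) hs.hasDerivAt).deriv
      refine Eq.trans h3.symm (Filter.EventuallyEq.deriv_eq ?_)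
      filter_upwards [hev] with τ hτ
      exact (hasFDerivAt_snd.comp_hasDerivAt τ hτ.hasDerivAt).deriv.symm
  rw [hψ1, hψ2, hψline0, hvd] at h2
  rw [← second hU e₁ e₂, ← (hvU e₁ e₂).deriv.deriv_eq, h2]
  ring

end JetTransfer

/-! ### Test equations with affine coefficient. -/

section TestEquations

/-- The equation of the class with constant `z.a` and affine coefficient `g` that takes the value
`z.g` at `z.t` with derivative `s`, on an interval around `z.t`. -/
noncomputable def affineEq (z : ExtSpace) (ha : z.a ≠ 0) (s : ℝ) : BurgersEq where
  a := z.a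
  I := {t | 0 < z.g * (z.g + s * (t - z.t))}
  g := fun t => z.g + s * (t - z.t)
  a_ne_zero := ha
  isOpen_I := isOpen_lt continuous_const (by fun_prop)
  ordConnected_I := by
    constructor
    intro t₁ h₁ t₂ h₂ t ht
    simp only [Set.mem_ofPred_eq] at h₁ h₂ ⊢
    obtain ⟨h₃, h₄⟩ := ht
    -- The product defining the interval is affine in `t` with slope `z.g * s`; the sign of the
    -- slope decides which endpoint gives the lower bound.
    rcases le_total 0 (z.g * s) with h | h <;> nlinarith
  smooth_g := by fun_prop
  g_ne_zero := by
    intro t ht h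
    simp [h] at ht

variable {z : ExtSpace} {ha : z.a ≠ 0} {s : ℝ}

theorem affineEq_lift (q : ℝ × ℝ × ℝ) :
    (affineEq z ha s).lift q.1 q.2.1 q.2.2 =
      (q.1, q.2.1, q.2.2, z.a, z.g + s * (q.1 - z.t)) := rfl

theorem affineEq_lift_self : (affineEq z ha s).lift z.t z.x z.u = z := by
  simp [BurgersEq.lift, affineEq]

theorem mem_affineEq_I (hg : z.g ≠ 0) : z.t ∈ (affineEq z ha s).I := by
  have : 0 < z.g * z.g := mul_self_pos.2 hg
  simpa [affineEq] using this

theorem hasFDerivAt_affineEq_lift (q : ℝ × ℝ × ℝ) :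
    ∃ ℓ : ℝ × ℝ × ℝ →L[ℝ] ExtSpace, (∀ w, ℓ w = (w.1, w.2.1, w.2.2, 0, s * w.1)) ∧
      HasFDerivAt (fun q : ℝ × ℝ × ℝ => (affineEq z ha s).lift q.1 q.2.1 q.2.2) ℓ q := by
  let π₁ := ContinuousLinearMap.fst ℝ ℝ (ℝ × ℝ)
  let π₂ := (ContinuousLinearMap.fst ℝ ℝ ℝ).comp (ContinuousLinearMap.snd ℝ ℝ (ℝ × ℝ))
  let π₃ := (ContinuousLinearMap.snd ℝ ℝ ℝ).comp (ContinuousLinearMap.snd ℝ ℝ (ℝ × ℝ))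
  refine ⟨π₁.prod (π₂.prod (π₃.prod ((0 : ℝ × ℝ × ℝ →L[ℝ] ℝ).prod (s • π₁)))), fun w => rfl, ?_⟩
  refine HasFDerivAt.prodMk π₁.hasFDerivAt (HasFDerivAt.prodMk π₂.hasFDerivAt
    (HasFDerivAt.prodMk π₃.hasFDerivAt (HasFDerivAt.prodMk (hasFDerivAt_const _ _) ?_)))
  exact ((π₁.hasFDerivAt.sub_const z.t).const_mul s).const_add z.g

theorem contDiff_affineEq_lift :
    ContDiff ℝ ∞ fun q : ℝ × ℝ × ℝ => (affineEq z ha s).lift q.1 q.2.1 q.2.2 := by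
  simp only [affineEq_lift]
  fun_prop

theorem contDiffAt_comp_affineEq_lift {f : ExtSpace → ℝ} (hf : ContDiffAt ℝ ∞ f z) :
    ContDiffAt ℝ ∞ (fun q : ℝ × ℝ × ℝ => f ((affineEq z ha s).lift q.1 q.2.1 q.2.2))
      (z.t, z.x, z.u) := by
  refine ContDiffAt.comp (g := f) (z.t, z.x, z.u) ?_ contDiff_affineEq_lift.contDiffAt
  rw [affineEq_lift_self]; exact hf

theorem fderiv_comp_affineEq_lift {f : ExtSpace → ℝ} (hf : DifferentiableAt ℝ f z)
    (w : ℝ × ℝ × ℝ) :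
    fderiv ℝ (fun q : ℝ × ℝ × ℝ => f ((affineEq z ha s).lift q.1 q.2.1 q.2.2))
      (z.t, z.x, z.u) w = fderiv ℝ f z (w.1, w.2.1, w.2.2, 0, s * w.1) := by
  obtain ⟨ℓ, hℓ, h⟩ := hasFDerivAt_affineEq_lift (ha := ha) (s := s) (z.t, z.x, z.u)
  have hd : HasFDerivAt f (fderiv ℝ f z) ((affineEq z ha s).lift z.t z.x z.u) := by
    rw [affineEq_lift_self]; exact hf.hasFDerivAt
  have : HasFDerivAt (fun q : ℝ × ℝ × ℝ => f ((affineEq z ha s).lift q.1 q.2.1 q.2.2)) _ _ :=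
    HasFDerivAt.comp (z.t, z.x, z.u) hd h
  rw [this.fderiv, ContinuousLinearMap.comp_apply, hℓ]

/-- The lift of a test equation is an affine map, so no second-order term of the coefficient enters.
This is the reason for taking the coefficient affine. -/
theorem secondLineDeriv_comp_affineEq_lift (f : ExtSpace → ℝ) (w : ℝ × ℝ × ℝ) :
    secondLineDeriv (fun q : ℝ × ℝ × ℝ => f ((affineEq z ha s).lift q.1 q.2.1 q.2.2))
      (z.t, z.x, z.u) w = secondLineDeriv f z (w.1, w.2.1, w.2.2, 0, s * w.1) := by
  unfold secondLineDeriv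
  congr 2
  funext τ
  refine congrArg f (Eq.trans (affineEq_lift _) ?_)
  ext <;> simp
  ring

theorem eventually_affineEq_lift {Ω : Set ExtSpace} (hΩ : IsOpen Ω) (hz : z ∈ Ω) (hg : z.g ≠ 0) :
    ∀ᶠ q : ℝ × ℝ × ℝ in 𝓝 (z.t, z.x, z.u),
      q.1 ∈ (affineEq z ha s).I ∧ (affineEq z ha s).lift q.1 q.2.1 q.2.2 ∈ Ω := by
  refine Filter.Eventually.and ?_ ?_
  · exact continuous_fst.continuousAt.eventually
      ((affineEq z ha s).isOpen_I.mem_nhds (mem_affineEq_I hg))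
  · refine contDiff_affineEq_lift.continuous.continuousAt.eventually (hΩ.mem_nhds ?_)
    change (affineEq z ha s).lift z.t z.x z.u ∈ Ω
    rw [affineEq_lift_self]; exact hz

end TestEquations

/-! ### Differentials of the components. -/

section Components

variable {Ω : Set ExtSpace} {Φ : ExtSpace → ExtSpace} {z : ExtSpace}

theorem fderiv_comp_t (h : DifferentiableAt ℝ Φ z) (w : ExtSpace) :
    fderiv ℝ (fun y => (Φ y).t) z w = (fderiv ℝ Φ z w).t := by
  have : HasFDerivAt (fun y => (Φ y).t) _ z := h.hasFDerivAt.fst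
  rw [this.fderiv]; rfl

theorem fderiv_comp_x (h : DifferentiableAt ℝ Φ z) (w : ExtSpace) :
    fderiv ℝ (fun y => (Φ y).x) z w = (fderiv ℝ Φ z w).x := by
  have : HasFDerivAt (fun y => (Φ y).x) _ z := h.hasFDerivAt.snd.fst
  rw [this.fderiv]; rfl

theorem fderiv_comp_u (h : DifferentiableAt ℝ Φ z) (w : ExtSpace) :
    fderiv ℝ (fun y => (Φ y).u) z w = (fderiv ℝ Φ z w).u := by
  have : HasFDerivAt (fun y => (Φ y).u) _ z := h.hasFDerivAt.snd.snd.fst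
  rw [this.fderiv]; rfl

theorem fderiv_comp_a (h : DifferentiableAt ℝ Φ z) (w : ExtSpace) :
    fderiv ℝ (fun y => (Φ y).a) z w = (fderiv ℝ Φ z w).a := by
  have : HasFDerivAt (fun y => (Φ y).a) _ z := h.hasFDerivAt.snd.snd.snd.fst
  rw [this.fderiv]; rfl

theorem fderiv_comp_g (h : DifferentiableAt ℝ Φ z) (w : ExtSpace) :
    fderiv ℝ (fun y => (Φ y).g) z w = (fderiv ℝ Φ z w).g := by
  have : HasFDerivAt (fun y => (Φ y).g) _ z := h.hasFDerivAt.snd.snd.snd.snd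
  rw [this.fderiv]; rfl

theorem map_dir (L : ExtSpace →L[ℝ] ExtSpace) (b c d e : ℝ) :
    L (b, c, d, 0, e) = b • L (1, 0, 0, 0, 0) + c • L (0, 1, 0, 0, 0) + d • L (0, 0, 1, 0, 0) +
      e • L (0, 0, 0, 0, 1) := by
  rw [← map_smul, ← map_smul, ← map_smul, ← map_smul, ← map_add, ← map_add, ← map_add]
  simp

theorem IsPointTransformation.contDiffAt (h : IsPointTransformation Ω Φ) (hΩ : IsOpen Ω)
    (hz : z ∈ Ω) : ContDiffAt ℝ ∞ Φ z :=
  h.smooth.contDiffAt (hΩ.mem_nhds hz)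

theorem IsPointTransformation.differentiableAt (h : IsPointTransformation Ω Φ) (hΩ : IsOpen Ω)
    (hz : z ∈ Ω) : DifferentiableAt ℝ Φ z :=
  (h.contDiffAt hΩ hz).differentiableAt (by simp)

theorem IsPointTransformation.fderiv_eq_zero (h : IsPointTransformation Ω Φ) (hz : z ∈ Ω)
    {w : ExtSpace} (hw : fderiv ℝ Φ z w = 0) : w = 0 := by
  have h1 : LinearMap.det (fderiv ℝ Φ z : ExtSpace →ₗ[ℝ] ExtSpace) ≠ 0 := h.jacobian_ne_zero z hz
  have h2 := LinearMap.bot_lt_ker_of_det_eq_zero (f := (fderiv ℝ Φ z : ExtSpace →ₗ[ℝ] ExtSpace))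
  have h3 : LinearMap.ker (fderiv ℝ Φ z : ExtSpace →ₗ[ℝ] ExtSpace) = ⊥ := by
    refine LinearMap.ker_eq_bot.2 ?_
    have := (LinearEquiv.ofIsUnitDet (f := (fderiv ℝ Φ z : ExtSpace →ₗ[ℝ] ExtSpace))
      (v := Module.finBasis ℝ ExtSpace) (v' := Module.finBasis ℝ ExtSpace)
      (by rw [LinearMap.det_toMatrix]; exact isUnit_iff_ne_zero.2 h1)).injective
    exact this
  exact (LinearMap.ker_eq_bot'.1 h3) w hw

end Components

/-! ### First- and second-order consequences of mapping the class into itself. -/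

namespace IsGenEquiv

variable {Ω : Set ExtSpace} {Φ : ExtSpace → ExtSpace} {z : ExtSpace}

/-- Along the lift of a test equation the `a` component is the constant of the image equation, and
the `g` component is the image coefficient composed with the `t` component; the first two claims are
the derivatives of these identities. -/
theorem fderiv_elements (h : IsGenEquiv Ω Φ) (hΩ : IsExtDomain Ω) (hz : z ∈ Ω) (s : ℝ) :
    (∀ w : ℝ × ℝ × ℝ, (fderiv ℝ Φ z (w.1, w.2.1, w.2.2, 0, s * w.1)).a = 0) ∧
    (∃ c : ℝ, ∀ w : ℝ × ℝ × ℝ, (fderiv ℝ Φ z (w.1, w.2.1, w.2.2, 0, s * w.1)).g =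
      c * (fderiv ℝ Φ z (w.1, w.2.1, w.2.2, 0, s * w.1)).t) ∧
    (Φ z).g ≠ 0 := by
  have hd := h.isPointTransformation.differentiableAt hΩ.isOpen hz
  have ha := hΩ.a_ne_zero z hz
  have hg := hΩ.g_ne_zero z hz
  obtain ⟨E', hE⟩ := h.maps_class (affineEq z ha s)
  have hev := eventually_affineEq_lift (ha := ha) (s := s) hΩ.isOpen hz hg
  have h0 := hE.map_elements z.t z.x z.u (mem_affineEq_I hg) (by rw [affineEq_lift_self]; exact hz)
  rw [affineEq_lift_self] at h0
  have hT := (hd.hasFDerivAt.fst.differentiableAt : DifferentiableAt ℝ (fun y => (Φ y).t) z)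
  have hA := (hd.hasFDerivAt.snd.snd.snd.fst.differentiableAt :
    DifferentiableAt ℝ (fun y => (Φ y).a) z)
  have hG := (hd.hasFDerivAt.snd.snd.snd.snd.differentiableAt :
    DifferentiableAt ℝ (fun y => (Φ y).g) z)
  have hlift : DifferentiableAt ℝ
      (fun q : ℝ × ℝ × ℝ => (affineEq z ha s).lift q.1 q.2.1 q.2.2) (z.t, z.x, z.u) :=
    contDiff_affineEq_lift.contDiffAt.differentiableAt (by simp)
  refine ⟨fun w => ?_, ?_, ?_⟩
  · rw [← fderiv_comp_a hd, ← fderiv_comp_affineEq_lift (ha := ha) hA]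
    have : (fun q : ℝ × ℝ × ℝ => (Φ ((affineEq z ha s).lift q.1 q.2.1 q.2.2)).a)
        =ᶠ[𝓝 (z.t, z.x, z.u)] fun _ => E'.a := by
      filter_upwards [hev] with q hq
      exact (hE.map_elements _ _ _ hq.1 hq.2).1
    rw [this.fderiv_eq]
    simp
  · have hE' : DifferentiableAt ℝ E'.g (Φ z).t :=
      (E'.smooth_g.contDiffAt (E'.isOpen_I.mem_nhds h0.2.1)).differentiableAt (by simp)
    refine ⟨deriv E'.g (Φ z).t, fun w => ?_⟩
    rw [← fderiv_comp_g hd, ← fderiv_comp_affineEq_lift (ha := ha) hG, ← fderiv_comp_t hd,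
      ← fderiv_comp_affineEq_lift (ha := ha) hT]
    have : (fun q : ℝ × ℝ × ℝ => (Φ ((affineEq z ha s).lift q.1 q.2.1 q.2.2)).g)
        =ᶠ[𝓝 (z.t, z.x, z.u)]
        fun q => E'.g (Φ ((affineEq z ha s).lift q.1 q.2.1 q.2.2)).t := by
      filter_upwards [hev] with q hq
      exact (hE.map_elements _ _ _ hq.1 hq.2).2.2
    rw [this.fderiv_eq]
    have h1 : HasDerivAt E'.g (deriv E'.g (Φ z).t)
        (Φ ((affineEq z ha s).lift z.t z.x z.u)).t := by
      rw [affineEq_lift_self]; exact hE'.hasDerivAt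
    have h2 : DifferentiableAt ℝ (fun q : ℝ × ℝ × ℝ =>
        (Φ ((affineEq z ha s).lift q.1 q.2.1 q.2.2)).t) (z.t, z.x, z.u) := by
      refine DifferentiableAt.comp (g := fun y => (Φ y).t) _ ?_ hlift
      rw [affineEq_lift_self]; exact hT
    have h3 : HasFDerivAt (fun q : ℝ × ℝ × ℝ =>
        E'.g (Φ ((affineEq z ha s).lift q.1 q.2.1 q.2.2)).t) _ _ :=
      h1.comp_hasFDerivAt (z.t, z.x, z.u) h2.hasFDerivAt
    rw [h3.fderiv]; rfl
  · rw [h0.2.2]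
    exact E'.g_ne_zero _ h0.2.1

/-- This is `jet_transfer` for the test equation of slope `s` through `z`, with derivatives along
its lift rewritten as derivatives of `Φ` itself. -/
theorem jet (h : IsGenEquiv Ω Φ) (hΩ : IsExtDomain Ω) (hz : z ∈ Ω) (s p q A C : ℝ)
    (hjet : p + 2 * z.a * z.u * q = z.g * C)
    (hJ : (fderiv ℝ Φ z (1, 0, p, 0, s)).t * (fderiv ℝ Φ z (0, 1, q, 0, 0)).x -
      (fderiv ℝ Φ z (0, 1, q, 0, 0)).t * (fderiv ℝ Φ z (1, 0, p, 0, s)).x ≠ 0)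
    (e₁ e₂ : ℝ)
    (heT : e₁ * (fderiv ℝ Φ z (1, 0, p, 0, s)).t + e₂ * (fderiv ℝ Φ z (0, 1, q, 0, 0)).t = 0)
    (heX : e₁ * (fderiv ℝ Φ z (1, 0, p, 0, s)).x + e₂ * (fderiv ℝ Φ z (0, 1, q, 0, 0)).x = 1) :
    ∃ v₁ v₂ v₃ : ℝ,
      v₁ * (fderiv ℝ Φ z (1, 0, p, 0, s)).t + v₂ * (fderiv ℝ Φ z (1, 0, p, 0, s)).x =
        (fderiv ℝ Φ z (1, 0, p, 0, s)).u ∧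
      v₁ * (fderiv ℝ Φ z (0, 1, q, 0, 0)).t + v₂ * (fderiv ℝ Φ z (0, 1, q, 0, 0)).x =
        (fderiv ℝ Φ z (0, 1, q, 0, 0)).u ∧
      v₁ + 2 * (Φ z).a * (Φ z).u * v₂ = (Φ z).g * v₃ ∧
      v₃ + v₁ * (secondLineDeriv (fun y => (Φ y).t) z (e₁, e₂, p * e₁ + q * e₂, 0, s * e₁) +
          (A * e₁ ^ 2 + C * e₂ ^ 2) * (fderiv ℝ Φ z (0, 0, 1, 0, 0)).t) +
        v₂ * (secondLineDeriv (fun y => (Φ y).x) z (e₁, e₂, p * e₁ + q * e₂, 0, s * e₁) +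
          (A * e₁ ^ 2 + C * e₂ ^ 2) * (fderiv ℝ Φ z (0, 0, 1, 0, 0)).x) =
        secondLineDeriv (fun y => (Φ y).u) z (e₁, e₂, p * e₁ + q * e₂, 0, s * e₁) +
          (A * e₁ ^ 2 + C * e₂ ^ 2) * (fderiv ℝ Φ z (0, 0, 1, 0, 0)).u := by
  have hC := h.isPointTransformation.contDiffAt hΩ.isOpen hz
  have hd := h.isPointTransformation.differentiableAt hΩ.isOpen hz
  have ha := hΩ.a_ne_zero z hz
  have hg := hΩ.g_ne_zero z hz
  obtain ⟨E', hE⟩ := h.maps_class (affineEq z ha s)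
  have h0 := hE.map_elements z.t z.x z.u (mem_affineEq_I hg) (by rw [affineEq_lift_self]; exact hz)
  rw [affineEq_lift_self] at h0
  have hT : ContDiffAt ℝ ∞ (fun y => (Φ y).t) z := hC.fst
  have hX : ContDiffAt ℝ ∞ (fun y => (Φ y).x) z := hC.snd.fst
  have hU : ContDiffAt ℝ ∞ (fun y => (Φ y).u) z := hC.snd.snd.fst
  have key := jet_transfer (contDiffAt_comp_affineEq_lift (ha := ha) (s := s) hT)
    (contDiffAt_comp_affineEq_lift (ha := ha) (s := s) hX)
    (contDiffAt_comp_affineEq_lift (ha := ha) (s := s) hU) (a := z.a) (g := z.g)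
    (a' := (Φ z).a) (g' := (Φ z).g) ?_ p q A C hjet
  · have fT := fderiv_comp_affineEq_lift (ha := ha) (s := s) (hT.differentiableAt (by simp))
    have fX := fderiv_comp_affineEq_lift (ha := ha) (s := s) (hX.differentiableAt (by simp))
    have fU := fderiv_comp_affineEq_lift (ha := ha) (s := s) (hU.differentiableAt (by simp))
    simp only [fT, fX, fU, secondLineDeriv_comp_affineEq_lift (fun y => (Φ y).t),
      secondLineDeriv_comp_affineEq_lift (fun y => (Φ y).x),
      secondLineDeriv_comp_affineEq_lift (fun y => (Φ y).u), affineEq_lift_self,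
      fderiv_comp_t hd, fderiv_comp_x hd, fderiv_comp_u hd, mul_one, mul_zero] at key
    exact key hJ e₁ e₂ heT heX
  · intro u v hu0 hu hv hev hueq
    have hm := hE.map_jets u v z.t z.x (mem_affineEq_I hg)
      (by rw [hu0, affineEq_lift_self]; exact hz) hu (by rw [hu0]; exact hv) hev
    rw [hu0, affineEq_lift_self] at hm
    have hueq' : (affineEq z ha s).HoldsAt u z.t z.x := by
      unfold BurgersEq.HoldsAt
      have : (affineEq z ha s).g z.t = z.g := by simp [affineEq]
      rw [this]
      exact hueq
    have := hm hueq'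
    unfold BurgersEq.HoldsAt at this
    rw [← h0.1, ← h0.2.2] at this
    simpa only [affineEq_lift_self] using this

end IsGenEquiv

/-! ### Varying the free entries of the jet. -/

section JetAlgebra

theorem det_ne_zero_of_injective {Tt Tx Tu Xt Xx Xu Ut Ux Uu : ℝ}
    (hinj : ∀ a b c : ℝ, a * Tt + b * Tx + c * Tu = 0 → a * Xt + b * Xx + c * Xu = 0 →
      a * Ut + b * Ux + c * Uu = 0 → a = 0 ∧ b = 0 ∧ c = 0) :
    Tt * Xx * Uu - Tt * Xu * Ux - Tx * Xt * Uu + Tx * Xu * Ut + Tu * Xt * Ux - Tu * Xx * Ut ≠ 0 := by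
  intro h
  have hdet : (!![Tt, Tx, Tu; Xt, Xx, Xu; Ut, Ux, Uu] : Matrix (Fin 3) (Fin 3) ℝ).det = 0 := by
    rw [Matrix.det_fin_three]; simpa using h
  obtain ⟨v, hv, hv0⟩ := Matrix.exists_mulVec_eq_zero_iff.2 hdet
  have h0 := congrFun hv0 0
  have h1 := congrFun hv0 1
  have h2 := congrFun hv0 2
  simp [Matrix.mulVec, dotProduct, Fin.sum_univ_three] at h0 h1 h2
  obtain ⟨a, b, c⟩ := hinj (v 0) (v 1) (v 2) (by linarith) (by linarith) (by linarith)
  exact hv (by ext i; fin_cases i <;> simpa)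

/-- A nonconstant, or constant nonzero, affine function of `(p, q)` is nonzero at two points with
the same `p`. -/
theorem exists_affine_ne_zero {c₀ c₁ c₂ : ℝ} (h : ¬(c₀ = 0 ∧ c₁ = 0 ∧ c₂ = 0)) :
    ∃ p q q' : ℝ, q ≠ q' ∧ c₀ + c₁ * p + c₂ * q ≠ 0 ∧ c₀ + c₁ * p + c₂ * q' ≠ 0 := by
  by_cases h2 : c₂ = 0
  · by_cases h0 : c₀ = 0
    · refine ⟨1, 0, 1, by norm_num, ?_⟩
      have : c₁ ≠ 0 := fun h1 => h ⟨h0, h1, h2⟩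
      simp [h0, h2, this]
    · exact ⟨0, 0, 1, by norm_num, by simp [h2, h0], by simp [h2, h0]⟩
  · refine ⟨0, (1 - c₀) / c₂, (2 - c₀) / c₂, ?_, ?_, ?_⟩
    · intro h; rw [div_left_inj' h2] at h; linarith
    · field_simp; norm_num
    · field_simp; norm_num

/-- The second-order part of the transformation rule forces `T` to be independent of `x`, `u`. -/
theorem fiber_derivs_eq_zero {Tt Tx Tu Xt Xx Xu Ut Ux Uu a u g a' U g' : ℝ} (hg : g ≠ 0)
    (hg' : g' ≠ 0)
    (hinj : ∀ a b c : ℝ, a * Tt + b * Tx + c * Tu = 0 → a * Xt + b * Xx + c * Xu = 0 →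
      a * Ut + b * Ux + c * Uu = 0 → a = 0 ∧ b = 0 ∧ c = 0)
    {ST SX SU : ℝ → ℝ → ℝ → ℝ → ℝ}
    (H : ∀ p q A C : ℝ, p + 2 * a * u * q = g * C →
      (Tt + p * Tu) * (Xx + q * Xu) - (Tx + q * Tu) * (Xt + p * Xu) ≠ 0 →
      ∀ e₁ e₂ : ℝ, e₁ * (Tt + p * Tu) + e₂ * (Tx + q * Tu) = 0 →
        e₁ * (Xt + p * Xu) + e₂ * (Xx + q * Xu) = 1 →
      ∃ v₁ v₂ v₃ : ℝ, v₁ * (Tt + p * Tu) + v₂ * (Xt + p * Xu) = Ut + p * Uu ∧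
        v₁ * (Tx + q * Tu) + v₂ * (Xx + q * Xu) = Ux + q * Uu ∧
        v₁ + 2 * a' * U * v₂ = g' * v₃ ∧
        v₃ + v₁ * (ST p q e₁ e₂ + (A * e₁ ^ 2 + C * e₂ ^ 2) * Tu) +
          v₂ * (SX p q e₁ e₂ + (A * e₁ ^ 2 + C * e₂ ^ 2) * Xu) =
          SU p q e₁ e₂ + (A * e₁ ^ 2 + C * e₂ ^ 2) * Uu) :
    Tx = 0 ∧ Tu = 0 := by
  have key : ∀ p q, (Tt + p * Tu) * (Xx + q * Xu) - (Tx + q * Tu) * (Xt + p * Xu) ≠ 0 →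
      Tx + q * Tu = 0 := by
    intro p q hJ
    by_contra hne
    set J := (Tt + p * Tu) * (Xx + q * Xu) - (Tx + q * Tu) * (Xt + p * Xu) with hJdef
    -- The direction mapped to `∂_x` is found by Cramer's rule. The entry `A`, which is `u_tt`, does
    -- not occur in the equation, so `v₁`, `v₂` and `v₃` agree for `A = 0` and `A = 1`, and the
    -- difference of the two second-order identities isolates the coefficient of `A`.
    have he := fun A => H p q A ((p + 2 * a * u * q) / g) (by field_simp) hJ
      (-(Tx + q * Tu) / J) ((Tt + p * Tu) / J) (by ring)
      (by field_simp; rw [hJdef]; ring)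
    obtain ⟨v₁, v₂, v₃, h1, h2, h3, h4⟩ := he 0
    obtain ⟨w₁, w₂, w₃, k1, k2, k3, k4⟩ := he 1
    have e1 : v₁ = w₁ := by
      have : (v₁ - w₁) * J = 0 := by
        rw [hJdef]; linear_combination (Xx + q * Xu) * (h1 - k1) - (Xt + p * Xu) * (h2 - k2)
      linarith [(mul_eq_zero.1 this).resolve_right hJ]
    have e2 : v₂ = w₂ := by
      have : (v₂ - w₂) * J = 0 := by
        rw [hJdef]; linear_combination (Tt + p * Tu) * (h2 - k2) - (Tx + q * Tu) * (h1 - k1)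
      linarith [(mul_eq_zero.1 this).resolve_right hJ]
    subst e1 e2
    have e3 : v₃ = w₃ := mul_left_cancel₀ hg' (by rw [← h3, k3])
    subst e3
    have e4 : (-(Tx + q * Tu) / J) ^ 2 * (v₁ * Tu + v₂ * Xu - Uu) = 0 := by
      linear_combination k4 - h4
    have e5 : v₁ * Tu + v₂ * Xu - Uu = 0 :=
      (mul_eq_zero.1 e4).resolve_left (pow_ne_zero _ (div_ne_zero (neg_ne_zero.2 hne) hJ))
    -- By `e5` the image of `∂_u` is tangent to the graph of `v`, hence is the image of a
    -- combination of the tangent vectors `(1, 0, p)` and `(0, 1, q)` of the graph of `u`. The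
    -- difference from `∂_u` would lie in the kernel, though `∂_u` is transversal to that graph.
    obtain ⟨c1, c2, c3⟩ := hinj ((Tu * (Xx + q * Xu) - (Tx + q * Tu) * Xu) / J)
      (((Tt + p * Tu) * Xu - (Xt + p * Xu) * Tu) / J)
      (p * ((Tu * (Xx + q * Xu) - (Tx + q * Tu) * Xu) / J) +
        q * (((Tt + p * Tu) * Xu - (Xt + p * Xu) * Tu) / J) - 1)
      (by field_simp; rw [hJdef]; ring) (by field_simp; rw [hJdef]; ring)
      (by
        have : Uu = v₁ * Tu + v₂ * Xu := by linarith
        field_simp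
        rw [hJdef] at *
        linear_combination -(Tu * (Xx + q * Xu) - (Tx + q * Tu) * Xu) * h1 -
          ((Tt + p * Tu) * Xu - (Xt + p * Xu) * Tu) * h2 +
          ((Tt + p * Tu) * (Xx + q * Xu) - (Tx + q * Tu) * (Xt + p * Xu)) * e5)
    rw [c1, c2] at c3
    norm_num at c3
  have hdet := det_ne_zero_of_injective hinj
  -- In `J` the `p * q` terms cancel, so `J` is affine in `(p, q)`. Its coefficients are, up to
  -- sign, the minors along the `U` row of the Jacobian, so they do not all vanish. Two values of
  -- `q` then separate `Tx` from `Tu`.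
  obtain ⟨p, q, q', hqq, h1, h2⟩ := exists_affine_ne_zero (c₀ := Tt * Xx - Tx * Xt)
    (c₁ := Tu * Xx - Tx * Xu) (c₂ := Tt * Xu - Tu * Xt) (by
      rintro ⟨h0, h1, h2⟩
      apply hdet
      linear_combination Uu * h0 - Ut * h1 - Ux * h2)
  have k1 := key p q (by convert h1 using 1; ring)
  have k2 := key p q' (by convert h2 using 1; ring)
  have hTu : Tu = 0 := by
    have : (q - q') * Tu = 0 := by linarith
    exact (mul_eq_zero.1 this).resolve_left (sub_ne_zero.2 hqq)
  subst hTu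
  exact ⟨by linarith, rfl⟩

/-- The coefficient of `u_t` in the transformation rule forces `X` to be independent of `u` and
determines its derivative with respect to `x`. -/
theorem fiber_preserving_scaling {Tt Xt Xx Xu Ut Ux Uu a u g a' U g' : ℝ} (hg : g ≠ 0)
    (hdet : Xx * Uu - Xu * Ux ≠ 0) {SX SU : ℝ → ℝ → ℝ}
    (H : ∀ p q C e : ℝ, p + 2 * a * u * q = g * C → e * (Xx + q * Xu) = 1 →
      ∃ v₁ v₂ v₃ : ℝ, v₁ * Tt + v₂ * (Xt + p * Xu) = Ut + p * Uu ∧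
        v₂ * (Xx + q * Xu) = Ux + q * Uu ∧
        v₁ + 2 * a' * U * v₂ = g' * v₃ ∧
        v₃ + v₂ * (SX q e + C * e ^ 2 * Xu) = SU q e + C * e ^ 2 * Uu) :
    Xu = 0 ∧ g * Xx ^ 2 = g' * Tt := by
  have key : ∀ q, Xx + q * Xu ≠ 0 → g * (Xx + q * Xu) ^ 2 = g' * Tt := by
    intro q hK
    set K := Xx + q * Xu with hKdef
    -- With `q` fixed, raising `u_t` from `0` to `1` raises `u_xx` by `1 / g`. The change of `v₁` is
    -- found once from the first-order relation and once through the equation for `v`; equating the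
    -- two gives the scaling law.
    have he := fun p => H p q ((p + 2 * a * u * q) / g) K⁻¹ (by field_simp)
      (inv_mul_cancel₀ hK)
    obtain ⟨v₁, v₂, v₃, h1, h2, h3, h4⟩ := he 0
    obtain ⟨w₁, w₂, w₃, k1, k2, k3, k4⟩ := he 1
    have e2 : v₂ = w₂ := mul_right_cancel₀ hK (by rw [h2, k2])
    subst e2
    have hne : Uu - v₂ * Xu ≠ 0 := by
      intro h
      apply hdet
      have : (Uu - v₂ * Xu) * K = Xx * Uu - Xu * Ux := by
        rw [hKdef]
        linear_combination -Xu * h2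
      rw [← this, h, zero_mul]
    have e1 : (w₁ - v₁) * Tt = Uu - v₂ * Xu := by linear_combination k1 - h1
    have e3 : w₁ - v₁ = g' * (w₃ - v₃) := by linear_combination k3 - h3
    have e4 : w₃ - v₃ = 1 / g * K⁻¹ ^ 2 * (Uu - v₂ * Xu) := by linear_combination k4 - h4
    rw [e3, e4] at e1
    have e5 : g' * Tt * (1 / g * K⁻¹ ^ 2) = 1 := by
      apply mul_right_cancel₀ hne
      linear_combination e1
    field_simp at e5
    linarith
  -- Otherwise `Xx + q * Xu` takes both values `1` and `2`, while its square times `g` does not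
  -- depend on `q`.
  have hXu : Xu = 0 := by
    by_contra h
    have h1 : Xx + (1 - Xx) / Xu * Xu = 1 := by field_simp; ring
    have h2 : Xx + (2 - Xx) / Xu * Xu = 2 := by field_simp; ring
    have k1 := key _ (by rw [h1]; norm_num)
    have k2 := key _ (by rw [h2]; norm_num)
    rw [h1] at k1
    rw [h2] at k2
    exact hg (by linarith)
  subst hXu
  refine ⟨rfl, ?_⟩
  have := key 0 (by intro h; apply hdet; rw [show Xx = 0 by linarith]; ring)
  simpa using this

/-- The remaining part of the transformation rule, for `u_xx = 0`. -/
theorem remaining_rule {Tt Xt Xx Ut Ux Uu a u g a' U g' q SX SU : ℝ}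
    (hscale : g * Xx ^ 2 = g' * Tt)
    (H : ∃ v₁ v₂ v₃ : ℝ, v₁ * Tt + v₂ * Xt = Ut + (-(2 * a * u * q)) * Uu ∧
        v₂ * Xx = Ux + q * Uu ∧ v₁ + 2 * a' * U * v₂ = g' * v₃ ∧ v₃ + v₂ * SX = SU) :
    (Ut - 2 * a * u * q * Uu) * Xx - (Ux + q * Uu) * Xt + 2 * a' * U * Tt * (Ux + q * Uu) =
      g * (Xx ^ 2 * (SU * Xx - (Ux + q * Uu) * SX)) := by
  obtain ⟨v₁, v₂, v₃, h1, h2, h3, h4⟩ := H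
  have e1 : v₃ = SU - v₂ * SX := by linarith
  subst e1
  rw [← h2]
  linear_combination -Xx * h1 + Tt * Xx * h3 - Xx * (SU - v₂ * SX) * hscale

end JetAlgebra

/-! ### Invariance under translations in a direction of vanishing derivative. -/

section Directions

theorem map_dir_t (L : ExtSpace →L[ℝ] ExtSpace) (b c d e : ℝ) :
    (L (b, c, d, 0, e)).t = b * (L (1, 0, 0, 0, 0)).t + c * (L (0, 1, 0, 0, 0)).t +
      d * (L (0, 0, 1, 0, 0)).t + e * (L (0, 0, 0, 0, 1)).t := by
  rw [map_dir]; rfl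

theorem map_dir_x (L : ExtSpace →L[ℝ] ExtSpace) (b c d e : ℝ) :
    (L (b, c, d, 0, e)).x = b * (L (1, 0, 0, 0, 0)).x + c * (L (0, 1, 0, 0, 0)).x +
      d * (L (0, 0, 1, 0, 0)).x + e * (L (0, 0, 0, 0, 1)).x := by
  rw [map_dir]; rfl

theorem map_dir_u (L : ExtSpace →L[ℝ] ExtSpace) (b c d e : ℝ) :
    (L (b, c, d, 0, e)).u = b * (L (1, 0, 0, 0, 0)).u + c * (L (0, 1, 0, 0, 0)).u +
      d * (L (0, 0, 1, 0, 0)).u + e * (L (0, 0, 0, 0, 1)).u := by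
  rw [map_dir]; rfl

/-- A function is constant along a segment on which its derivative in the direction of the segment
vanishes. -/
theorem eq_of_fderiv_segment_eq_zero {V : Type*} [NormedAddCommGroup V] [NormedSpace ℝ V]
    {f : V → ℝ} {B : Set V} (hB : Convex ℝ B) (hf : ∀ y ∈ B, DifferentiableAt ℝ f y) {y z : V}
    (hy : y ∈ B) (hz : z ∈ B) (h : ∀ w ∈ B, fderiv ℝ f w (z - y) = 0) : f z = f y := by
  have hmem : ∀ τ ∈ Set.Icc (0 : ℝ) 1, y + τ • (z - y) ∈ B := fun τ hτ =>
    hB.add_smul_sub_mem hy hz hτ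
  have hl : ∀ τ : ℝ, HasDerivAt (fun τ : ℝ => y + τ • (z - y)) (z - y) τ := fun τ => by
    simpa using ((hasDerivAt_id τ).smul_const (z - y)).const_add y
  have hd : ∀ τ ∈ Set.Icc (0 : ℝ) 1, HasDerivAt (fun τ : ℝ => f (y + τ • (z - y))) 0 τ := by
    intro τ hτ
    have := (hf _ (hmem τ hτ)).hasFDerivAt.comp_hasDerivAt τ (hl τ)
    rwa [h _ (hmem τ hτ)] at this
  have := constant_of_has_deriv_right_zero (f := fun τ : ℝ => f (y + τ • (z - y)))
    (fun τ hτ => (hd τ hτ).continuousAt.continuousWithinAt)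
    (fun τ hτ => (hd τ ⟨hτ.1, hτ.2.le⟩).hasDerivWithinAt) 1 (by simp)
  simpa using this

/-- A function with vanishing derivative in the direction `w` is locally invariant under small
translations in this direction. -/
theorem eventually_translate_eq {V : Type*} [NormedAddCommGroup V] [NormedSpace ℝ V]
    {f : V → ℝ} {Ω : Set V} (hΩ : IsOpen Ω) (hf : ∀ y ∈ Ω, DifferentiableAt ℝ f y) {w : V}
    (h : ∀ y ∈ Ω, fderiv ℝ f y w = 0) {z : V} (hz : z ∈ Ω) :
    ∀ᶠ τ : ℝ in 𝓝 0, ∀ᶠ y in 𝓝 z, f (y + τ • w) = f y := by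
  obtain ⟨r, hr, hB⟩ := Metric.isOpen_iff.1 hΩ z hz
  have hc : Continuous fun y : ℝ × V => y.2 + y.1 • w := by fun_prop
  have h1 : ∀ᶠ y : ℝ × V in 𝓝 ((0 : ℝ), z), y.2 + y.1 • w ∈ Metric.ball z r := by
    refine hc.continuousAt.eventually (Metric.isOpen_ball.mem_nhds ?_)
    simpa using hr
  have h2 : ∀ᶠ y : ℝ × V in 𝓝 ((0 : ℝ), z), y.2 ∈ Metric.ball z r :=
    continuous_snd.continuousAt.eventually (Metric.ball_mem_nhds z hr)
  have h3 := (h1.and h2).curry_nhds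
  filter_upwards [h3] with τ hτ
  filter_upwards [hτ] with y hy
  refine eq_of_fderiv_segment_eq_zero (convex_ball z r) (fun y hy => hf y (hB hy)) hy.2 hy.1 ?_
  intro y' hy'
  simp [h y' (hB hy')]

theorem fderiv_translate {V : Type*} [NormedAddCommGroup V] [NormedSpace ℝ V] {f : V → ℝ}
    {z w : V} (h : ∀ᶠ y in 𝓝 z, f (y + w) = f y) : fderiv ℝ f (z + w) = fderiv ℝ f z := by
  rw [← fderiv_comp_add_right]
  exact Filter.EventuallyEq.fderiv_eq h

theorem secondLineDeriv_congr {V : Type*} [NormedAddCommGroup V] [NormedSpace ℝ V] {f f' : V → ℝ}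
    {z : V} (h : f =ᶠ[𝓝 z] f') (c : V) : secondLineDeriv f z c = secondLineDeriv f' z c := by
  have hc : Filter.Tendsto (fun τ : ℝ => z + τ • c) (𝓝 0) (𝓝 z) := by
    have : Continuous fun τ : ℝ => z + τ • c := by fun_prop
    simpa using this.tendsto 0
  exact Filter.EventuallyEq.deriv_eq (Filter.EventuallyEq.deriv (hc.eventually h))

theorem secondLineDeriv_translate {V : Type*} [NormedAddCommGroup V] [NormedSpace ℝ V] {f : V → ℝ}
    {z w : V} (h : ∀ᶠ y in 𝓝 z, f (y + w) = f y) (c : V) :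
    secondLineDeriv f (z + w) c = secondLineDeriv f z c := by
  rw [← secondLineDeriv_congr h c]
  unfold secondLineDeriv
  simp only [add_right_comm]

theorem secondLineDeriv_eq_zero {V : Type*} [NormedAddCommGroup V] [NormedSpace ℝ V] {f : V → ℝ}
    {Ω : Set V} (hΩ : IsOpen Ω) (hf : ∀ y ∈ Ω, DifferentiableAt ℝ f y) {c : V}
    (h : ∀ y ∈ Ω, fderiv ℝ f y c = 0) {z : V} (hz : z ∈ Ω) : secondLineDeriv f z c = 0 := by
  have h1 : (fun τ : ℝ => f (z + τ • c)) =ᶠ[𝓝 0] fun _ => f z := by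
    filter_upwards [eventually_translate_eq hΩ hf h hz] with τ hτ
    exact hτ.self_of_nhds
  rw [secondLineDeriv, h1.deriv.deriv_eq]
  simp

end Directions

/-! ### Derivation of the determining equations. -/

namespace IsGenEquiv

variable {Ω : Set ExtSpace} {Φ : ExtSpace → ExtSpace} {z : ExtSpace}

/-- The directions tangent to test equations of slopes `0` and `1` together span the hyperplane of
zero `a` component. -/
theorem fderiv_a_eq_zero (h : IsGenEquiv Ω Φ) (hΩ : IsExtDomain Ω) (hz : z ∈ Ω) (b c d e : ℝ) :
    (fderiv ℝ Φ z (b, c, d, 0, e)).a = 0 := by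
  have h0 := (h.fderiv_elements hΩ hz 0).1
  have h1 := (h.fderiv_elements hΩ hz 1).1
  have k0 := h0 (b, c, d)
  have k1 := h1 (e, 0, 0)
  have k2 := h0 (e, 0, 0)
  have hw : ((b, c, d, 0, e) : ExtSpace) =
      (b, c, d, 0, 0 * b) + (e, 0, 0, 0, 1 * e) - (e, 0, 0, 0, 0 * e) := by simp
  rw [hw, map_sub, map_add]
  change _ + _ - _ = (0 : ℝ)
  simp only at k0 k1 k2
  linear_combination k0 + k1 - k2

/-- On such directions the `a` component vanishes and the `g` component is a multiple of the `t`
component, so the `t, x, u` components alone detect the kernel of the invertible differential. -/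
theorem injective_of_slope (h : IsGenEquiv Ω Φ) (hΩ : IsExtDomain Ω) (hz : z ∈ Ω) (s b c d : ℝ)
    (ht : (fderiv ℝ Φ z (b, c, d, 0, s * b)).t = 0) (hx : (fderiv ℝ Φ z (b, c, d, 0, s * b)).x = 0)
    (hu : (fderiv ℝ Φ z (b, c, d, 0, s * b)).u = 0) : b = 0 ∧ c = 0 ∧ d = 0 := by
  obtain ⟨k, hk⟩ := (h.fderiv_elements hΩ hz s).2.1
  have hg := hk (b, c, d)
  have ha := h.fderiv_a_eq_zero hΩ hz b c d (s * b)
  simp only at hg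
  rw [ht, mul_zero] at hg
  have := h.isPointTransformation.fderiv_eq_zero hz
    (w := (b, c, d, 0, s * b)) (Prod.ext ht (Prod.ext hx (Prod.ext hu (Prod.ext ha hg))))
  simp only [Prod.ext_iff, Prod.fst_zero, Prod.snd_zero] at this
  exact ⟨this.1, this.2.1, this.2.2.1⟩

theorem injective_of_slope' (h : IsGenEquiv Ω Φ) (hΩ : IsExtDomain Ω) (hz : z ∈ Ω) (s : ℝ) :
    ∀ b c d : ℝ,
      b * ((fderiv ℝ Φ z (1, 0, 0, 0, 0)).t + s * (fderiv ℝ Φ z (0, 0, 0, 0, 1)).t) +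
        c * (fderiv ℝ Φ z (0, 1, 0, 0, 0)).t + d * (fderiv ℝ Φ z (0, 0, 1, 0, 0)).t = 0 →
      b * ((fderiv ℝ Φ z (1, 0, 0, 0, 0)).x + s * (fderiv ℝ Φ z (0, 0, 0, 0, 1)).x) +
        c * (fderiv ℝ Φ z (0, 1, 0, 0, 0)).x + d * (fderiv ℝ Φ z (0, 0, 1, 0, 0)).x = 0 →
      b * ((fderiv ℝ Φ z (1, 0, 0, 0, 0)).u + s * (fderiv ℝ Φ z (0, 0, 0, 0, 1)).u) +
        c * (fderiv ℝ Φ z (0, 1, 0, 0, 0)).u + d * (fderiv ℝ Φ z (0, 0, 1, 0, 0)).u = 0 →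
      b = 0 ∧ c = 0 ∧ d = 0 := by
  intro b c d ht hx hu
  refine h.injective_of_slope hΩ hz s b c d ?_ ?_ ?_
  · rw [map_dir_t]; linarith
  · rw [map_dir_x]; linarith
  · rw [map_dir_u]; linarith

theorem fderiv_t_fiber (h : IsGenEquiv Ω Φ) (hΩ : IsExtDomain Ω) (hz : z ∈ Ω) :
    (fderiv ℝ Φ z (0, 1, 0, 0, 0)).t = 0 ∧ (fderiv ℝ Φ z (0, 0, 1, 0, 0)).t = 0 := by
  refine fiber_derivs_eq_zero (a := z.a) (u := z.u) (a' := (Φ z).a) (U := (Φ z).u)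
    (hΩ.g_ne_zero z hz) (h.fderiv_elements hΩ hz 0).2.2 (h.injective_of_slope' hΩ hz 0)
    (ST := fun p q e₁ e₂ =>
      secondLineDeriv (fun y => (Φ y).t) z (e₁, e₂, p * e₁ + q * e₂, 0, 0 * e₁))
    (SX := fun p q e₁ e₂ =>
      secondLineDeriv (fun y => (Φ y).x) z (e₁, e₂, p * e₁ + q * e₂, 0, 0 * e₁))
    (SU := fun p q e₁ e₂ =>
      secondLineDeriv (fun y => (Φ y).u) z (e₁, e₂, p * e₁ + q * e₂, 0, 0 * e₁)) ?_
  intro p q A C hjet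
  have := h.jet hΩ hz 0 p q A C hjet
  rw [map_dir_t _ 1 0 p 0, map_dir_x _ 1 0 p 0, map_dir_u _ 1 0 p 0, map_dir_t _ 0 1 q 0,
    map_dir_x _ 0 1 q 0, map_dir_u _ 0 1 q 0] at this
  simpa only [zero_mul, one_mul, add_zero, zero_add] using this

/-- Since `T_x = T_u = 0`, the determinant for slope `s` factors as `(T_t + s T_g) (X_x U_u - X_u
U_x)`. It is nonzero for every real `s`, which excludes `T_g ≠ 0`. -/
theorem fderiv_t_g (h : IsGenEquiv Ω Φ) (hΩ : IsExtDomain Ω) (hz : z ∈ Ω) :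
    (fderiv ℝ Φ z (0, 0, 0, 0, 1)).t = 0 ∧ (fderiv ℝ Φ z (1, 0, 0, 0, 0)).t ≠ 0 ∧
      (fderiv ℝ Φ z (0, 1, 0, 0, 0)).x * (fderiv ℝ Φ z (0, 0, 1, 0, 0)).u -
        (fderiv ℝ Φ z (0, 0, 1, 0, 0)).x * (fderiv ℝ Φ z (0, 1, 0, 0, 0)).u ≠ 0 := by
  obtain ⟨hx, hu⟩ := h.fderiv_t_fiber hΩ hz
  have key := fun s => det_ne_zero_of_injective (h.injective_of_slope' hΩ hz s)
  rw [hx, hu] at key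
  have hs : ∀ s, (fderiv ℝ Φ z (1, 0, 0, 0, 0)).t + s * (fderiv ℝ Φ z (0, 0, 0, 0, 1)).t ≠ 0 := by
    intro s hs
    apply key s
    rw [hs]; ring
  refine ⟨?_, ?_, ?_⟩
  · by_contra hne
    exact hs (-(fderiv ℝ Φ z (1, 0, 0, 0, 0)).t / (fderiv ℝ Φ z (0, 0, 0, 0, 1)).t)
      (by field_simp; ring)
  · simpa using hs 0
  · intro h0
    apply key 0
    linear_combination ((fderiv ℝ Φ z (1, 0, 0, 0, 0)).t + 0 * (fderiv ℝ Φ z (0, 0, 0, 0, 1)).t)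
      * h0

/-- The derivative is a multiple of `T_x`. Combined with the scaling law this later makes `X_x ^ 2`
independent of `x`. -/
theorem fderiv_g_x (h : IsGenEquiv Ω Φ) (hΩ : IsExtDomain Ω) (hz : z ∈ Ω) :
    (fderiv ℝ Φ z (0, 1, 0, 0, 0)).g = 0 := by
  obtain ⟨k, hk⟩ := (h.fderiv_elements hΩ hz 0).2.1
  have := hk (0, 1, 0)
  simpa [(h.fderiv_t_fiber hΩ hz).1] using this

/-- The transformation rule after `T` is known to depend on `t` and `a` only. -/
theorem jet_fiber (h : IsGenEquiv Ω Φ) (hΩ : IsExtDomain Ω) (hz : z ∈ Ω) (s p q C e : ℝ)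
    (hjet : p + 2 * z.a * z.u * q = z.g * C)
    (he : e * ((fderiv ℝ Φ z (0, 1, 0, 0, 0)).x + q * (fderiv ℝ Φ z (0, 0, 1, 0, 0)).x) = 1) :
    ∃ v₁ v₂ v₃ : ℝ,
      v₁ * (fderiv ℝ Φ z (1, 0, 0, 0, 0)).t +
        v₂ * ((fderiv ℝ Φ z (1, 0, 0, 0, 0)).x + s * (fderiv ℝ Φ z (0, 0, 0, 0, 1)).x +
          p * (fderiv ℝ Φ z (0, 0, 1, 0, 0)).x) =
        (fderiv ℝ Φ z (1, 0, 0, 0, 0)).u + s * (fderiv ℝ Φ z (0, 0, 0, 0, 1)).u +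
          p * (fderiv ℝ Φ z (0, 0, 1, 0, 0)).u ∧
      v₂ * ((fderiv ℝ Φ z (0, 1, 0, 0, 0)).x + q * (fderiv ℝ Φ z (0, 0, 1, 0, 0)).x) =
        (fderiv ℝ Φ z (0, 1, 0, 0, 0)).u + q * (fderiv ℝ Φ z (0, 0, 1, 0, 0)).u ∧
      v₁ + 2 * (Φ z).a * (Φ z).u * v₂ = (Φ z).g * v₃ ∧
      v₃ + v₂ * (secondLineDeriv (fun y => (Φ y).x) z (0, e, q * e, 0, 0) +
          C * e ^ 2 * (fderiv ℝ Φ z (0, 0, 1, 0, 0)).x) =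
        secondLineDeriv (fun y => (Φ y).u) z (0, e, q * e, 0, 0) +
          C * e ^ 2 * (fderiv ℝ Φ z (0, 0, 1, 0, 0)).u := by
  obtain ⟨hTx, hTu⟩ := h.fderiv_t_fiber hΩ hz
  obtain ⟨hTg, hTt, -⟩ := h.fderiv_t_g hΩ hz
  have hK : (fderiv ℝ Φ z (0, 1, 0, 0, 0)).x + q * (fderiv ℝ Φ z (0, 0, 1, 0, 0)).x ≠ 0 :=
    right_ne_zero_of_mul_eq_one he
  have hST : secondLineDeriv (fun y => (Φ y).t) z (0, e, q * e, 0, 0) = 0 := by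
    have hd : ∀ y ∈ Ω, DifferentiableAt ℝ Φ y := fun y hy =>
      h.isPointTransformation.differentiableAt hΩ.isOpen hy
    refine secondLineDeriv_eq_zero hΩ.isOpen (fun y hy => (hd y hy).fst) (fun y hy => ?_) hz
    rw [fderiv_comp_t (hd y hy), map_dir_t, (h.fderiv_t_fiber hΩ hy).1,
      (h.fderiv_t_fiber hΩ hy).2]
    ring
  -- The direction mapped to `∂_x` is now `(0, e)`, so `u_tt` drops out and its value `0` is
  -- immaterial.
  have := h.jet hΩ hz s p q 0 C hjet
  rw [map_dir_t _ 1 0 p s, map_dir_x _ 1 0 p s, map_dir_u _ 1 0 p s, map_dir_t _ 0 1 q 0,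
    map_dir_x _ 0 1 q 0, map_dir_u _ 0 1 q 0] at this
  have := this (by
    rw [hTx, hTu, hTg]
    simp only [zero_mul, one_mul, add_zero, zero_add, mul_zero, sub_zero]
    exact mul_ne_zero hTt hK) 0 e (by rw [hTx, hTu, hTg]; ring)
    (by simp only [zero_mul, one_mul, add_zero, zero_add]; exact he)
  simp only [hTx, hTu, hTg, zero_mul, one_mul, add_zero, zero_add, mul_zero, hST, ne_eq,
    OfNat.ofNat_ne_zero, not_false_eq_true, zero_pow] at this
  obtain ⟨v₁, v₂, v₃, h1, h2, h3, h4⟩ := this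
  exact ⟨v₁, v₂, v₃, by linarith, h2, h3, h4⟩

theorem fderiv_x_u (h : IsGenEquiv Ω Φ) (hΩ : IsExtDomain Ω) (hz : z ∈ Ω) :
    (fderiv ℝ Φ z (0, 0, 1, 0, 0)).x = 0 ∧
      z.g * (fderiv ℝ Φ z (0, 1, 0, 0, 0)).x ^ 2 =
        (Φ z).g * (fderiv ℝ Φ z (1, 0, 0, 0, 0)).t := by
  obtain ⟨-, hTt, hdet⟩ := h.fderiv_t_g hΩ hz
  refine fiber_preserving_scaling (a := z.a) (u := z.u) (a' := (Φ z).a) (U := (Φ z).u)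
    (hΩ.g_ne_zero z hz) hdet
    (SX := fun q e => secondLineDeriv (fun y => (Φ y).x) z (0, e, q * e, 0, 0))
    (SU := fun q e => secondLineDeriv (fun y => (Φ y).u) z (0, e, q * e, 0, 0))
    (H := fun p q C e hjet he => ?_)
    (Xt := (fderiv ℝ Φ z (1, 0, 0, 0, 0)).x) (Ut := (fderiv ℝ Φ z (1, 0, 0, 0, 0)).u)
    (Ux := (fderiv ℝ Φ z (0, 1, 0, 0, 0)).u) (Uu := (fderiv ℝ Φ z (0, 0, 1, 0, 0)).u)
  simpa using h.jet_fiber hΩ hz 0 p q C e hjet he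

theorem fderiv_x_x_ne_zero (h : IsGenEquiv Ω Φ) (hΩ : IsExtDomain Ω) (hz : z ∈ Ω) :
    (fderiv ℝ Φ z (0, 1, 0, 0, 0)).x ≠ 0 ∧ (fderiv ℝ Φ z (0, 0, 1, 0, 0)).u ≠ 0 := by
  obtain ⟨-, -, hdet⟩ := h.fderiv_t_g hΩ hz
  rw [(h.fderiv_x_u hΩ hz).1, zero_mul, sub_zero] at hdet
  exact ⟨left_ne_zero_of_mul hdet, right_ne_zero_of_mul hdet⟩

/-- The jet has `u_xx = 0` and `u_t = -2 a u u_x`. What remains free is `s`, which occurs only on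
the left and only to first order, the explicit factor `g`, which occurs only on the right, and `q`.
Each is exploited in turn. -/
theorem slope_rule (h : IsGenEquiv Ω Φ) (hΩ : IsExtDomain Ω) (hz : z ∈ Ω) (s q : ℝ) :
    ((fderiv ℝ Φ z (1, 0, 0, 0, 0)).u + s * (fderiv ℝ Φ z (0, 0, 0, 0, 1)).u -
          2 * z.a * z.u * q * (fderiv ℝ Φ z (0, 0, 1, 0, 0)).u) *
        (fderiv ℝ Φ z (0, 1, 0, 0, 0)).x -
      ((fderiv ℝ Φ z (0, 1, 0, 0, 0)).u + q * (fderiv ℝ Φ z (0, 0, 1, 0, 0)).u) *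
        ((fderiv ℝ Φ z (1, 0, 0, 0, 0)).x + s * (fderiv ℝ Φ z (0, 0, 0, 0, 1)).x) +
      2 * (Φ z).a * (Φ z).u * (fderiv ℝ Φ z (1, 0, 0, 0, 0)).t *
        ((fderiv ℝ Φ z (0, 1, 0, 0, 0)).u + q * (fderiv ℝ Φ z (0, 0, 1, 0, 0)).u) =
      z.g * ((fderiv ℝ Φ z (0, 1, 0, 0, 0)).x ^ 2 *
        (secondLineDeriv (fun y => (Φ y).u) z (0, (fderiv ℝ Φ z (0, 1, 0, 0, 0)).x⁻¹,
            q * (fderiv ℝ Φ z (0, 1, 0, 0, 0)).x⁻¹, 0, 0) * (fderiv ℝ Φ z (0, 1, 0, 0, 0)).x -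
          ((fderiv ℝ Φ z (0, 1, 0, 0, 0)).u + q * (fderiv ℝ Φ z (0, 0, 1, 0, 0)).u) *
            secondLineDeriv (fun y => (Φ y).x) z (0, (fderiv ℝ Φ z (0, 1, 0, 0, 0)).x⁻¹,
              q * (fderiv ℝ Φ z (0, 1, 0, 0, 0)).x⁻¹, 0, 0))) := by
  obtain ⟨hXu, hscale⟩ := h.fderiv_x_u hΩ hz
  obtain ⟨hX, -⟩ := h.fderiv_x_x_ne_zero hΩ hz
  refine remaining_rule hscale ?_
  have := h.jet_fiber hΩ hz s (-(2 * z.a * z.u * q)) q 0 (fderiv ℝ Φ z (0, 1, 0, 0, 0)).x⁻¹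
    (by ring) (by rw [hXu, mul_zero, add_zero]; exact inv_mul_cancel₀ hX)
  simpa only [hXu, mul_zero, add_zero, zero_mul] using this

/-- The coefficient of `s` in `slope_rule` vanishes for every `q`, and its coefficient of `q` is
`-U_u X_g`. -/
theorem fderiv_x_g (h : IsGenEquiv Ω Φ) (hΩ : IsExtDomain Ω) (hz : z ∈ Ω) :
    (fderiv ℝ Φ z (0, 0, 0, 0, 1)).x = 0 ∧ (fderiv ℝ Φ z (0, 0, 0, 0, 1)).u = 0 := by
  obtain ⟨hX, hU⟩ := h.fderiv_x_x_ne_zero hΩ hz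
  have key : ∀ q, (fderiv ℝ Φ z (0, 0, 0, 0, 1)).u * (fderiv ℝ Φ z (0, 1, 0, 0, 0)).x -
      ((fderiv ℝ Φ z (0, 1, 0, 0, 0)).u + q * (fderiv ℝ Φ z (0, 0, 1, 0, 0)).u) *
        (fderiv ℝ Φ z (0, 0, 0, 0, 1)).x = 0 := fun q => by
    linear_combination h.slope_rule hΩ hz 1 q - h.slope_rule hΩ hz 0 q
  have h0 := key 0
  have h1 := key 1
  have hXg : (fderiv ℝ Φ z (0, 0, 0, 0, 1)).x = 0 := by
    have : (fderiv ℝ Φ z (0, 0, 1, 0, 0)).u * (fderiv ℝ Φ z (0, 0, 0, 0, 1)).x = 0 := by linarith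
    exact (mul_eq_zero.1 this).resolve_left hU
  rw [hXg, mul_zero, sub_zero] at h0
  exact ⟨hXg, (mul_eq_zero.1 h0).resolve_right hX⟩

/-- The differential equations satisfied by the components of the transformation. -/
theorem determining_equations (h : IsGenEquiv Ω Φ) (hΩ : IsExtDomain Ω) (hz : z ∈ Ω) :
    2 * (Φ z).a * (fderiv ℝ Φ z (1, 0, 0, 0, 0)).t * (Φ z).u =
        2 * z.a * z.u * (fderiv ℝ Φ z (0, 1, 0, 0, 0)).x + (fderiv ℝ Φ z (1, 0, 0, 0, 0)).x ∧
      (fderiv ℝ Φ z (1, 0, 0, 0, 0)).u + 2 * z.a * z.u * (fderiv ℝ Φ z (0, 1, 0, 0, 0)).u = 0 := by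
  obtain ⟨hX, hU⟩ := h.fderiv_x_x_ne_zero hΩ hz
  have hd : ∀ y ∈ Ω, DifferentiableAt ℝ Φ y := fun y hy =>
    h.isPointTransformation.differentiableAt hΩ.isOpen hy
  -- The components `T, X, U` and `a'` are locally invariant under shifts of `g`, and so are their
  -- derivatives. Comparing `slope_rule` at `z` and at a point shifted by some `τ ≠ 0` therefore
  -- changes only the explicit factor `g`.
  have hT := eventually_translate_eq hΩ.isOpen (f := fun y => (Φ y).t) (fun y hy => (hd y hy).fst)
    (w := (0, 0, 0, 0, 1))
    (fun y hy => by rw [fderiv_comp_t (hd y hy), (h.fderiv_t_g hΩ hy).1]) hz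
  have hX' := eventually_translate_eq hΩ.isOpen (f := fun y => (Φ y).x)
    (fun y hy => (hd y hy).snd.fst) (w := (0, 0, 0, 0, 1))
    (fun y hy => by rw [fderiv_comp_x (hd y hy), (h.fderiv_x_g hΩ hy).1]) hz
  have hU' := eventually_translate_eq hΩ.isOpen (f := fun y => (Φ y).u)
    (fun y hy => (hd y hy).snd.snd.fst) (w := (0, 0, 0, 0, 1))
    (fun y hy => by rw [fderiv_comp_u (hd y hy), (h.fderiv_x_g hΩ hy).2]) hz
  have hA' := eventually_translate_eq hΩ.isOpen (f := fun y => (Φ y).a)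
    (fun y hy => (hd y hy).snd.snd.snd.fst) (w := (0, 0, 0, 0, 1))
    (fun y hy => by rw [fderiv_comp_a (hd y hy), h.fderiv_a_eq_zero hΩ hy]) hz
  have hmem : ∀ᶠ τ : ℝ in 𝓝 0, z + τ • ((0, 0, 0, 0, 1) : ExtSpace) ∈ Ω := by
    have hc : Continuous fun τ : ℝ => z + τ • ((0, 0, 0, 0, 1) : ExtSpace) := by fun_prop
    refine hc.continuousAt.eventually (hΩ.isOpen.mem_nhds ?_)
    simpa using hz
  have hev := (((hT.and hX').and (hU'.and hA')).and hmem)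
  obtain ⟨τ, ⟨⟨⟨hT, hX'⟩, hU', hA'⟩, hmem⟩, hτ⟩ :=
    ((hev.filter_mono nhdsWithin_le_nhds).and
      (self_mem_nhdsWithin : {τ : ℝ | τ ≠ 0} ∈ 𝓝[≠] (0 : ℝ))).exists
  have dT : ∀ w, (fderiv ℝ Φ (z + τ • ((0, 0, 0, 0, 1) : ExtSpace)) w).t = (fderiv ℝ Φ z w).t :=
    fun w => by rw [← fderiv_comp_t (hd _ hmem), ← fderiv_comp_t (hd _ hz), fderiv_translate hT]
  have dX : ∀ w, (fderiv ℝ Φ (z + τ • ((0, 0, 0, 0, 1) : ExtSpace)) w).x = (fderiv ℝ Φ z w).x :=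
    fun w => by rw [← fderiv_comp_x (hd _ hmem), ← fderiv_comp_x (hd _ hz), fderiv_translate hX']
  have dU : ∀ w, (fderiv ℝ Φ (z + τ • ((0, 0, 0, 0, 1) : ExtSpace)) w).u = (fderiv ℝ Φ z w).u :=
    fun w => by rw [← fderiv_comp_u (hd _ hmem), ← fderiv_comp_u (hd _ hz), fderiv_translate hU']
  have key : ∀ q, ((fderiv ℝ Φ z (1, 0, 0, 0, 0)).u -
          2 * z.a * z.u * q * (fderiv ℝ Φ z (0, 0, 1, 0, 0)).u) *
        (fderiv ℝ Φ z (0, 1, 0, 0, 0)).x -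
      ((fderiv ℝ Φ z (0, 1, 0, 0, 0)).u + q * (fderiv ℝ Φ z (0, 0, 1, 0, 0)).u) *
        (fderiv ℝ Φ z (1, 0, 0, 0, 0)).x +
      2 * (Φ z).a * (Φ z).u * (fderiv ℝ Φ z (1, 0, 0, 0, 0)).t *
        ((fderiv ℝ Φ z (0, 1, 0, 0, 0)).u + q * (fderiv ℝ Φ z (0, 0, 1, 0, 0)).u) = 0 := by
    intro q
    have h1 := h.slope_rule hΩ hz 0 q
    have h2 := h.slope_rule hΩ hmem 0 q
    have hA0 := hA'.self_of_nhds
    have hU0 := hU'.self_of_nhds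
    simp only [dT, dX, dU] at h2
    rw [hA0, hU0,
      secondLineDeriv_translate (f := fun y => (Φ y).x) hX',
      secondLineDeriv_translate (f := fun y => (Φ y).u) hU'] at h2
    have ha : (z + τ • ((0, 0, 0, 0, 1) : ExtSpace)).a = z.a := by simp [ExtSpace.a]
    have hu : (z + τ • ((0, 0, 0, 0, 1) : ExtSpace)).u = z.u := by simp [ExtSpace.u]
    have hg : (z + τ • ((0, 0, 0, 0, 1) : ExtSpace)).g = z.g + τ := by simp [ExtSpace.g]
    rw [ha, hu, hg] at h2
    set M := (fderiv ℝ Φ z (0, 1, 0, 0, 0)).x ^ 2 *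
        (secondLineDeriv (fun y => (Φ y).u) z (0, (fderiv ℝ Φ z (0, 1, 0, 0, 0)).x⁻¹,
            q * (fderiv ℝ Φ z (0, 1, 0, 0, 0)).x⁻¹, 0, 0) * (fderiv ℝ Φ z (0, 1, 0, 0, 0)).x -
          ((fderiv ℝ Φ z (0, 1, 0, 0, 0)).u + q * (fderiv ℝ Φ z (0, 0, 1, 0, 0)).u) *
            secondLineDeriv (fun y => (Φ y).x) z (0, (fderiv ℝ Φ z (0, 1, 0, 0, 0)).x⁻¹,
              q * (fderiv ℝ Φ z (0, 1, 0, 0, 0)).x⁻¹, 0, 0)) with hM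
    have hM0 : M = 0 := by
      have : τ * M = 0 := by linear_combination h1 - h2
      exact (mul_eq_zero.1 this).resolve_left hτ
    rw [hM0, mul_zero] at h1
    linear_combination h1
  -- The coefficient of `q` is `U_u` times the first determining equation; the term without `q` then
  -- reduces to `X_x` times the second.
  have h0 := key 0
  have h1 := key 1
  have e1 : 2 * (Φ z).a * (fderiv ℝ Φ z (1, 0, 0, 0, 0)).t * (Φ z).u =
      2 * z.a * z.u * (fderiv ℝ Φ z (0, 1, 0, 0, 0)).x + (fderiv ℝ Φ z (1, 0, 0, 0, 0)).x := by
    apply mul_left_cancel₀ hU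
    linear_combination h1 - h0
  refine ⟨e1, ?_⟩
  apply mul_right_cancel₀ hX
  linear_combination h0 - (fderiv ℝ Φ z (0, 1, 0, 0, 0)).u * e1

end IsGenEquiv

/-! ### Integration of the determining equations. -/

section Integration

theorem eq_of_hasDerivAt_zero {f : ℝ → ℝ} {I : Set ℝ} (hI : Convex ℝ I)
    (hf : ∀ t ∈ I, HasDerivAt f 0 t) {s t : ℝ} (hs : s ∈ I) (ht : t ∈ I) : f t = f s :=
  eq_of_fderiv_segment_eq_zero hI (fun y hy => (hf y hy).differentiableAt) hs ht
    fun w hw => by rw [(hf w hw).hasFDerivAt.fderiv]; simp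

/-- The solutions of the ordinary differential equations for the coefficients. -/
theorem projective_of_ode {I : Set ℝ} (hI : Convex ℝ I) {t₀ : ℝ} (ht₀ : t₀ ∈ I)
    {T T' X₁ X₁' X₀ X₀' : ℝ → ℝ} (hT : ∀ t ∈ I, HasDerivAt T (T' t) t)
    (hX₁ : ∀ t ∈ I, HasDerivAt X₁ (X₁' t) t) (hX₀ : ∀ t ∈ I, HasDerivAt X₀ (X₀' t) t)
    (hT0 : ∀ t ∈ I, T' t ≠ 0) (hX0 : ∀ t ∈ I, X₁ t ≠ 0)
    (hP : ∀ t ∈ I, HasDerivAt (fun s => X₁ s / T' s) (-(X₁' t / T' t)) t)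
    (hQ : ∀ t ∈ I, HasDerivAt (fun s => X₁' s / T' s) 0 t)
    (hR : ∀ t ∈ I, HasDerivAt (fun s => X₀' s / T' s) 0 t) :
    ∃ c α β γ δ n n₀ : ℝ, c ≠ 0 ∧ α * δ - β * γ = 1 / c ∧ ∀ t ∈ I, γ * t + δ ≠ 0 ∧
      T t = (α * t + β) / (γ * t + δ) ∧ X₁ t = 1 / (γ * t + δ) ∧ X₀ t = n * T t + n₀ ∧
      X₁ t ^ 2 = c * T' t ∧ X₁' t = -γ * c * T' t ∧ X₀' t = n * T' t := by
  -- The first integral `X₁ ^ 2 / T'`, written as `X₁ * (X₁ / T')` so that `hP` applies to the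
  -- second factor.
  set c := X₁ t₀ * (X₁ t₀ / T' t₀) with hc
  set m := X₁' t₀ / T' t₀ with hm
  set n := X₀' t₀ / T' t₀ with hn
  have hc0 : c ≠ 0 := mul_ne_zero (hX0 _ ht₀) (div_ne_zero (hX0 _ ht₀) (hT0 _ ht₀))
  have h1 : ∀ t ∈ I, X₁ t ^ 2 = c * T' t := by
    intro t ht
    have := eq_of_hasDerivAt_zero hI (f := fun s => X₁ s * (X₁ s / T' s))
      (fun s hs => ((hX₁ s hs).mul (hP s hs)).congr_deriv (by ring)) ht₀ ht
    rw [hc, ← this]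
    field_simp [hT0 t ht]
  have h2 : ∀ t ∈ I, X₁' t = m * T' t := by
    intro t ht
    have := eq_of_hasDerivAt_zero hI hQ ht₀ ht
    rw [hm, ← this, div_mul_cancel₀ _ (hT0 t ht)]
  have h3 : ∀ t ∈ I, X₀' t = n * T' t := by
    intro t ht
    have := eq_of_hasDerivAt_zero hI hR ht₀ ht
    rw [hn, ← this, div_mul_cancel₀ _ (hT0 t ht)]
  -- This is the derivative of `1 / X₁`, namely `-X₁' / X₁ ^ 2 = -m T' / (c T')`.
  set γ := -(m / c) with hγ
  set δ := (X₁ t₀)⁻¹ - γ * t₀ with hδ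
  have hmγ : m = -γ * c := by rw [hγ]; field_simp
  have h4 : ∀ t ∈ I, (X₁ t)⁻¹ = γ * t + δ := by
    intro t ht
    have := eq_of_hasDerivAt_zero hI (f := fun s => (X₁ s)⁻¹ - γ * s)
      (fun s hs => (((hX₁ s hs).inv (hX0 s hs)).sub ((hasDerivAt_id s).const_mul γ)).congr_deriv
        (by rw [h1 s hs, h2 s hs, hmγ]; field_simp [hT0 s hs]; ring)) ht₀ ht
    rw [hδ]; linarith
  set α := X₁ t₀ / c + γ * T t₀ with hα
  have h5 : ∀ t ∈ I, X₁ t / c + γ * T t = α := fun t ht =>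
    eq_of_hasDerivAt_zero hI (f := fun s => X₁ s / c + γ * T s)
      (fun s hs => (((hX₁ s hs).div_const c).add ((hT s hs).const_mul γ)).congr_deriv
        (by rw [h2 s hs, hmγ]; field_simp; ring)) ht₀ ht
  set β := T t₀ * (γ * t₀ + δ) - α * t₀ with hβ
  -- The derivative of `T (γ t + δ)` is `T' / X₁ + γ T = X₁ / c + γ T = α`.
  have h6 : ∀ t ∈ I, T t * (γ * t + δ) = α * t + β := by
    intro t ht
    have := eq_of_hasDerivAt_zero hI (f := fun s => T s * (γ * s + δ) - α * s)
      (fun s hs => (((hT s hs).mul (((hasDerivAt_id s).const_mul γ).add_const δ)).sub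
        ((hasDerivAt_id s).const_mul α)).congr_deriv (by
          have e1 : T' s = X₁ s ^ 2 / c := by rw [h1 s hs]; field_simp
          simp only [id, mul_one]
          rw [← h4 s hs, ← h5 s hs, e1]
          field_simp [hX0 s hs]; ring)) ht₀ ht
    rw [hβ]; linarith
  refine ⟨c, α, β, γ, δ, n, X₀ t₀ - n * T t₀, hc0, ?_, fun t ht => ?_⟩
  · have e1 : α * δ - β * γ = (α - γ * T t₀) * (γ * t₀ + δ) := by rw [hβ]; ring
    rw [e1, ← h4 t₀ ht₀, hα]
    field_simp [hX0 t₀ ht₀]; ring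
  · have hne : γ * t + δ ≠ 0 := by rw [← h4 t ht]; exact inv_ne_zero (hX0 t ht)
    refine ⟨hne, ?_, ?_, ?_, h1 t ht, by rw [h2 t ht, hmγ], h3 t ht⟩
    · rw [eq_div_iff hne, h6 t ht]
    · rw [← h4 t ht]; simp
    · have := eq_of_hasDerivAt_zero hI (f := fun s => X₀ s - n * T s)
        (fun s hs => ((hX₀ s hs).sub ((hT s hs).const_mul n)).congr_deriv
          (by rw [h3 s hs]; ring)) ht₀ ht
      linarith

/-- The solutions of the determining equations on a box. -/
theorem integrate_determining_equations {t₀ x₀ u₀ a a' r : ℝ} (hr : 0 < r) (ha : a ≠ 0)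
    (ha' : a' ≠ 0) {T T' : ℝ → ℝ} {X Xt Xx : ℝ → ℝ → ℝ} {U Ut Ux : ℝ → ℝ → ℝ → ℝ}
    (hT : ∀ t ∈ Metric.ball t₀ r, HasDerivAt T (T' t) t)
    (hT0 : ∀ t ∈ Metric.ball t₀ r, T' t ≠ 0)
    (hXt : ∀ t ∈ Metric.ball t₀ r, ∀ x ∈ Metric.ball x₀ r,
      HasDerivAt (fun s => X s x) (Xt t x) t)
    (hXx : ∀ t ∈ Metric.ball t₀ r, ∀ x ∈ Metric.ball x₀ r, HasDerivAt (X t) (Xx t x) x)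
    (hX0 : ∀ t ∈ Metric.ball t₀ r, Xx t x₀ ≠ 0)
    (hXc : ∀ t ∈ Metric.ball t₀ r, ∀ x ∈ Metric.ball x₀ r, Xx t x = Xx t x₀)
    (hUt : ∀ t ∈ Metric.ball t₀ r, ∀ x ∈ Metric.ball x₀ r, ∀ u ∈ Metric.ball u₀ r,
      HasDerivAt (fun s => U s x u) (Ut t x u) t)
    (hUx : ∀ t ∈ Metric.ball t₀ r, ∀ x ∈ Metric.ball x₀ r, ∀ u ∈ Metric.ball u₀ r,
      HasDerivAt (fun y => U t y u) (Ux t x u) x)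
    (e₁ : ∀ t ∈ Metric.ball t₀ r, ∀ x ∈ Metric.ball x₀ r, ∀ u ∈ Metric.ball u₀ r,
      2 * a' * T' t * U t x u = 2 * a * u * Xx t x + Xt t x)
    (e₂ : ∀ t ∈ Metric.ball t₀ r, ∀ x ∈ Metric.ball x₀ r, ∀ u ∈ Metric.ball u₀ r,
      Ut t x u + 2 * a * u * Ux t x u = 0) :
    ∃ c α β γ δ n n₀ : ℝ, c ≠ 0 ∧ α * δ - β * γ = 1 / c ∧ ∀ t ∈ Metric.ball t₀ r,
      γ * t + δ ≠ 0 ∧ T t = (α * t + β) / (γ * t + δ) ∧ Xx t x₀ ^ 2 = c * T' t ∧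
      (∀ x ∈ Metric.ball x₀ r,
        X t x = (x + n * (α * t + β) + n₀ * (γ * t + δ)) / (γ * t + δ)) ∧
      ∀ x ∈ Metric.ball x₀ r, ∀ u ∈ Metric.ball u₀ r,
        U t x u = c / (2 * a') * (2 * a * (γ * t + δ) * u - γ * x + n / c) := by
  have ht₀ : t₀ ∈ Metric.ball t₀ r := Metric.mem_ball_self hr
  have hx₀ : x₀ ∈ Metric.ball x₀ r := Metric.mem_ball_self hr
  have hu₀ : u₀ ∈ Metric.ball u₀ r := Metric.mem_ball_self hr
  have hh : ∀ y : ℝ, y + r / 2 ∈ Metric.ball y r := fun y => by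
    rw [Metric.mem_ball, Real.dist_eq, add_sub_cancel_left, abs_of_pos] <;> linarith
  have hr0 : r ≠ 0 := hr.ne'
  -- the coefficients of `X`
  have hXaff : ∀ t ∈ Metric.ball t₀ r, ∀ x ∈ Metric.ball x₀ r,
      X t x = X t x₀ + Xx t x₀ * (x - x₀) := by
    intro t ht x hx
    have := eq_of_hasDerivAt_zero (convex_ball x₀ r) (f := fun y => X t y - Xx t x₀ * y)
      (fun y hy => ((hXx t ht y hy).sub ((hasDerivAt_id y).const_mul (Xx t x₀))).congr_deriv
        (by rw [hXc t ht y hy]; ring)) hx₀ hx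
    linarith
  -- Nothing is assumed on the `t`-derivative of `Xx`. As `X` is affine in `x`, `Xx` is a difference
  -- quotient of `X` and inherits differentiability in `t`.
  have hX1 : ∀ t ∈ Metric.ball t₀ r, Xx t x₀ = (X t (x₀ + r / 2) - X t x₀) / (r / 2) := by
    intro t ht
    rw [hXaff t ht _ (hh x₀)]
    field_simp; ring
  set X₁' : ℝ → ℝ := fun t => (Xt t (x₀ + r / 2) - Xt t x₀) / (r / 2) with hX₁'
  have hX₁ : ∀ t ∈ Metric.ball t₀ r, HasDerivAt (fun s => Xx s x₀) (X₁' t) t := by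
    intro t ht
    refine (((hXt t ht _ (hh x₀)).sub (hXt t ht _ hx₀)).div_const (r / 2)).congr_of_eventuallyEq ?_
    filter_upwards [Metric.isOpen_ball.mem_nhds ht] with s hs
    exact hX1 s hs
  have hX₀ : ∀ t ∈ Metric.ball t₀ r,
      HasDerivAt (fun s => X s x₀ - Xx s x₀ * x₀) (Xt t x₀ - X₁' t * x₀) t :=
    fun t ht => (hXt t ht x₀ hx₀).sub ((hX₁ t ht).mul_const x₀)
  have hXtaff : ∀ t ∈ Metric.ball t₀ r, ∀ x ∈ Metric.ball x₀ r,
      Xt t x = X₁' t * x + (Xt t x₀ - X₁' t * x₀) := by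
    intro t ht x hx
    refine (hXt t ht x hx).unique ?_
    refine (((hX₁ t ht).mul_const x).add (hX₀ t ht)).congr_of_eventuallyEq ?_
    filter_upwards [Metric.isOpen_ball.mem_nhds ht] with s hs
    rw [hXaff s hs x hx]
    simp only [Pi.add_apply]
    ring
  -- the coefficients of `U`
  set P : ℝ → ℝ := fun t => Xx t x₀ / T' t with hPdef
  set Q : ℝ → ℝ := fun t => X₁' t / T' t with hQdef
  set R : ℝ → ℝ := fun t => (Xt t x₀ - X₁' t * x₀) / T' t with hRdef
  have hUaff : ∀ t ∈ Metric.ball t₀ r, ∀ x ∈ Metric.ball x₀ r, ∀ u ∈ Metric.ball u₀ r,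
      2 * a' * U t x u = 2 * a * u * P t + Q t * x + R t := by
    intro t ht x hx u hu
    have := e₁ t ht x hx u hu
    have hne := hT0 t ht
    rw [hXc t ht x hx, hXtaff t ht x hx] at this
    simp only [hPdef, hQdef, hRdef]
    field_simp
    linear_combination this
  have hUxQ : ∀ t ∈ Metric.ball t₀ r, ∀ x ∈ Metric.ball x₀ r, ∀ u ∈ Metric.ball u₀ r,
      2 * a' * Ux t x u = Q t := by
    intro t ht x hx u hu
    refine ((hUx t ht x hx u hu).const_mul (2 * a')).unique ?_
    have hl : HasDerivAt (fun y => 2 * a * u * P t + Q t * y + R t) (Q t) x := by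
      simpa using (((hasDerivAt_id x).const_mul (Q t)).const_add (2 * a * u * P t)).add_const (R t)
    refine hl.congr_of_eventuallyEq ?_
    filter_upwards [Metric.isOpen_ball.mem_nhds hx] with y hy
    exact hUaff t ht y hy u hu
  -- The second determining equation as a `t`-derivative, valid for all `x` and `u` of the box.
  -- Differences in `u` and in `x` isolate `P' = -Q` and `Q' = 0`, and `R' = 0` is the remainder.
  have hV : ∀ t ∈ Metric.ball t₀ r, ∀ x ∈ Metric.ball x₀ r, ∀ u ∈ Metric.ball u₀ r,
      HasDerivAt (fun s => 2 * a * u * P s + Q s * x + R s) (-(2 * a * u * Q t)) t := by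
    intro t ht x hx u hu
    have h1 := ((hUt t ht x hx u hu).const_mul (2 * a')).congr_deriv
      (g' := -(2 * a * u * Q t)) (by
        rw [← hUxQ t ht x hx u hu]
        linear_combination 2 * a' * e₂ t ht x hx u hu)
    refine h1.congr_of_eventuallyEq ?_
    filter_upwards [Metric.isOpen_ball.mem_nhds ht] with s hs
    exact (hUaff s hs x hx u hu).symm
  have hP : ∀ t ∈ Metric.ball t₀ r, HasDerivAt P (-Q t) t := by
    intro t ht
    have := (((hV t ht x₀ hx₀ _ (hh u₀)).sub (hV t ht x₀ hx₀ u₀ hu₀)).div_const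
      (a * r)).congr_deriv (g' := -Q t) (by field_simp; ring)
    refine this.congr_of_eventuallyEq (Filter.Eventually.of_forall fun s => ?_)
    simp only [Pi.sub_apply]
    field_simp; ring
  have hQ : ∀ t ∈ Metric.ball t₀ r, HasDerivAt Q 0 t := by
    intro t ht
    have := (((hV t ht _ (hh x₀) u₀ hu₀).sub (hV t ht x₀ hx₀ u₀ hu₀)).div_const
      (r / 2)).congr_deriv (g' := 0) (by ring)
    refine this.congr_of_eventuallyEq (Filter.Eventually.of_forall fun s => ?_)
    simp only [Pi.sub_apply]
    field_simp; ring
  have hR : ∀ t ∈ Metric.ball t₀ r, HasDerivAt R 0 t := by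
    intro t ht
    have := (((hV t ht x₀ hx₀ u₀ hu₀).sub ((hP t ht).const_mul (2 * a * u₀))).sub
      ((hQ t ht).mul_const x₀)).congr_deriv (g' := 0) (by ring)
    refine this.congr_of_eventuallyEq (Filter.Eventually.of_forall fun s => ?_)
    simp only [Pi.sub_apply]
    ring
  obtain ⟨c, α, β, γ, δ, n, n₀, hc, hdisc, H⟩ := projective_of_ode (convex_ball t₀ r) ht₀ hT hX₁ hX₀
    hT0 hX0 hP hQ hR
  refine ⟨c, α, β, γ, δ, n, n₀, hc, hdisc, fun t ht => ?_⟩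
  obtain ⟨h1, h2, h3, h4, h5, h6, h7⟩ := H t ht
  refine ⟨h1, h2, h5, fun x hx => ?_, fun x hx u hu => ?_⟩
  · have e : X t x = Xx t x₀ * x + (X t x₀ - Xx t x₀ * x₀) := by rw [hXaff t ht x hx]; ring
    rw [e, h4, h3, h2]
    field_simp
    ring
  · have hu := hUaff t ht x hx u hu
    simp only [hPdef, hQdef, hRdef] at hu
    rw [h7, h6] at hu
    have hTt : T' t = (1 / (γ * t + δ)) ^ 2 / c := by rw [← h3, h5]; field_simp
    have hne := hT0 t ht
    have eQ : -γ * c * T' t / T' t = -γ * c := by field_simp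
    have eR : n * T' t / T' t = n := by field_simp
    have eP : Xx t x₀ / T' t = c * (γ * t + δ) := by rw [hTt, h3]; field_simp
    rw [eP, eQ, eR] at hu
    have : U t x u = (2 * a * u * (c * (γ * t + δ)) + -γ * c * x + n) / (2 * a') := by
      rw [← hu]; field_simp
    rw [this]; field_simp; ring

end Integration

/-! ### Group law and uniqueness of the constants. -/

namespace ProjParams

theorem κ_ne_zero (p : ProjParams) : p.κ ≠ 0 := left_ne_zero_of_mul p.κσ_ne_zero

theorem σ_ne_zero (p : ProjParams) : p.σ ≠ 0 := right_ne_zero_of_mul p.κσ_ne_zero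

theorem toMap_t (p : ProjParams) (z : ExtSpace) :
    (p.toMap z).t = (p.α * z.t + p.β) / (p.γ * z.t + p.δ) := rfl

theorem toMap_x (p : ProjParams) (z : ExtSpace) :
    (p.toMap z).x = (p.κ * z.x + p.μ₁ * z.t + p.μ₀) / (p.γ * z.t + p.δ) := rfl

theorem toMap_u (p : ProjParams) (z : ExtSpace) :
    (p.toMap z).u = p.σ / (2 * z.a * (p.α * p.δ - p.β * p.γ)) *
      (2 * z.a * p.κ * (p.γ * z.t + p.δ) * z.u - p.κ * p.γ * z.x + p.μ₁ * p.δ - p.μ₀ * p.γ) := rfl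

theorem toMap_a (p : ProjParams) (z : ExtSpace) : (p.toMap z).a = z.a / p.σ := rfl

theorem toMap_g (p : ProjParams) (z : ExtSpace) :
    (p.toMap z).g = p.κ ^ 2 / (p.α * p.δ - p.β * p.γ) * z.g := rfl

/-- Parameters of the identity. -/
def one : ProjParams where
  α := 1
  β := 0
  γ := 0
  δ := 1
  κ := 1
  μ₁ := 0
  μ₀ := 0
  σ := 1
  disc_ne_zero := by norm_num
  κσ_ne_zero := by norm_num

/-- Parameters of the composition `q ∘ p`. -/
def comp (q p : ProjParams) : ProjParams where
  α := q.α * p.α + q.β * p.γ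
  β := q.α * p.β + q.β * p.δ
  γ := q.γ * p.α + q.δ * p.γ
  δ := q.γ * p.β + q.δ * p.δ
  κ := q.κ * p.κ
  μ₁ := q.κ * p.μ₁ + q.μ₁ * p.α + q.μ₀ * p.γ
  μ₀ := q.κ * p.μ₀ + q.μ₁ * p.β + q.μ₀ * p.δ
  σ := q.σ * p.σ
  disc_ne_zero := by
    have := mul_ne_zero q.disc_ne_zero p.disc_ne_zero
    intro h
    apply this
    linear_combination h
  κσ_ne_zero := by
    have := mul_ne_zero q.κσ_ne_zero p.κσ_ne_zero
    intro h
    apply this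
    linear_combination h

/-- Parameters of the inverse transformation. -/
noncomputable def inv (p : ProjParams) : ProjParams where
  α := p.δ
  β := -p.β
  γ := -p.γ
  δ := p.α
  -- The inverse of the matrix with rows `(κ, μ₁, μ₀)`, `(0, α, β)`, `(0, γ, δ)`, multiplied by `α δ
  -- - β γ`.
  κ := (p.α * p.δ - p.β * p.γ) / p.κ
  μ₁ := -(p.μ₁ * p.δ - p.μ₀ * p.γ) / p.κ
  μ₀ := -(p.μ₀ * p.α - p.μ₁ * p.β) / p.κ
  σ := p.σ⁻¹
  disc_ne_zero := by
    intro h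
    apply p.disc_ne_zero
    linear_combination h
  κσ_ne_zero :=
    mul_ne_zero (div_ne_zero p.disc_ne_zero p.κ_ne_zero) (inv_ne_zero p.σ_ne_zero)

theorem one_toMap {z : ExtSpace} (hz : z.a ≠ 0) :
    one.γ * z.t + one.δ ≠ 0 ∧ one.toMap z = z := by
  refine ⟨by simp [one], ?_⟩
  refine Prod.ext ?_ (Prod.ext ?_ (Prod.ext ?_ (Prod.ext ?_ ?_))) <;> simp [toMap, one]
  field_simp [show z.2.2.2.1 ≠ 0 from hz]

/-- On `(t, x)` the map is the projective action on `(x, t, 1)` of the matrix with rows `(κ, μ₁,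
μ₀)`, `(0, α, β)`, `(0, γ, δ)`. The constants of a composition are those of the matrix product, and
`σ` is multiplicative. -/
theorem comp_toMap (p q : ProjParams) {z : ExtSpace} (hz : z.a ≠ 0) (hp : p.γ * z.t + p.δ ≠ 0)
    (hq : q.γ * (p.toMap z).t + q.δ ≠ 0) :
    (q.comp p).γ * z.t + (q.comp p).δ ≠ 0 ∧ q.toMap (p.toMap z) = (q.comp p).toMap z := by
  have hden : (q.comp p).γ * z.t + (q.comp p).δ =
      (q.γ * (p.toMap z).t + q.δ) * (p.γ * z.t + p.δ) := by
    rw [toMap_t]; simp only [comp]; field_simp; ring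
  have hne : (q.comp p).γ * z.t + (q.comp p).δ ≠ 0 := by
    rw [hden]; exact mul_ne_zero hq hp
  have hdisc : (q.comp p).α * (q.comp p).δ - (q.comp p).β * (q.comp p).γ =
      (q.α * q.δ - q.β * q.γ) * (p.α * p.δ - p.β * p.γ) := by
    simp only [comp]; ring
  have hq' := q.disc_ne_zero
  have hp' := p.disc_ne_zero
  have hσ := p.σ_ne_zero
  have hσ' := q.σ_ne_zero
  have hT : (p.toMap z).t * (p.γ * z.t + p.δ) = p.α * z.t + p.β := by
    rw [toMap_t, div_mul_cancel₀ _ hp]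
  have hX : (p.toMap z).x * (p.γ * z.t + p.δ) = p.κ * z.x + p.μ₁ * z.t + p.μ₀ := by
    rw [toMap_x, div_mul_cancel₀ _ hp]
  -- The only relation between the new `t` and `x` that the `u` component requires.
  have hTX : (p.toMap z).t * (-p.κ * p.γ * z.x + p.μ₁ * p.δ - p.μ₀ * p.γ) -
      (p.α * p.δ - p.β * p.γ) * (p.toMap z).x = -p.κ * p.α * z.x + p.μ₁ * p.β - p.μ₀ * p.α := by
    apply mul_right_cancel₀ hp
    linear_combination (-p.κ * p.γ * z.x + p.μ₁ * p.δ - p.μ₀ * p.γ) * hT -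
      (p.α * p.δ - p.β * p.γ) * hX
  refine ⟨hne, Prod.ext ?_ (Prod.ext ?_ (Prod.ext ?_ (Prod.ext ?_ ?_)))⟩
  · change (q.toMap (p.toMap z)).t = ((q.comp p).toMap z).t
    rw [toMap_t q, toMap_t (q.comp p), div_eq_div_iff hq hne, hden]
    simp only [comp]
    linear_combination (q.γ * (p.toMap z).t + q.δ) * q.α * hT
  · change (q.toMap (p.toMap z)).x = ((q.comp p).toMap z).x
    rw [toMap_x q, toMap_x (q.comp p), div_eq_div_iff hq hne, hden]
    simp only [comp]
    linear_combination (q.γ * (p.toMap z).t + q.δ) * (q.κ * hX + q.μ₁ * hT)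
  · change (q.toMap (p.toMap z)).u = ((q.comp p).toMap z).u
    rw [toMap_u q, toMap_u (q.comp p), hdisc, toMap_u, toMap_a, hden]
    generalize (p.toMap z).t = T at *
    generalize (p.toMap z).x = X at *
    simp only [comp]
    generalize hD : q.α * q.δ - q.β * q.γ = D at *
    generalize hE : p.α * p.δ - p.β * p.γ = E at *
    field_simp
    rw [← hE] at hTX ⊢
    linear_combination q.κ * q.γ * hTX
  · change (q.toMap (p.toMap z)).a = ((q.comp p).toMap z).a
    rw [toMap_a q, toMap_a (q.comp p), toMap_a]
    simp only [comp]
    field_simp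
  · change (q.toMap (p.toMap z)).g = ((q.comp p).toMap z).g
    rw [toMap_g q, toMap_g (q.comp p), toMap_g, hdisc]
    simp only [comp]
    field_simp

theorem inv_toMap (p : ProjParams) {z : ExtSpace} (hz : z.a ≠ 0) (hp : p.γ * z.t + p.δ ≠ 0) :
    p.inv.γ * (p.toMap z).t + p.inv.δ ≠ 0 ∧ p.inv.toMap (p.toMap z) = z := by
  have hp' := p.disc_ne_zero
  have hσ := p.σ_ne_zero
  have hκ := p.κ_ne_zero
  have hden : p.inv.γ * (p.toMap z).t + p.inv.δ =
      (p.α * p.δ - p.β * p.γ) / (p.γ * z.t + p.δ) := by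
    rw [toMap_t]; simp only [inv]; field_simp; ring
  have hne : p.inv.γ * (p.toMap z).t + p.inv.δ ≠ 0 := by
    rw [hden]; exact div_ne_zero hp' hp
  have hdisc : p.inv.α * p.inv.δ - p.inv.β * p.inv.γ = p.α * p.δ - p.β * p.γ := by
    simp only [inv]; ring
  refine ⟨hne, Prod.ext ?_ (Prod.ext ?_ (Prod.ext ?_ (Prod.ext ?_ ?_)))⟩
  · change (p.inv.toMap (p.toMap z)).t = z.t
    have hT : (p.toMap z).t * (p.γ * z.t + p.δ) = p.α * z.t + p.β := by
      rw [toMap_t, div_mul_cancel₀ _ hp]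
    rw [toMap_t p.inv, div_eq_iff hne, hden, ← mul_div_assoc, eq_div_iff hp]
    simp only [inv]
    linear_combination p.δ * hT
  · change (p.inv.toMap (p.toMap z)).x = z.x
    rw [toMap_x p.inv, div_eq_iff hne, hden, toMap_t, toMap_x]
    simp only [inv]
    field_simp
    ring
  · change (p.inv.toMap (p.toMap z)).u = z.u
    rw [toMap_u p.inv, hdisc, hden, toMap_x, toMap_u, toMap_a]
    simp only [inv]
    generalize hE : p.α * p.δ - p.β * p.γ = E at *
    field_simp
    rw [← hE]
    ring
  · change (p.inv.toMap (p.toMap z)).a = z.a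
    rw [toMap_a p.inv, toMap_a]
    simp only [inv]
    field_simp
  · change (p.inv.toMap (p.toMap z)).g = z.g
    rw [toMap_g p.inv, toMap_g, hdisc]
    simp only [inv]
    field_simp

/-- Each component is homogeneous of degree zero in the tuple without `σ`. -/
theorem Equivalent.toMap_eq {p q : ProjParams} (h : p.Equivalent q) (z : ExtSpace) :
    (p.γ * z.t + p.δ ≠ 0 → q.γ * z.t + q.δ ≠ 0) ∧ p.toMap z = q.toMap z := by
  obtain ⟨⟨c, hc, h1, h2, h3, h4, h5, h6, h7⟩, h8⟩ := h
  have hp := p.disc_ne_zero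
  have e1 : q.γ * z.t + q.δ = c * (p.γ * z.t + p.δ) := by rw [h3, h4]; ring
  have e2 : q.α * q.δ - q.β * q.γ = c ^ 2 * (p.α * p.δ - p.β * p.γ) := by
    rw [h1, h2, h3, h4]; ring
  refine ⟨fun h => by rw [e1]; exact mul_ne_zero hc h,
    Prod.ext ?_ (Prod.ext ?_ (Prod.ext ?_ (Prod.ext ?_ ?_)))⟩
  · change (p.toMap z).t = (q.toMap z).t
    rw [toMap_t, toMap_t, e1, h1, h2, ← mul_div_mul_left _ _ hc]
    ring
  · change (p.toMap z).x = (q.toMap z).x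
    rw [toMap_x, toMap_x, e1, h5, h6, h7, ← mul_div_mul_left _ _ hc]
    ring
  · change (p.toMap z).u = (q.toMap z).u
    rw [toMap_u, toMap_u, e1, e2, h8, h3, h4, h5, h6, h7]
    rw [show 2 * z.a * (c ^ 2 * (p.α * p.δ - p.β * p.γ)) =
      c ^ 2 * (2 * z.a * (p.α * p.δ - p.β * p.γ)) by ring, div_mul_eq_mul_div, div_mul_eq_mul_div,
      ← mul_div_mul_left _ _ (pow_ne_zero 2 hc)]
    ring
  · change (p.toMap z).a = (q.toMap z).a
    rw [toMap_a, toMap_a, h8]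
  · change (p.toMap z).g = (q.toMap z).g
    rw [toMap_g, toMap_g, e2, h5]
    field_simp

/-- The parameters are determined up to equivalence by four points of a slice. -/
theorem equivalent_of_toMap_eq {p q : ProjParams} {z : ExtSpace} (ha : z.a ≠ 0) {s y : ℝ}
    (hs : s ≠ z.t) (hy : y ≠ z.x)
    (hp : p.γ * z.t + p.δ ≠ 0) (hp' : p.γ * s + p.δ ≠ 0)
    (hq : q.γ * z.t + q.δ ≠ 0) (hq' : q.γ * s + q.δ ≠ 0)
    (h₁ : p.toMap z = q.toMap z)
    (h₂ : p.toMap (z.t, y, z.u, z.a, z.g) = q.toMap (z.t, y, z.u, z.a, z.g))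
    (h₃ : p.toMap (s, z.x, z.u, z.a, z.g) = q.toMap (s, z.x, z.u, z.a, z.g))
    (h₄ : p.toMap (s, y, z.u, z.a, z.g) = q.toMap (s, y, z.u, z.a, z.g)) :
    p.Equivalent q := by
  have hκ := p.κ_ne_zero
  have hst : s - z.t ≠ 0 := sub_ne_zero.2 hs
  have hyx : y - z.x ≠ 0 := sub_ne_zero.2 hy
  have t₁ := congrArg ExtSpace.t h₁
  have t₃ := congrArg ExtSpace.t h₃
  have x₁ := congrArg ExtSpace.x h₁
  have x₂ := congrArg ExtSpace.x h₂
  have x₃ := congrArg ExtSpace.x h₃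
  have x₄ := congrArg ExtSpace.x h₄
  have a₁ := congrArg ExtSpace.a h₁
  simp only [toMap_t, toMap_x, toMap_a] at t₁ t₃ x₁ x₂ x₃ x₄ a₁
  rw [div_eq_div_iff hp hq] at t₁ x₁ x₂
  rw [div_eq_div_iff hp' hq'] at t₃ x₃ x₄
  have hσ : q.σ = p.σ := by
    rw [div_eq_div_iff p.σ_ne_zero q.σ_ne_zero] at a₁
    exact mul_left_cancel₀ ha a₁
  -- At fixed `t`, two values of `x` determine `κ / (γ t + δ)`. Hence the two denominators have
  -- ratio `c` at both times, and everything else follows by comparing affine functions of `t` at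
  -- two points.
  set c := q.κ / p.κ with hc
  have hc0 : c ≠ 0 := div_ne_zero q.κ_ne_zero hκ
  have hqκ : q.κ = c * p.κ := by rw [hc]; field_simp
  have d₁ : q.γ * z.t + q.δ = c * (p.γ * z.t + p.δ) := by
    apply mul_left_cancel₀ (mul_ne_zero hyx hκ)
    rw [hqκ] at x₁ x₂
    linear_combination x₂ - x₁
  have d₂ : q.γ * s + q.δ = c * (p.γ * s + p.δ) := by
    apply mul_left_cancel₀ (mul_ne_zero hyx hκ)
    rw [hqκ] at x₃ x₄
    linear_combination x₄ - x₃
  have hγ : q.γ = c * p.γ := by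
    apply mul_left_cancel₀ hst
    linear_combination d₂ - d₁
  have hδ : q.δ = c * p.δ := by rw [hγ] at d₁; linear_combination d₁
  have b₁ : q.α * z.t + q.β = c * (p.α * z.t + p.β) := by
    apply mul_right_cancel₀ hp
    rw [d₁] at t₁
    linear_combination -t₁
  have b₂ : q.α * s + q.β = c * (p.α * s + p.β) := by
    apply mul_right_cancel₀ hp'
    rw [d₂] at t₃
    linear_combination -t₃
  have hα : q.α = c * p.α := by
    apply mul_left_cancel₀ hst
    linear_combination b₂ - b₁
  have m₁ : q.μ₁ * z.t + q.μ₀ = c * (p.μ₁ * z.t + p.μ₀) := by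
    apply mul_right_cancel₀ hp
    rw [d₁, hqκ] at x₁
    linear_combination -x₁
  have m₂ : q.μ₁ * s + q.μ₀ = c * (p.μ₁ * s + p.μ₀) := by
    apply mul_right_cancel₀ hp'
    rw [d₂, hqκ] at x₃
    linear_combination -x₃
  have hμ : q.μ₁ = c * p.μ₁ := by
    apply mul_left_cancel₀ hst
    linear_combination m₂ - m₁
  exact ⟨⟨c, hc0, hα, by rw [hα] at b₁; linear_combination b₁, hγ, hδ, hqκ, hμ,
    by rw [hμ] at m₁; linear_combination m₁⟩, hσ⟩

/-- Transformations that coincide near a point of a slice have equivalent parameters. -/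
theorem equivalent_of_eventually {p q : ProjParams} {z : ExtSpace} (ha : z.a ≠ 0)
    (h : ∀ᶠ y in 𝓝 z, y.a = z.a →
      p.γ * y.t + p.δ ≠ 0 ∧ q.γ * y.t + q.δ ≠ 0 ∧ p.toMap y = q.toMap y) :
    p.Equivalent q := by
  have hc : Continuous fun τ : ℝ × ℝ =>
      ((z.t + τ.1, z.x + τ.2, z.u, z.a, z.g) : ExtSpace) := by fun_prop
  have h' : ∀ᶠ τ : ℝ × ℝ in 𝓝 (0, 0),
      p.γ * (z.t + τ.1) + p.δ ≠ 0 ∧ q.γ * (z.t + τ.1) + q.δ ≠ 0 ∧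
        p.toMap (z.t + τ.1, z.x + τ.2, z.u, z.a, z.g) =
          q.toMap (z.t + τ.1, z.x + τ.2, z.u, z.a, z.g) := by
    have : Filter.Tendsto (fun τ : ℝ × ℝ => ((z.t + τ.1, z.x + τ.2, z.u, z.a, z.g) : ExtSpace))
        (𝓝 (0, 0)) (𝓝 z) := by
      have := hc.tendsto (0, 0)
      simpa using this
    filter_upwards [this.eventually h] with τ hτ using hτ rfl
  obtain ⟨r, hr, hB⟩ := Metric.eventually_nhds_iff_ball.1 h'
  have hmem : ∀ τ₁ ∈ ({0, r / 2} : Set ℝ), ∀ τ₂ ∈ ({0, r / 2} : Set ℝ),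
      ((τ₁, τ₂) : ℝ × ℝ) ∈ Metric.ball ((0, 0) : ℝ × ℝ) r := by
    have h0 : ∀ τ ∈ ({0, r / 2} : Set ℝ), τ ∈ Metric.ball (0 : ℝ) r := by
      rintro τ (rfl | rfl)
      · simpa using hr
      · rw [Metric.mem_ball, Real.dist_eq, sub_zero, abs_of_pos] <;> linarith
    intro τ₁ h₁ τ₂ h₂
    rw [← ball_prod_same]
    exact ⟨h0 _ h₁, h0 _ h₂⟩
  have h00 := hB _ (hmem 0 (by simp) 0 (by simp))
  have h01 := hB _ (hmem 0 (by simp) (r / 2) (by simp))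
  have h10 := hB _ (hmem (r / 2) (by simp) 0 (by simp))
  have h11 := hB _ (hmem (r / 2) (by simp) (r / 2) (by simp))
  simp only [add_zero] at h00 h01 h10 h11
  refine equivalent_of_toMap_eq ha (s := z.t + r / 2) (y := z.x + r / 2) (by simpa using hr.ne')
    (by simpa using hr.ne') h00.1 h10.1 h00.2.1 h10.2.1 h00.2.2 h01.2.2 h10.2.2 h11.2.2

end ProjParams

/-! ### The projective form near a point. -/

theorem hasDerivAt_line_t {f : ExtSpace → ℝ} {t x u a g : ℝ}
    (hf : DifferentiableAt ℝ f (t, x, u, a, g)) :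
    HasDerivAt (fun s => f (s, x, u, a, g)) (fderiv ℝ f (t, x, u, a, g) (1, 0, 0, 0, 0)) t :=
  hf.hasFDerivAt.comp_hasDerivAt t ((hasDerivAt_id t).prodMk (hasDerivAt_const t (x, u, a, g)))

theorem hasDerivAt_line_x {f : ExtSpace → ℝ} {t x u a g : ℝ}
    (hf : DifferentiableAt ℝ f (t, x, u, a, g)) :
    HasDerivAt (fun y => f (t, y, u, a, g)) (fderiv ℝ f (t, x, u, a, g) (0, 1, 0, 0, 0)) x :=
  hf.hasFDerivAt.comp_hasDerivAt x
    ((hasDerivAt_const x t).prodMk ((hasDerivAt_id x).prodMk (hasDerivAt_const x (u, a, g))))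

namespace IsGenEquiv

variable {Ω : Set ExtSpace} {Φ : ExtSpace → ExtSpace} {z : ExtSpace}

theorem a_ne_zero (h : IsGenEquiv Ω Φ) (hΩ : IsExtDomain Ω) (hz : z ∈ Ω) : (Φ z).a ≠ 0 := by
  obtain ⟨E', hE⟩ := h.maps_class (affineEq z (hΩ.a_ne_zero z hz) 0)
  have h0 := hE.map_elements z.t z.x z.u (mem_affineEq_I (hΩ.g_ne_zero z hz))
    (by rw [affineEq_lift_self]; exact hz)
  rw [affineEq_lift_self] at h0
  rw [h0.1]
  exact E'.a_ne_zero

/-- Near each point of a slice, a generalized equivalence transformation has the projective form. -/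
theorem exists_eventually_eq_toMap (h : IsGenEquiv Ω Φ) (hΩ : IsExtDomain Ω) (hz : z ∈ Ω) :
    ∃ p : ProjParams, ∀ᶠ y in 𝓝 z, y.a = z.a → p.γ * y.t + p.δ ≠ 0 ∧ Φ y = p.toMap y := by
  obtain ⟨t₀, x₀, u₀, a, g₀⟩ := z
  obtain ⟨r, hr, hB⟩ := Metric.isOpen_iff.1 hΩ.isOpen _ hz
  have ha : a ≠ 0 := hΩ.a_ne_zero _ hz
  have ha' := h.a_ne_zero hΩ hz
  set a' := (Φ (t₀, x₀, u₀, a, g₀)).a with ha'def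
  have ht₀ : t₀ ∈ Metric.ball t₀ r := Metric.mem_ball_self hr
  have hx₀ : x₀ ∈ Metric.ball x₀ r := Metric.mem_ball_self hr
  have hu₀ : u₀ ∈ Metric.ball u₀ r := Metric.mem_ball_self hr
  have hg₀ : g₀ ∈ Metric.ball g₀ r := Metric.mem_ball_self hr
  have hbox : ∀ {t x u g : ℝ}, t ∈ Metric.ball t₀ r → x ∈ Metric.ball x₀ r →
      u ∈ Metric.ball u₀ r → g ∈ Metric.ball g₀ r →
      ((t, x, u, a, g) : ExtSpace) ∈ Metric.ball ((t₀, x₀, u₀, a, g₀) : ExtSpace) r := by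
    intro t x u g ht hx hu hg
    simp only [← ball_prod_same]
    exact ⟨ht, hx, hu, Metric.mem_ball_self hr, hg⟩
  have hd : ∀ y ∈ Metric.ball ((t₀, x₀, u₀, a, g₀) : ExtSpace) r, DifferentiableAt ℝ Φ y :=
    fun y hy => h.isPointTransformation.differentiableAt hΩ.isOpen (hB hy)
  -- the components do not depend on some of the variables
  have hconst : ∀ {f : ExtSpace → ℝ},
      (∀ y ∈ Metric.ball ((t₀, x₀, u₀, a, g₀) : ExtSpace) r, DifferentiableAt ℝ f y) →
      ∀ {t t' x x' u u' g g' : ℝ}, t ∈ Metric.ball t₀ r → x ∈ Metric.ball x₀ r →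
      u ∈ Metric.ball u₀ r → g ∈ Metric.ball g₀ r →
      t' ∈ Metric.ball t₀ r → x' ∈ Metric.ball x₀ r →
      u' ∈ Metric.ball u₀ r → g' ∈ Metric.ball g₀ r →
      (∀ y ∈ Metric.ball ((t₀, x₀, u₀, a, g₀) : ExtSpace) r,
        fderiv ℝ f y (t - t', x - x', u - u', 0, g - g') = 0) →
      f (t, x, u, a, g) = f (t', x', u', a, g') := by
    intro f hf t t' x x' u u' g g' ht hx hu hg ht' hx' hu' hg' h0
    refine eq_of_fderiv_segment_eq_zero (convex_ball _ r) hf (hbox ht' hx' hu' hg')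
      (hbox ht hx hu hg) fun w hw => ?_
    have := h0 w hw
    simpa using this
  have hTc : ∀ {t x u g : ℝ}, t ∈ Metric.ball t₀ r → x ∈ Metric.ball x₀ r →
      u ∈ Metric.ball u₀ r → g ∈ Metric.ball g₀ r →
      (Φ (t, x, u, a, g)).t = (Φ (t, x₀, u₀, a, g₀)).t := by
    intro t x u g ht hx hu hg
    refine hconst (f := fun y => (Φ y).t) (fun y hy => (hd y hy).fst) ht hx hu hg ht hx₀ hu₀ hg₀ ?_
    intro y hy
    rw [fderiv_comp_t (hd y hy), map_dir_t, (h.fderiv_t_fiber hΩ (hB hy)).1,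
      (h.fderiv_t_fiber hΩ (hB hy)).2, (h.fderiv_t_g hΩ (hB hy)).1]
    ring
  have hXc : ∀ {t x u g : ℝ}, t ∈ Metric.ball t₀ r → x ∈ Metric.ball x₀ r →
      u ∈ Metric.ball u₀ r → g ∈ Metric.ball g₀ r →
      (Φ (t, x, u, a, g)).x = (Φ (t, x, u₀, a, g₀)).x := by
    intro t x u g ht hx hu hg
    refine hconst (f := fun y => (Φ y).x) (fun y hy => (hd y hy).snd.fst) ht hx hu hg ht hx hu₀ hg₀
      ?_
    intro y hy
    rw [fderiv_comp_x (hd y hy), map_dir_x, (h.fderiv_x_u hΩ (hB hy)).1,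
      (h.fderiv_x_g hΩ (hB hy)).1]
    ring
  have hUc : ∀ {t x u g : ℝ}, t ∈ Metric.ball t₀ r → x ∈ Metric.ball x₀ r →
      u ∈ Metric.ball u₀ r → g ∈ Metric.ball g₀ r →
      (Φ (t, x, u, a, g)).u = (Φ (t, x, u, a, g₀)).u := by
    intro t x u g ht hx hu hg
    refine hconst (f := fun y => (Φ y).u) (fun y hy => (hd y hy).snd.snd.fst) ht hx hu hg ht hx hu
      hg₀ ?_
    intro y hy
    rw [fderiv_comp_u (hd y hy), map_dir_u, (h.fderiv_x_g hΩ (hB hy)).2]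
    ring
  have hAc : ∀ {t x u g : ℝ}, t ∈ Metric.ball t₀ r → x ∈ Metric.ball x₀ r →
      u ∈ Metric.ball u₀ r → g ∈ Metric.ball g₀ r → (Φ (t, x, u, a, g)).a = a' := by
    intro t x u g ht hx hu hg
    refine hconst (f := fun y => (Φ y).a) (fun y hy => (hd y hy).snd.snd.snd.fst) ht hx hu hg ht₀ hx₀
      hu₀ hg₀ ?_
    intro y hy
    rw [fderiv_comp_a (hd y hy), h.fderiv_a_eq_zero hΩ (hB hy)]
  have hGc : ∀ {t x : ℝ}, t ∈ Metric.ball t₀ r → x ∈ Metric.ball x₀ r →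
      (Φ (t, x, u₀, a, g₀)).g = (Φ (t, x₀, u₀, a, g₀)).g := by
    intro t x ht hx
    refine hconst (f := fun y => (Φ y).g) (fun y hy => (hd y hy).snd.snd.snd.snd) ht hx hu₀ hg₀ ht
      hx₀ hu₀ hg₀ ?_
    intro y hy
    have h0 := h.fderiv_g_x hΩ (hB hy)
    rw [fderiv_comp_g (hd y hy), map_dir]
    simp only [sub_self, zero_smul, zero_add, add_zero]
    change (x - x₀) * (fderiv ℝ Φ y (0, 1, 0, 0, 0)).g = 0
    rw [h0, mul_zero]
  -- the derivatives do not depend on these variables either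
  have dT : ∀ {t x u g : ℝ}, t ∈ Metric.ball t₀ r → x ∈ Metric.ball x₀ r →
      u ∈ Metric.ball u₀ r → g ∈ Metric.ball g₀ r →
      (fderiv ℝ Φ (t, x, u, a, g) (1, 0, 0, 0, 0)).t =
        (fderiv ℝ Φ (t, x₀, u₀, a, g₀) (1, 0, 0, 0, 0)).t := by
    intro t x u g ht hx hu hg
    have h1 := hd _ (hbox ht hx hu hg)
    have h2 := hd _ (hbox ht hx₀ hu₀ hg₀)
    rw [← fderiv_comp_t h1, ← fderiv_comp_t h2]
    refine (hasDerivAt_line_t h1.fst).unique ((hasDerivAt_line_t h2.fst).congr_of_eventuallyEq ?_)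
    filter_upwards [Metric.isOpen_ball.mem_nhds ht] with s hs using hTc hs hx hu hg
  have dXt : ∀ {t x u g : ℝ}, t ∈ Metric.ball t₀ r → x ∈ Metric.ball x₀ r →
      u ∈ Metric.ball u₀ r → g ∈ Metric.ball g₀ r →
      (fderiv ℝ Φ (t, x, u, a, g) (1, 0, 0, 0, 0)).x =
        (fderiv ℝ Φ (t, x, u₀, a, g₀) (1, 0, 0, 0, 0)).x := by
    intro t x u g ht hx hu hg
    have h1 := hd _ (hbox ht hx hu hg)
    have h2 := hd _ (hbox ht hx hu₀ hg₀)
    rw [← fderiv_comp_x h1, ← fderiv_comp_x h2]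
    refine (hasDerivAt_line_t h1.snd.fst).unique
      ((hasDerivAt_line_t h2.snd.fst).congr_of_eventuallyEq ?_)
    filter_upwards [Metric.isOpen_ball.mem_nhds ht] with s hs using hXc hs hx hu hg
  have dXx : ∀ {t x u g : ℝ}, t ∈ Metric.ball t₀ r → x ∈ Metric.ball x₀ r →
      u ∈ Metric.ball u₀ r → g ∈ Metric.ball g₀ r →
      (fderiv ℝ Φ (t, x, u, a, g) (0, 1, 0, 0, 0)).x =
        (fderiv ℝ Φ (t, x, u₀, a, g₀) (0, 1, 0, 0, 0)).x := by
    intro t x u g ht hx hu hg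
    have h1 := hd _ (hbox ht hx hu hg)
    have h2 := hd _ (hbox ht hx hu₀ hg₀)
    rw [← fderiv_comp_x h1, ← fderiv_comp_x h2]
    refine (hasDerivAt_line_x h1.snd.fst).unique
      ((hasDerivAt_line_x h2.snd.fst).congr_of_eventuallyEq ?_)
    filter_upwards [Metric.isOpen_ball.mem_nhds hx] with s hs using hXc ht hs hu hg
  -- In the scaling law `g X_x ^ 2 = g' T_t` both factors on the right are independent of `x`. So
  -- `X_x ^ 2` is too, and a continuous nonvanishing `X_x` keeps its sign on the interval.
  have hXxc : ∀ {t x : ℝ}, t ∈ Metric.ball t₀ r → x ∈ Metric.ball x₀ r →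
      (fderiv ℝ Φ (t, x, u₀, a, g₀) (0, 1, 0, 0, 0)).x =
        (fderiv ℝ Φ (t, x₀, u₀, a, g₀) (0, 1, 0, 0, 0)).x := by
    intro t x ht hx
    have hcont : ContinuousOn (fun y => (fderiv ℝ Φ (t, y, u₀, a, g₀) (0, 1, 0, 0, 0)).x)
        (Metric.ball x₀ r) := by
      have h1 := h.isPointTransformation.smooth.continuousOn_fderiv_of_isOpen hΩ.isOpen (by simp)
      have h2 : ContinuousOn (fun y => fderiv ℝ Φ (t, y, u₀, a, g₀)) (Metric.ball x₀ r) :=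
        h1.comp (Continuous.continuousOn (by fun_prop))
          fun y hy => hB (hbox ht hy hu₀ hg₀)
      exact (h2.clm_apply continuousOn_const).snd.fst
    refine (convex_ball x₀ r).isPreconnected.eq_of_sq_eq hcont continuousOn_const ?_ ?_ hx₀ ?_ hx
    · intro y hy
      have k1 := (h.fderiv_x_u hΩ (hB (hbox ht hy hu₀ hg₀))).2
      have k2 := (h.fderiv_x_u hΩ (hB (hbox ht hx₀ hu₀ hg₀))).2
      rw [dT ht hy hu₀ hg₀, hGc ht hy] at k1
      exact mul_left_cancel₀ (hΩ.g_ne_zero _ hz) (k1.trans k2.symm)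
    · intro y hy
      exact (h.fderiv_x_x_ne_zero hΩ (hB (hbox ht hx₀ hu₀ hg₀))).1
    · rfl
  obtain ⟨c, α, β, γ, δ, n, n₀, hc, hdisc, H⟩ := integrate_determining_equations
    (t₀ := t₀) (x₀ := x₀) (u₀ := u₀) hr ha ha'
    (T := fun t => (Φ (t, x₀, u₀, a, g₀)).t)
    (T' := fun t => (fderiv ℝ Φ (t, x₀, u₀, a, g₀) (1, 0, 0, 0, 0)).t)
    (X := fun t x => (Φ (t, x, u₀, a, g₀)).x)
    (Xt := fun t x => (fderiv ℝ Φ (t, x, u₀, a, g₀) (1, 0, 0, 0, 0)).x)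
    (Xx := fun t x => (fderiv ℝ Φ (t, x, u₀, a, g₀) (0, 1, 0, 0, 0)).x)
    (U := fun t x u => (Φ (t, x, u, a, g₀)).u)
    (Ut := fun t x u => (fderiv ℝ Φ (t, x, u, a, g₀) (1, 0, 0, 0, 0)).u)
    (Ux := fun t x u => (fderiv ℝ Φ (t, x, u, a, g₀) (0, 1, 0, 0, 0)).u)
    (fun t ht => by
      have h1 := hd _ (hbox ht hx₀ hu₀ hg₀)
      rw [← fderiv_comp_t h1]
      exact hasDerivAt_line_t h1.fst)
    (fun t ht => (h.fderiv_t_g hΩ (hB (hbox ht hx₀ hu₀ hg₀))).2.1)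
    (fun t ht x hx => by
      have h1 := hd _ (hbox ht hx hu₀ hg₀)
      rw [← fderiv_comp_x h1]
      exact hasDerivAt_line_t h1.snd.fst)
    (fun t ht x hx => by
      have h1 := hd _ (hbox ht hx hu₀ hg₀)
      rw [← fderiv_comp_x h1]
      exact hasDerivAt_line_x h1.snd.fst)
    (fun t ht => (h.fderiv_x_x_ne_zero hΩ (hB (hbox ht hx₀ hu₀ hg₀))).1)
    (fun t ht x hx => hXxc ht hx)
    (fun t ht x hx u hu => by
      have h1 := hd _ (hbox ht hx hu hg₀)
      rw [← fderiv_comp_u h1]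
      exact hasDerivAt_line_t h1.snd.snd.fst)
    (fun t ht x hx u hu => by
      have h1 := hd _ (hbox ht hx hu hg₀)
      rw [← fderiv_comp_u h1]
      exact hasDerivAt_line_x h1.snd.snd.fst)
    (fun t ht x hx u hu => by
      have := (h.determining_equations hΩ (hB (hbox ht hx hu hg₀))).1
      rwa [hAc ht hx hu hg₀, dT ht hx hu hg₀, dXx ht hx hu hg₀, dXt ht hx hu hg₀] at this)
    (fun t ht x hx u hu => (h.determining_equations hΩ (hB (hbox ht hx hu hg₀))).2)
  have hdisc0 : α * δ - β * γ ≠ 0 := by rw [hdisc]; exact one_div_ne_zero hc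
  -- The free multiplier is used to normalize `κ = 1`; the values of `μ₁` and `μ₀` come from `X₀ = n
  -- T + n₀`.
  let p : ProjParams :=
    { α := α, β := β, γ := γ, δ := δ, κ := 1, μ₁ := n * α + n₀ * γ, μ₀ := n * β + n₀ * δ
      σ := a / a', disc_ne_zero := hdisc0
      κσ_ne_zero := by rw [one_mul]; exact div_ne_zero ha ha' }
  refine ⟨p, ?_⟩
  filter_upwards [Metric.ball_mem_nhds _ hr] with y hy hya
  obtain ⟨t, x, u, b, g⟩ := y
  simp only [← ball_prod_same, Set.mem_prod] at hy
  obtain ⟨ht, hx, hu, -, hg⟩ := hy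
  obtain rfl : b = a := hya
  obtain ⟨h1, h2, h3, h4, h5⟩ := H t ht
  refine ⟨h1, Prod.ext ?_ (Prod.ext ?_ (Prod.ext ?_ (Prod.ext ?_ ?_)))⟩
  · change (Φ (t, x, u, b, g)).t = (p.toMap (t, x, u, b, g)).t
    rw [hTc ht hx hu hg, h2, ProjParams.toMap_t]
  · change (Φ (t, x, u, b, g)).x = (p.toMap (t, x, u, b, g)).x
    rw [hXc ht hx hu hg, h4 x hx, ProjParams.toMap_x]
    simp only [p]
    congr 1
    ring
  · change (Φ (t, x, u, b, g)).u = (p.toMap (t, x, u, b, g)).u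
    rw [hUc ht hx hu hg, h5 x hx u hu, ProjParams.toMap_u]
    simp only [p]
    rw [hdisc]
    have e : (n * α + n₀ * γ) * δ - (n * β + n₀ * δ) * γ = n / c := by
      rw [div_eq_mul_one_div, ← hdisc]; ring
    rw [add_sub_assoc, e]
    field_simp
  · change (Φ (t, x, u, b, g)).a = (p.toMap (t, x, u, b, g)).a
    rw [hAc ht hx hu hg, ProjParams.toMap_a]
    simp only [p]
    field_simp
  · change (Φ (t, x, u, b, g)).g = (p.toMap (t, x, u, b, g)).g
    rw [ProjParams.toMap_g]
    simp only [p]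
    rw [hdisc]
    -- The `g` component is read off from the scaling law together with `X_x ^ 2 = c T_t`; no
    -- integration is needed.
    have k1 := (h.fderiv_x_u hΩ (hB (hbox ht hx hu hg))).2
    have k2 := (h.fderiv_t_g hΩ (hB (hbox ht hx₀ hu₀ hg₀))).2.1
    rw [dT ht hx hu hg, dXx ht hx hu hg, hXxc ht hx, h3] at k1
    apply mul_right_cancel₀ k2
    rw [← k1]
    field_simp

end IsGenEquiv

/-! ### Smoothness, Jacobian and image equations of the listed maps. -/

namespace ProjParams

/-- The transformation of `t`. -/
noncomputable def mobius (p : ProjParams) (t : ℝ) : ℝ := (p.α * t + p.β) / (p.γ * t + p.δ)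

theorem inv_mobius_den (p : ProjParams) {t : ℝ} (h : p.γ * t + p.δ ≠ 0) :
    p.inv.γ * p.mobius t + p.inv.δ = (p.α * p.δ - p.β * p.γ) / (p.γ * t + p.δ) := by
  simp only [mobius, inv]
  field_simp
  ring

theorem inv_mobius (p : ProjParams) {t : ℝ} (h : p.γ * t + p.δ ≠ 0) :
    p.inv.γ * p.mobius t + p.inv.δ ≠ 0 ∧ p.inv.mobius (p.mobius t) = t := by
  have hd := p.inv_mobius_den h
  have hne : p.inv.γ * p.mobius t + p.inv.δ ≠ 0 := by
    rw [hd]; exact div_ne_zero p.disc_ne_zero h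
  refine ⟨hne, ?_⟩
  have hT : p.mobius t * (p.γ * t + p.δ) = p.α * t + p.β := by
    rw [mobius, div_mul_cancel₀ _ h]
  rw [mobius, div_eq_iff hne, hd, ← mul_div_assoc, eq_div_iff h]
  simp only [inv]
  linear_combination p.δ * hT

theorem mobius_inv (p : ProjParams) {s : ℝ} (h : p.inv.γ * s + p.inv.δ ≠ 0) :
    p.γ * p.inv.mobius s + p.δ ≠ 0 ∧ p.mobius (p.inv.mobius s) = s := by
  have hT : p.inv.mobius s * (p.inv.γ * s + p.inv.δ) = p.inv.α * s + p.inv.β := by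
    rw [mobius, div_mul_cancel₀ _ h]
  generalize p.inv.mobius s = t at *
  simp only [inv] at h hT
  have hd : (p.γ * t + p.δ) * (-p.γ * s + p.α) = p.α * p.δ - p.β * p.γ := by
    linear_combination p.γ * hT
  have hne : p.γ * t + p.δ ≠ 0 := by
    intro h0
    rw [h0, zero_mul] at hd
    exact p.disc_ne_zero hd.symm
  refine ⟨hne, ?_⟩
  rw [mobius, div_eq_iff hne]
  linear_combination hT

theorem contDiffOn_mobius (p : ProjParams) :
    ContDiffOn ℝ ∞ p.mobius {t | p.γ * t + p.δ ≠ 0} := by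
  unfold mobius
  exact ContDiffOn.div (by fun_prop) (by fun_prop) fun t ht => ht

theorem contDiffAt_toMap (p : ProjParams) {z : ExtSpace} (ha : z.a ≠ 0)
    (hz : p.γ * z.t + p.δ ≠ 0) : ContDiffAt ℝ ∞ p.toMap z := by
  unfold toMap
  refine ContDiffAt.prodMk ?_ (ContDiffAt.prodMk ?_ (ContDiffAt.prodMk ?_
    (ContDiffAt.prodMk ?_ ?_)))
  · exact ContDiffAt.div (by fun_prop) (by fun_prop) hz
  · exact ContDiffAt.div (by fun_prop) (by fun_prop) hz
  · refine ContDiffAt.mul (ContDiffAt.div (by fun_prop) (by fun_prop) ?_) (by fun_prop)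
    exact mul_ne_zero (mul_ne_zero two_ne_zero ha) p.disc_ne_zero
  · fun_prop
  · fun_prop

/-- The map of the inverse constants is a smooth left inverse near each point, so the two Jacobians
multiply to `1`. -/
theorem isPointTransformation_toMap (p : ProjParams) {Ω : Set ExtSpace} (hΩ : IsExtDomain Ω)
    (hp : ∀ z ∈ Ω, p.γ * z.t + p.δ ≠ 0) : IsPointTransformation Ω p.toMap where
  smooth := fun z hz => (p.contDiffAt_toMap (hΩ.a_ne_zero z hz) (hp z hz)).contDiffWithinAt
  jacobian_ne_zero := by
    intro z hz
    have ha := hΩ.a_ne_zero z hz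
    have h1 := (p.contDiffAt_toMap ha (hp z hz)).differentiableAt (by simp)
    have h2 : DifferentiableAt ℝ p.inv.toMap (p.toMap z) :=
      (p.inv.contDiffAt_toMap (by rw [toMap_a]; exact div_ne_zero ha p.σ_ne_zero)
        (p.inv_toMap ha (hp z hz)).1).differentiableAt (by simp)
    have h3 : (fun y => p.inv.toMap (p.toMap y)) =ᶠ[𝓝 z] fun y => y := by
      filter_upwards [hΩ.isOpen.mem_nhds hz] with y hy
      exact (p.inv_toMap (hΩ.a_ne_zero y hy) (hp y hy)).2
    have h4 : (fderiv ℝ p.inv.toMap (p.toMap z)).comp (fderiv ℝ p.toMap z) =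
        ContinuousLinearMap.id ℝ ExtSpace :=
      ((h2.hasFDerivAt.comp z h1.hasFDerivAt).congr_of_eventuallyEq h3.symm).unique
        (hasFDerivAt_id z)
    intro h0
    have h5 : LinearMap.det ((fderiv ℝ p.inv.toMap (p.toMap z) : ExtSpace →ₗ[ℝ] ExtSpace) ∘ₗ
        (fderiv ℝ p.toMap z : ExtSpace →ₗ[ℝ] ExtSpace)) = 1 := by
      have h6 : (fderiv ℝ p.inv.toMap (p.toMap z) : ExtSpace →ₗ[ℝ] ExtSpace) ∘ₗ
          (fderiv ℝ p.toMap z : ExtSpace →ₗ[ℝ] ExtSpace) = LinearMap.id :=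
        congrArg (fun L : ExtSpace →L[ℝ] ExtSpace => (L : ExtSpace →ₗ[ℝ] ExtSpace)) h4
      rw [h6, LinearMap.det_id]
    rw [LinearMap.det_comp,
      show LinearMap.det (fderiv ℝ p.toMap z : ExtSpace →ₗ[ℝ] ExtSpace) = 0 from h0, mul_zero] at h5
    exact zero_ne_one h5

/-- The image equation of `E` under `p`, on the image of the open interval `E.I ∩ J`. -/
noncomputable def imageEq (p : ProjParams) (E : BurgersEq) (J : Set ℝ) (hJ : IsOpen J)
    (hJ' : J.OrdConnected) (hp : ∀ t ∈ J, p.γ * t + p.δ ≠ 0) : BurgersEq where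
  a := E.a / p.σ
  I := p.mobius '' (E.I ∩ J)
  g := fun s => p.κ ^ 2 / (p.α * p.δ - p.β * p.γ) * E.g (p.inv.mobius s)
  a_ne_zero := div_ne_zero E.a_ne_zero p.σ_ne_zero
  isOpen_I := by
    -- The image of the interval is a preimage under the inverse fractional linear map, which gives
    -- openness by continuity.
    have h : p.mobius '' (E.I ∩ J) =
        {s | p.inv.γ * s + p.inv.δ ≠ 0} ∩ p.inv.mobius ⁻¹' (E.I ∩ J) := by
      ext s
      constructor
      · rintro ⟨t, ht, rfl⟩
        have := p.inv_mobius (hp t ht.2)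
        exact ⟨this.1, by rw [Set.mem_preimage, this.2]; exact ht⟩
      · rintro ⟨h1, h2⟩
        exact ⟨_, h2, (p.mobius_inv h1).2⟩
    rw [h]
    exact p.inv.contDiffOn_mobius.continuousOn.isOpen_inter_preimage
      (isOpen_ne_fun (by fun_prop) continuous_const) (E.isOpen_I.inter hJ)
  ordConnected_I := by
    have h1 : IsPreconnected (E.I ∩ J) := (E.ordConnected_I.inter hJ').isPreconnected
    exact (h1.image _ (p.contDiffOn_mobius.continuousOn.mono fun t ht => hp t ht.2)).ordConnected
  smooth_g := by
    refine contDiffOn_const.mul (E.smooth_g.comp (t := E.I) (p.inv.contDiffOn_mobius.mono ?_) ?_)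
    · rintro s ⟨t, ht, rfl⟩
      exact (p.inv_mobius (hp t ht.2)).1
    · rintro s ⟨t, ht, rfl⟩
      rw [(p.inv_mobius (hp t ht.2)).2]
      exact ht.1
  g_ne_zero := by
    rintro s ⟨t, ht, rfl⟩
    rw [(p.inv_mobius (hp t ht.2)).2]
    exact mul_ne_zero (div_ne_zero (pow_ne_zero 2 p.κ_ne_zero) p.disc_ne_zero)
      (E.g_ne_zero t ht.1)

end ProjParams

/-! ### Sufficiency: the listed maps preserve the class. -/

/-- Transformed functions satisfy the transformed equation. -/
theorem ProjParams.jet_rule (p : ProjParams) {u v : ℝ × ℝ → ℝ} {a g t x : ℝ} (ha : a ≠ 0)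
    (ht : p.γ * t + p.δ ≠ 0) (hu : ContDiffAt ℝ ∞ u (t, x))
    (hv : ContDiffAt ℝ ∞ v (p.mobius t, (p.κ * x + p.μ₁ * t + p.μ₀) / (p.γ * t + p.δ)))
    (huv : ∀ᶠ q : ℝ × ℝ in 𝓝 (t, x),
      v (p.mobius q.1, (p.κ * q.2 + p.μ₁ * q.1 + p.μ₀) / (p.γ * q.1 + p.δ)) =
        p.σ / (2 * a * (p.α * p.δ - p.β * p.γ)) *
          (2 * a * p.κ * (p.γ * q.1 + p.δ) * u q - p.κ * p.γ * q.2 + p.μ₁ * p.δ - p.μ₀ * p.γ))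
    (hE : fderiv ℝ u (t, x) (1, 0) + 2 * a * u (t, x) * fderiv ℝ u (t, x) (0, 1) =
      g * secondLineDeriv u (t, x) (0, 1)) :
    fderiv ℝ v (p.mobius t, (p.κ * x + p.μ₁ * t + p.μ₀) / (p.γ * t + p.δ)) (1, 0) +
        2 * (a / p.σ) * v (p.mobius t, (p.κ * x + p.μ₁ * t + p.μ₀) / (p.γ * t + p.δ)) *
          fderiv ℝ v (p.mobius t, (p.κ * x + p.μ₁ * t + p.μ₀) / (p.γ * t + p.δ)) (0, 1) =
      p.κ ^ 2 / (p.α * p.δ - p.β * p.γ) * g *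
        secondLineDeriv v (p.mobius t, (p.κ * x + p.μ₁ * t + p.μ₀) / (p.γ * t + p.δ)) (0, 1) := by
  have hD := p.disc_ne_zero
  have hσ := p.σ_ne_zero
  have hκ := p.κ_ne_zero
  set y₀ : ℝ × ℝ := (p.mobius t, (p.κ * x + p.μ₁ * t + p.μ₀) / (p.γ * t + p.δ)) with hy₀
  set D := p.α * p.δ - p.β * p.γ with hDdef
  set C := p.σ / (2 * a * D) with hC
  have hvd := (hv.differentiableAt (by simp)).hasFDerivAt
  have hud := (hu.differentiableAt (by simp)).hasFDerivAt
  have hv2 : ∀ w₁ w₂ : ℝ, fderiv ℝ v y₀ (w₁, w₂) =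
      w₁ * fderiv ℝ v y₀ (1, 0) + w₂ * fderiv ℝ v y₀ (0, 1) := by
    intro w₁ w₂
    have : ((w₁, w₂) : ℝ × ℝ) = w₁ • (1, 0) + w₂ • (0, 1) := by simp
    rw [this, map_add, map_smul, map_smul, smul_eq_mul, smul_eq_mul]
  -- derivatives of the transformation of the independent variables
  have hd : HasDerivAt (fun s => p.γ * s + p.δ) p.γ t := by
    simpa using ((hasDerivAt_id t).const_mul p.γ).add_const p.δ
  have hτ : HasDerivAt p.mobius (D / (p.γ * t + p.δ) ^ 2) t := by
    have h1 : HasDerivAt (fun s => p.α * s + p.β) p.α t := by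
      simpa using ((hasDerivAt_id t).const_mul p.α).add_const p.β
    exact (h1.div hd ht).congr_deriv (by rw [hDdef]; ring)
  have hξt : HasDerivAt (fun s => (p.κ * x + p.μ₁ * s + p.μ₀) / (p.γ * s + p.δ))
      ((p.μ₁ * (p.γ * t + p.δ) - (p.κ * x + p.μ₁ * t + p.μ₀) * p.γ) / (p.γ * t + p.δ) ^ 2) t := by
    have h1 : HasDerivAt (fun s => p.κ * x + p.μ₁ * s + p.μ₀) p.μ₁ t := by
      simpa using (((hasDerivAt_id t).const_mul p.μ₁).const_add (p.κ * x)).add_const p.μ₀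
    exact h1.div hd ht
  have hξx : ∀ y, HasDerivAt (fun y => ((p.mobius t,
      (p.κ * y + p.μ₁ * t + p.μ₀) / (p.γ * t + p.δ)) : ℝ × ℝ)) (0, p.κ / (p.γ * t + p.δ)) y := by
    intro y
    refine (hasDerivAt_const y _).prodMk ?_
    have h1 : HasDerivAt (fun y => p.κ * y + p.μ₁ * t + p.μ₀) p.κ y := by
      simpa using (((hasDerivAt_id y).const_mul p.κ).add_const (p.μ₁ * t)).add_const p.μ₀
    exact h1.div_const _
  -- At fixed `t` the image curve is a straight line run at constant speed `κ / (γ t + δ)`, so `v_x`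
  -- and `v_xx` are read off along it without an acceleration term. The curve of constant `x` then
  -- yields `v_t`.
  have hx : (fun y => v (p.mobius t, (p.κ * y + p.μ₁ * t + p.μ₀) / (p.γ * t + p.δ))) =ᶠ[𝓝 x]
      fun y => C * (2 * a * p.κ * (p.γ * t + p.δ) * u (t, y) - p.κ * p.γ * y + p.μ₁ * p.δ -
        p.μ₀ * p.γ) :=
    (hasDerivAt_prodMk_right t x).continuousAt.eventually huv
  have hux : ∀ {y : ℝ}, DifferentiableAt ℝ (fun y => u (t, y)) y →
      HasDerivAt (fun y => C * (2 * a * p.κ * (p.γ * t + p.δ) * u (t, y) - p.κ * p.γ * y +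
        p.μ₁ * p.δ - p.μ₀ * p.γ))
      (C * (2 * a * p.κ * (p.γ * t + p.δ) * deriv (fun y => u (t, y)) y - p.κ * p.γ)) y := by
    intro y hy
    have h1 := (((hy.hasDerivAt.const_mul (2 * a * p.κ * (p.γ * t + p.δ))).sub
      ((hasDerivAt_id y).const_mul (p.κ * p.γ))).add_const (p.μ₁ * p.δ)).sub_const (p.μ₀ * p.γ)
    simpa using h1.const_mul C
  have hu1 : HasDerivAt (fun y => u (t, y)) (fderiv ℝ u (t, x) (0, 1)) x :=
    hud.comp_hasDerivAt x (hasDerivAt_prodMk_right t x)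
  have huC : ContDiffAt ℝ ∞ (fun y => u (t, y)) x :=
    ContDiffAt.comp (g := u) x hu (by fun_prop)
  have hev : ∀ᶠ y in 𝓝 x, DifferentiableAt ℝ (fun y => u (t, y)) y :=
    ((huC.of_le (by norm_cast : (1 : WithTop ℕ∞) ≤ ∞)).eventually (by simp)).mono
      fun y hy => hy.differentiableAt (by simp)
  have hu2 : DifferentiableAt ℝ (deriv fun y => u (t, y)) x :=
    ((huC.fderiv_right (m := 1) (by norm_cast)).differentiableAt (by simp)).clm_apply
      (differentiableAt_const _)
  -- first derivatives
  have r0 : v y₀ = C * (2 * a * p.κ * (p.γ * t + p.δ) * u (t, x) - p.κ * p.γ * x + p.μ₁ * p.δ -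
      p.μ₀ * p.γ) := huv.self_of_nhds
  have r1 : p.κ / (p.γ * t + p.δ) * fderiv ℝ v y₀ (0, 1) =
      C * (2 * a * p.κ * (p.γ * t + p.δ) * fderiv ℝ u (t, x) (0, 1) - p.κ * p.γ) := by
    have h1 := HasFDerivAt.comp_hasDerivAt x hvd (hξx x)
    rw [hv2, zero_mul, zero_add] at h1
    have h2 := hux hu1.differentiableAt
    rw [hu1.deriv] at h2
    exact h1.unique (h2.congr_of_eventuallyEq hx)
  have r2 : (p.κ / (p.γ * t + p.δ)) ^ 2 * secondLineDeriv v y₀ (0, 1) =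
      C * (2 * a * p.κ * (p.γ * t + p.δ)) * secondLineDeriv u (t, x) (0, 1) := by
    have hc : deriv (fun y => ((p.mobius t,
        (p.κ * y + p.μ₁ * t + p.μ₀) / (p.γ * t + p.δ)) : ℝ × ℝ)) =
        fun _ => (0, p.κ / (p.γ * t + p.δ)) := funext fun y => (hξx y).deriv
    have h1 := deriv_deriv_comp_eq_secondLineDeriv (f := v) (τ := x) (c := fun y =>
      ((p.mobius t, (p.κ * y + p.μ₁ * t + p.μ₀) / (p.γ * t + p.δ)) : ℝ × ℝ)) hv (by fun_prop)
    rw [hc, deriv_const, map_zero, add_zero, hx.deriv.deriv_eq] at h1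
    have h2 : deriv (fun y => C * (2 * a * p.κ * (p.γ * t + p.δ) * u (t, y) - p.κ * p.γ * y +
        p.μ₁ * p.δ - p.μ₀ * p.γ)) =ᶠ[𝓝 x] fun y =>
        C * (2 * a * p.κ * (p.γ * t + p.δ) * deriv (fun y => u (t, y)) y - p.κ * p.γ) := by
      filter_upwards [hev] with y hy using (hux hy).deriv
    rw [h2.deriv_eq, (((hu2.hasDerivAt.const_mul (2 * a * p.κ * (p.γ * t + p.δ))).sub_const
      (p.κ * p.γ)).const_mul C).deriv, deriv_deriv_snd hu] at h1
    have h3 : secondLineDeriv v y₀ (0, p.κ / (p.γ * t + p.δ)) =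
        (p.κ / (p.γ * t + p.δ)) ^ 2 * secondLineDeriv v y₀ (0, 1) := by
      have : ((0, p.κ / (p.γ * t + p.δ)) : ℝ × ℝ) = (p.κ / (p.γ * t + p.δ)) • (0, 1) := by simp
      rw [secondLineDeriv_eq hv, secondLineDeriv_eq hv, this, map_smul, map_smul]
      simp only [smul_apply, smul_eq_mul]
      ring
    rw [← h3, ← h1]
    ring
  have r3 : D / (p.γ * t + p.δ) ^ 2 * fderiv ℝ v y₀ (1, 0) +
      (p.μ₁ * (p.γ * t + p.δ) - (p.κ * x + p.μ₁ * t + p.μ₀) * p.γ) / (p.γ * t + p.δ) ^ 2 *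
        fderiv ℝ v y₀ (0, 1) =
      C * (2 * a * p.κ * (p.γ * u (t, x) + (p.γ * t + p.δ) * fderiv ℝ u (t, x) (1, 0))) := by
    have h1 := HasFDerivAt.comp_hasDerivAt t hvd (hτ.prodMk hξt)
    rw [hv2] at h1
    have h2 : HasDerivAt (fun s => u (s, x)) (fderiv ℝ u (t, x) (1, 0)) t :=
      hud.comp_hasDerivAt t (hasDerivAt_prodMk_left t x)
    have h3 := (((((hd.const_mul (2 * a * p.κ)).mul h2).sub_const (p.κ * p.γ * x)).add_const
      (p.μ₁ * p.δ)).sub_const (p.μ₀ * p.γ)).const_mul C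
    have h4 := h3.congr_of_eventuallyEq
      ((hasDerivAt_prodMk_left t x).continuousAt.eventually huv)
    refine (h1.unique h4).trans ?_
    ring
  have hC0 : C * (2 * a * D) = p.σ := by rw [hC]; field_simp
  set d := p.γ * t + p.δ with hddef
  generalize fderiv ℝ v y₀ (1, 0) = V₁ at *
  generalize fderiv ℝ v y₀ (0, 1) = V₂ at *
  generalize secondLineDeriv v y₀ (0, 1) = V₃ at *
  have s1 : V₂ = C * (2 * a * d ^ 2 * fderiv ℝ u (t, x) (0, 1) - p.γ * d) := by
    field_simp at r1
    linear_combination r1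
  have s2 : V₃ = C * (2 * a * d ^ 3 / p.κ) * secondLineDeriv u (t, x) (0, 1) := by
    field_simp at r2 ⊢
    linear_combination r2
  have s3 : V₁ = (d ^ 2 * (C * (2 * a * p.κ * (p.γ * u (t, x) + d * fderiv ℝ u (t, x) (1, 0)))) -
      (p.μ₁ * d - (p.κ * x + p.μ₁ * t + p.μ₀) * p.γ) * V₂) / D := by
    rw [← r3]; field_simp; ring
  rw [r0, s3, s2, s1]
  have e : p.κ ^ 2 / D * g * (C * (2 * a * d ^ 3 / p.κ) * secondLineDeriv u (t, x) (0, 1)) =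
      C * (2 * a * d ^ 3) * p.κ / D * (g * secondLineDeriv u (t, x) (0, 1)) := by
    field_simp
  rw [e, ← hE]
  have e' : 2 * (a / p.σ) = 1 / (C * D) := by
    rw [← hC0]
    have : C ≠ 0 := div_ne_zero hσ (mul_ne_zero (mul_ne_zero two_ne_zero ha) hD)
    field_simp
  have hCne : C ≠ 0 := div_ne_zero hσ (mul_ne_zero (mul_ne_zero two_ne_zero ha) hD)
  rw [e']
  clear_value C D
  field_simp
  rw [hddef]
  ring

/-- A map that has the projective form on the slice over `E.a` maps `E` to an equation of the
class. -/
theorem exists_mapsEq_of_eq_toMap {Ω : Set ExtSpace} {Φ : ExtSpace → ExtSpace}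
    (hΩ : IsExtDomain Ω) (E : BurgersEq) (p : ProjParams)
    (h : ∀ z ∈ Ω, z.a = E.a → p.γ * z.t + p.δ ≠ 0 ∧ Φ z = p.toMap z) :
    ∃ E' : BurgersEq, MapsEq Ω Φ E E' := by
  -- The times occurring in the slice. Connectedness of the slice makes `J` an interval; it avoids
  -- the pole of the fractional linear map, so the image of `E.I ∩ J` is an interval as the class
  -- requires.
  set J : Set ℝ := (fun z : ExtSpace => z.t) '' {z ∈ Ω | z.a = E.a} with hJdef
  have hJ' : J.OrdConnected :=
    ((hΩ.slice_connected E.a).image _ continuous_fst.continuousOn).ordConnected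
  have hJ : IsOpen J := by
    rw [isOpen_iff_mem_nhds]
    rintro t ⟨z, ⟨hz, hza⟩, rfl⟩
    have hc : Continuous fun s : ℝ => ((s, z.x, z.u, z.a, z.g) : ExtSpace) := by fun_prop
    filter_upwards [hc.continuousAt.eventually (hΩ.isOpen.mem_nhds hz)] with s hs
    exact ⟨_, ⟨hs, hza⟩, rfl⟩
  have hp : ∀ t ∈ J, p.γ * t + p.δ ≠ 0 := by
    rintro t ⟨z, ⟨hz, hza⟩, rfl⟩
    exact (h z hz hza).1
  have hmem : ∀ {t x u : ℝ}, E.lift t x u ∈ Ω → t ∈ J := fun {t x u} hz =>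
    ⟨E.lift t x u, ⟨hz, rfl⟩, rfl⟩
  have hg : ∀ {t : ℝ}, t ∈ J → (p.imageEq E J hJ hJ' hp).g (p.mobius t) =
      p.κ ^ 2 / (p.α * p.δ - p.β * p.γ) * E.g t := by
    intro t ht
    change p.κ ^ 2 / (p.α * p.δ - p.β * p.γ) * E.g (p.inv.mobius (p.mobius t)) = _
    rw [(p.inv_mobius (hp t ht)).2]
  refine ⟨p.imageEq E J hJ hJ' hp, ⟨fun t x u ht hz => ?_, fun u v t x ht hz hu hv huv hE => ?_⟩⟩
  · rw [(h _ hz rfl).2]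
    exact ⟨rfl, ⟨t, ⟨ht, hmem hz⟩, rfl⟩, (hg (hmem hz)).symm⟩
  · have hEg : ContinuousAt E.g t :=
      (E.smooth_g.contDiffAt (E.isOpen_I.mem_nhds ht)).continuousAt
    have hlift : ContinuousAt (fun q : ℝ × ℝ => E.lift q.1 q.2 (u q)) (t, x) := by
      have hg' : ContinuousAt (fun q : ℝ × ℝ => E.g q.1) (t, x) :=
        ContinuousAt.comp (g := E.g) (f := Prod.fst) hEg continuousAt_fst
      exact continuousAt_fst.prodMk (continuousAt_snd.prodMk (hu.continuousAt.prodMk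
        (continuousAt_const.prodMk hg')))
    have huv' : ∀ᶠ q : ℝ × ℝ in 𝓝 (t, x),
        v (p.mobius q.1, (p.κ * q.2 + p.μ₁ * q.1 + p.μ₀) / (p.γ * q.1 + p.δ)) =
          p.σ / (2 * E.a * (p.α * p.δ - p.β * p.γ)) *
            (2 * E.a * p.κ * (p.γ * q.1 + p.δ) * u q - p.κ * p.γ * q.2 + p.μ₁ * p.δ -
              p.μ₀ * p.γ) := by
      filter_upwards [huv, hlift.eventually (hΩ.isOpen.mem_nhds hz)] with q hq hqΩ
      rw [(h _ hqΩ rfl).2] at hq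
      exact hq
    rw [(h _ hz rfl).2] at hv ⊢
    have hjet := (burgers_jet_iff hu E.a (E.g t)).1 hE
    refine (burgers_jet_iff hv _ _).2 ?_
    have := p.jet_rule E.a_ne_zero (hp t (hmem hz)) hu hv huv' hjet
    rw [← hg (hmem hz)] at this
    exact this

theorem ProjParams.isGenEquiv_toMap (p : ProjParams) {Ω : Set ExtSpace} (hΩ : IsExtDomain Ω)
    (hp : ∀ z ∈ Ω, p.γ * z.t + p.δ ≠ 0) : IsGenEquiv Ω p.toMap :=
  ⟨p.isPointTransformation_toMap hΩ hp, fun E =>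
    exists_mapsEq_of_eq_toMap hΩ E p fun z hz _ => ⟨hp z hz, rfl⟩⟩

/-! ### Gluing along slices and the main theorem. -/

/-- On each slice, a generalized equivalence transformation has the projective form. -/
theorem IsGenEquiv.exists_eq_toMap {Ω : Set ExtSpace} {Φ : ExtSpace → ExtSpace}
    (h : IsGenEquiv Ω Φ) (hΩ : IsExtDomain Ω) (a : ℝ) :
    ∃ p : ProjParams, ∀ z ∈ Ω, z.a = a → p.γ * z.t + p.δ ≠ 0 ∧ Φ z = p.toMap z := by
  by_cases hne : ∃ z₀ ∈ Ω, z₀.a = a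
  swap
  · exact ⟨ProjParams.one, fun z hz hza => (hne ⟨z, hz, hza⟩).elim⟩
  obtain ⟨z₀, hz₀, rfl⟩ := hne
  let Q : ProjParams → ExtSpace → Prop := fun p z =>
    ∀ᶠ y in 𝓝 z, y.a = z.a → p.γ * y.t + p.δ ≠ 0 ∧ Φ y = p.toMap y
  -- If `p` and `q` both describe `Φ` near one point, they are equivalent and define the same map,
  -- so `p` serves wherever `q` does.
  have hQ : ∀ {p q : ProjParams} {z w : ExtSpace}, z ∈ Ω → Q p z → Q q z → Q q w → Q p w := by
    intro p q z w hz hp hq hw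
    have e : q.Equivalent p := by
      refine ProjParams.equivalent_of_eventually (hΩ.a_ne_zero z hz) ?_
      filter_upwards [hp, hq] with y h1 h2 hy
      exact ⟨(h2 hy).1, (h1 hy).1, (h2 hy).2.symm.trans (h1 hy).2⟩
    filter_upwards [hw] with y h1 hy
    exact ⟨(e.toMap_eq y).1 (h1 hy).1, (h1 hy).2.trans (e.toMap_eq y).2⟩
  have key : ∀ z ∈ {z ∈ Ω | z.a = z₀.a}, ∃ p, Q p z₀ ∧ Q p z := by
    intro z hz
    -- Sharing a common `p` is a transitive and symmetric relation on the slice that holds between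
    -- nearby points, so by connectedness it holds between any two.
    refine (hΩ.slice_connected z₀.a).induction₂ (fun y w => ∃ p, Q p y ∧ Q p w) ?_ ?_ ?_
      ⟨hz₀, rfl⟩ hz
    · rintro y ⟨hy, hya⟩
      obtain ⟨p, hp⟩ := h.exists_eventually_eq_toMap hΩ hy
      filter_upwards [nhdsWithin_le_nhds hp.eventually_nhds, self_mem_nhdsWithin] with w hw hwS
      refine ⟨p, hp, ?_⟩
      filter_upwards [hw] with y' h1 h2
      exact h1 (h2.trans (hwS.2.trans hya.symm))
    · rintro y w x hy hw hx ⟨p, hp, hp'⟩ ⟨q, hq, hq'⟩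
      exact ⟨p, hp, hQ hw.1 hp' hq hq'⟩
    · rintro y w hy hw ⟨p, hp, hp'⟩
      exact ⟨p, hp', hp⟩
  obtain ⟨p₀, hp₀⟩ := h.exists_eventually_eq_toMap hΩ hz₀
  refine ⟨p₀, fun z hz hza => ?_⟩
  obtain ⟨p, hp, hp'⟩ := key z ⟨hz, hza⟩
  exact (hQ hz₀ hp₀ hp hp').self_of_nhds rfl

/-- The generalized equivalence group of the class `u_t + a (u ^ 2)_x = g(t) u_xx`. -/
theorem theorem2 :
    -- the generalized equivalence transformations are exactly the point transformations of the
    -- listed form; the parameters do not depend on `t, x, u, g`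
    (∀ (Ω : Set ExtSpace) (Φ : ExtSpace → ExtSpace), IsExtDomain Ω →
      (IsGenEquiv Ω Φ ↔
        IsPointTransformation Ω Φ ∧
          ∀ a : ℝ, ∃ p : ProjParams, ∀ z ∈ Ω, z.a = a →
            p.γ * z.t + p.δ ≠ 0 ∧ Φ z = p.toMap z)) ∧
    -- all the listed transformations, with any constants, belong to the group
    (∀ (p : ProjParams) (Ω : Set ExtSpace), IsExtDomain Ω →
      (∀ z ∈ Ω, p.γ * z.t + p.δ ≠ 0) → IsGenEquiv Ω p.toMap) ∧
    -- the constants are defined up to a nonzero multiplier of all of them but `σ`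
    (∀ (p q : ProjParams) (Ω : Set ExtSpace), IsExtDomain Ω →
      (∀ z ∈ Ω, p.γ * z.t + p.δ ≠ 0) → (∀ z ∈ Ω, q.γ * z.t + q.δ ≠ 0) →
      ∀ a : ℝ, (∃ z ∈ Ω, z.a = a) →
        ((∀ z ∈ Ω, z.a = a → p.toMap z = q.toMap z) ↔ p.Equivalent q)) ∧
    -- the listed transformations form a group: identity, composition, inverse
    (∃ e : ProjParams, ∀ z : ExtSpace, z.a ≠ 0 →
      e.γ * z.t + e.δ ≠ 0 ∧ e.toMap z = z) ∧
    (∀ p q : ProjParams, ∃ r : ProjParams, ∀ z : ExtSpace, z.a ≠ 0 →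
      p.γ * z.t + p.δ ≠ 0 → q.γ * (p.toMap z).t + q.δ ≠ 0 →
        r.γ * z.t + r.δ ≠ 0 ∧ q.toMap (p.toMap z) = r.toMap z) ∧
    (∀ p : ProjParams, ∃ r : ProjParams, ∀ z : ExtSpace, z.a ≠ 0 →
      p.γ * z.t + p.δ ≠ 0 →
        r.γ * (p.toMap z).t + r.δ ≠ 0 ∧ r.toMap (p.toMap z) = z) := by
  refine ⟨fun Ω Φ hΩ => ⟨fun h => ⟨h.isPointTransformation, h.exists_eq_toMap hΩ⟩, ?_⟩,
    fun p Ω hΩ hp => p.isGenEquiv_toMap hΩ hp, ?_, ⟨ProjParams.one, fun z hz =>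
      ProjParams.one_toMap hz⟩, fun p q => ⟨q.comp p, fun z hz hp hq => p.comp_toMap q hz hp hq⟩,
    fun p => ⟨p.inv, fun z hz hp => p.inv_toMap hz hp⟩⟩
  · rintro ⟨hΦ, h⟩
    refine ⟨hΦ, fun E => ?_⟩
    obtain ⟨p, hp⟩ := h E.a
    exact exists_mapsEq_of_eq_toMap hΩ E p hp
  · rintro p q Ω hΩ hp hq a ⟨z, hz, rfl⟩
    refine ⟨fun h => ?_, fun h y _ _ => (h.toMap_eq y).2⟩
    refine ProjParams.equivalent_of_eventually (hΩ.a_ne_zero z hz) ?_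
    filter_upwards [hΩ.isOpen.mem_nhds hz] with y hy hya
    exact ⟨hp y hy, hq y hy, h y hy hya⟩
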